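/- Let $E$ be a symmetric monoidal closed category, with tensor product $\otimes$, unit $1$ and internal hom $[x,y]$ (so $\mathrm{Hom}(x\otimes c,y)\cong\mathrm{Hom}(c,[x,y])$). Let $\mathbf E$ be the $E$-enriched category with the objects of $E$ and hom-objects $[x,y]$. With the enriched tensor product $[x,y]\otimes[x',y']\to[x\otimes x',y\otimes y']$ it is a symmetric monoidal $E$-category, and so is its opposite $\mathbf E^{\mathrm{op}}$. Let $\mathrm{CMon}_{\mathrm{lax}}(\mathrm{Cat}_E)$ be the monoidal 2-category whose objects are the symmetric monoidal $E$-categories, whose morphisms are the lax symmetric monoidal $E$-functors and whose 2-morphisms are the monoidal $E$-natural transformations; its tensor product is that of $E$-categories, with the tensor unit the one-object $E$-category with hom-object $1$. Every symmetric monoidal $E$-category $A$ is a pseudo-monoid in it: the multiplication is the functor $\otimes_A:A\otimes A\to A$ with the interchange $(a\otimes b)\otimes(a'\otimes b')\cong(a\otimes a')\otimes(b\otimes b')$ as its monoidal structure, the unit is the unit object, and the constraints are those of $A$. In particular $\mathbf E^{\mathrm{op}}$ is a pseudo-monoid. A right module over a pseudo-monoid $(A,\mu,\iota)$ is an object $M$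 with an action morphism $\kappa:M\otimes A\to M$ (write $m\cdot a$) and 2-morphisms $\alpha:(m\cdot a)\cdot b\to m\cdot(ab)$, i.e. $\kappa(\kappa\otimes\mathrm{id})\Rightarrow\kappa(\mathrm{id}\otimes\mu)$, and $\upsilon:m\to m\cdot 1$, i.e. $\mathrm{id}_M\Rightarrow\kappa(\mathrm{id}\otimes\iota)$ (up to the canonical isomorphisms of the tensor product), such that (leaving the constraints of $A$ unnamed) the two composites $$((m\cdot a)\cdot b)\cdot c\to(m\cdot a)\cdot(bc)\to m\cdot(a(bc)),\qquad ((m\cdot a)\cdot b)\cdot c\to(m\cdot(ab))\cdot c\to m\cdot((ab)c)\cong m\cdot(a(bc))$$ agree, and the two composites $$m\cdot a\xrightarrow{\upsilon\cdot a}(m\cdot1)\cdot a\xrightarrow{\alpha}m\cdot(1a)\cong m\cdot a,\qquad m\cdot a\xrightarrow{\upsilon}(m\cdot a)\cdot1\xrightarrow{\alpha}m\cdot(a1)\cong m\cdot a$$ are identities. It is strong if $\alpha$ and $\upsilon$ are invertible 2-morphisms. **Theorem.** The internal hom canonically makes $\mathbf E$ a strong right module over the pseudo-monoid $\mathbf E^{\mathrm{op}}$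 in $\mathrm{CMon}_{\mathrm{lax}}(\mathrm{Cat}_E)$. Explicitly: 1. The $E$-functor $\langle-,-\rangle:\mathbf E\otimes\mathbf E^{\mathrm{op}}\to\mathbf E$, $\langle y,x\rangle=[x,y]$, whose action on hom-objects $[y,y']\otimes[x',x]\to[[x,y],[x',y']]$ is the transpose of the composition $[x,y]\otimes[y,y']\otimes[x',x]\to[x',y']$, is lax symmetric monoidal, with the structure given by the morphism $1\to[1,1]$ that names $\mathrm{id}_1$ and the morphisms $[x,y]\otimes[x',y']\to[x\otimes x',y\otimes y']$ (tensor product of internal homs). 2. The currying morphisms $[x',[x,y]]\to[x\otimes x',y]$ are the components of a monoidal $E$-natural transformation $\langle\langle y,x\rangle,x'\rangle\to\langle y,x\otimes x'\rangle$, and the canonical morphisms $y\to[1,y]$ are the components of a monoidal $E$-natural transformation $y\to\langle y,1\rangle$. Both are invertible. 3. With $\langle-,-\rangle$ as action and these transformations as $\alpha$ and $\upsilon$, the pentagon and the two unit axioms above hold. -/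

import Mathlib

set_option linter.unusedSectionVars false
set_option linter.style.longLine false

open CategoryTheory MonoidalCategory BraidedCategory

universe v u w w₁ w₂ w₃ w₄ w₅ w₆

namespace EnrichedSM

section Elements

variable {V : Type u} [Category.{v} V] [MonoidalCategory V]
  {C : Type w₁} [EnrichedCategory V C] {D : Type w₂} [EnrichedCategory V D]

/-- Postcomposition of a generalized element of a hom-object with an element. -/
def postc {c : V} {x y z : C} (f : c ⟶ (x ⟶[V] y)) (b : 𝟙_ V ⟶ (y ⟶[V] z)) :
    c ⟶ (x ⟶[V] z) :=
  (ρ_ c).inv ≫ (f ⊗ₘ b) ≫ eComp V x y z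

/-- Precomposition of a generalized element of a hom-object with an element. -/
def prec {c : V} {x y z : C} (a : 𝟙_ V ⟶ (x ⟶[V] y)) (f : c ⟶ (y ⟶[V] z)) :
    c ⟶ (x ⟶[V] z) :=
  (λ_ c).inv ≫ (a ⊗ₘ f) ≫ eComp V x y z

/-- Composition (in diagrammatic order) of elements of hom-objects, that is, composition in the
underlying category. -/
def elComp {x y z : C} (a : 𝟙_ V ⟶ (x ⟶[V] y)) (b : 𝟙_ V ⟶ (y ⟶[V] z)) :
    𝟙_ V ⟶ (x ⟶[V] z) :=
  (λ_ (𝟙_ V)).inv ≫ (a ⊗ₘ b) ≫ eComp V x y z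

infixr:80 "⊚" => elComp

/-- The action of an enriched functor on elements of hom-objects. -/
def onEl (F : EnrichedFunctor V C D) {x y : C} (a : 𝟙_ V ⟶ (x ⟶[V] y)) :
    𝟙_ V ⟶ (F.obj x ⟶[V] F.obj y) :=
  a ≫ F.map x y

variable {c d : V} {x y z t : C}

theorem elComp_eq_prec (a : 𝟙_ V ⟶ (x ⟶[V] y)) (b : 𝟙_ V ⟶ (y ⟶[V] z)) :
    a ⊚ b = prec a b := rfl

theorem elComp_eq_postc (a : 𝟙_ V ⟶ (x ⟶[V] y)) (b : 𝟙_ V ⟶ (y ⟶[V] z)) :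
    a ⊚ b = postc a b := by
  simp [elComp, postc, unitors_inv_equal]

theorem comp_postc (h : d ⟶ c) (f : c ⟶ (x ⟶[V] y)) (b : 𝟙_ V ⟶ (y ⟶[V] z)) :
    postc (h ≫ f) b = h ≫ postc f b := by
  simp [postc, MonoidalCategory.tensorHom_def]

theorem comp_prec (h : d ⟶ c) (a : 𝟙_ V ⟶ (x ⟶[V] y)) (f : c ⟶ (y ⟶[V] z)) :
    prec a (h ≫ f) = h ≫ prec a f := by
  simp [prec, MonoidalCategory.tensorHom_def']

@[simp] theorem postc_id (f : c ⟶ (x ⟶[V] y)) : postc f (eId V y) = f := by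
  have := e_comp_id V x y
  simp only [postc, MonoidalCategory.tensorHom_def, Category.assoc]
  rw [← rightUnitor_inv_naturality_assoc, this, Category.comp_id]

@[simp] theorem id_prec (f : c ⟶ (x ⟶[V] y)) : prec (eId V x) f = f := by
  have := e_id_comp V x y
  simp only [prec, MonoidalCategory.tensorHom_def', Category.assoc]
  rw [← leftUnitor_inv_naturality_assoc, this, Category.comp_id]

theorem postc_eComp {c₁ c₂ : V} (f : c₁ ⟶ (x ⟶[V] y)) (g : c₂ ⟶ (y ⟶[V] z))
    (b : 𝟙_ V ⟶ (z ⟶[V] t)) :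
    postc ((f ⊗ₘ g) ≫ eComp V x y z) b = (f ⊗ₘ postc g b) ≫ eComp V x y t := by
  have := e_assoc' V x y z t
  simp only [postc, MonoidalCategory.tensorHom_def, Category.assoc, comp_whiskerRight, MonoidalCategory.whiskerLeft_comp]
  rw [← whisker_exchange_assoc (eComp V x y z) b, ← e_assoc' V x y z t]
  monoidal

theorem prec_eComp {c₁ c₂ : V} (a : 𝟙_ V ⟶ (x ⟶[V] y)) (f : c₁ ⟶ (y ⟶[V] z))
    (g : c₂ ⟶ (z ⟶[V] t)) :
    prec a ((f ⊗ₘ g) ≫ eComp V y z t) = (prec a f ⊗ₘ g) ≫ eComp V x z t := by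
  have := e_assoc V x y z t
  simp only [prec, MonoidalCategory.tensorHom_def', Category.assoc, comp_whiskerRight, MonoidalCategory.whiskerLeft_comp]
  rw [whisker_exchange_assoc, ← e_assoc V x y z t]
  monoidal

theorem postc_eq (f : c ⟶ (x ⟶[V] y)) (b : 𝟙_ V ⟶ (y ⟶[V] z)) :
    postc f b = (ρ_ c).inv ≫ (f ⊗ₘ b) ≫ eComp V x y z := rfl

theorem prec_eq (a : 𝟙_ V ⟶ (x ⟶[V] y)) (f : c ⟶ (y ⟶[V] z)) :
    prec a f = (λ_ c).inv ≫ (a ⊗ₘ f) ≫ eComp V x y z := rfl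

theorem postc_postc (f : c ⟶ (x ⟶[V] y)) (b : 𝟙_ V ⟶ (y ⟶[V] z)) (b' : 𝟙_ V ⟶ (z ⟶[V] t)) :
    postc (postc f b) b' = postc f (b ⊚ b') := by
  rw [elComp_eq_postc, postc_eq f b, comp_postc, postc_eComp, ← postc_eq]

theorem prec_postc (a : 𝟙_ V ⟶ (x ⟶[V] y)) (f : c ⟶ (y ⟶[V] z)) (b : 𝟙_ V ⟶ (z ⟶[V] t)) :
    postc (prec a f) b = prec a (postc f b) := by
  rw [prec_eq a f, comp_postc, postc_eComp, ← prec_eq]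

theorem prec_prec (a : 𝟙_ V ⟶ (x ⟶[V] y)) (a' : 𝟙_ V ⟶ (y ⟶[V] z)) (f : c ⟶ (z ⟶[V] t)) :
    prec a (prec a' f) = prec (a ⊚ a') f := by
  rw [elComp_eq_prec, prec_eq a' f, comp_prec, prec_eComp, ← prec_eq]

theorem elComp_assoc (a : 𝟙_ V ⟶ (x ⟶[V] y)) (b : 𝟙_ V ⟶ (y ⟶[V] z))
    (b' : 𝟙_ V ⟶ (z ⟶[V] t)) : (a ⊚ b) ⊚ b' = a ⊚ b ⊚ b' := by
  rw [elComp_eq_prec, ← prec_prec]; rfl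

@[simp] theorem elComp_id (a : 𝟙_ V ⟶ (x ⟶[V] y)) : a ⊚ eId V y = a := by
  rw [elComp_eq_postc, postc_id]

@[simp] theorem id_elComp (a : 𝟙_ V ⟶ (x ⟶[V] y)) : eId V x ⊚ a = a := by
  rw [elComp_eq_prec, id_prec]

theorem map_postc (F : EnrichedFunctor V C D) (f : c ⟶ (x ⟶[V] y)) (b : 𝟙_ V ⟶ (y ⟶[V] z)) :
    postc f b ≫ F.map x z = postc (f ≫ F.map x y) (onEl F b) := by
  simp [postc, onEl, tensorHom_comp_tensorHom_assoc]

theorem map_prec (F : EnrichedFunctor V C D) (a : 𝟙_ V ⟶ (x ⟶[V] y)) (f : c ⟶ (y ⟶[V] z)) :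
    prec a f ≫ F.map x z = prec (onEl F a) (f ≫ F.map y z) := by
  simp [prec, onEl, tensorHom_comp_tensorHom_assoc]

theorem onEl_comp (F : EnrichedFunctor V C D) (a : 𝟙_ V ⟶ (x ⟶[V] y)) (b : 𝟙_ V ⟶ (y ⟶[V] z)) :
    onEl F (a ⊚ b) = onEl F a ⊚ onEl F b := map_prec F a b

@[simp] theorem onEl_id (F : EnrichedFunctor V C D) (x : C) :
    onEl F (eId V x) = eId V (F.obj x) := F.map_id x

end Elements

section Auxiliary

variable {V : Type u} [Category.{v} V] [MonoidalCategory V]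

theorem comp_tensorHom' {X X' Y Z W : V} (h : X' ⟶ X) (f : X ⟶ Y) (g : Z ⟶ W) :
    (h ≫ f) ⊗ₘ g = h ▷ Z ≫ (f ⊗ₘ g) := by
  rw [← tensorHom_id, tensorHom_comp_tensorHom, Category.id_comp]

theorem tensorHom_comp' {X Y Z Z' W : V} (f : X ⟶ Y) (h : Z' ⟶ Z) (g : Z ⟶ W) :
    f ⊗ₘ (h ≫ g) = X ◁ h ≫ (f ⊗ₘ g) := by
  rw [← id_tensorHom, tensorHom_comp_tensorHom, Category.id_comp]

end Auxiliary

section Products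

variable {V : Type u} [Category.{v} V] [MonoidalCategory V] [BraidedCategory V]

theorem lam_tensorμ (X Y : V) :
    (λ_ (X ⊗ Y)).inv ≫ (λ_ (𝟙_ V)).inv ▷ (X ⊗ Y) ≫ tensorμ (𝟙_ V) (𝟙_ V) X Y =
      ((λ_ X).inv ⊗ₘ (λ_ Y).inv) := by
  rw [Iso.inv_comp_eq, tensor_left_unitality]
  simp [tensorHom_comp_tensorHom]

theorem rho_tensorμ (X Y : V) :
    (ρ_ (X ⊗ Y)).inv ≫ (X ⊗ Y) ◁ (λ_ (𝟙_ V)).inv ≫ tensorμ X Y (𝟙_ V) (𝟙_ V) =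
      ((ρ_ X).inv ⊗ₘ (ρ_ Y).inv) := by
  rw [Iso.inv_comp_eq, tensor_right_unitality]
  simp [tensorHom_comp_tensorHom]

theorem tensorμ_braid {V : Type u} [Category.{v} V] [MonoidalCategory V] [SymmetricCategory V]
    (A B X Y : V) :
    tensorμ A B X Y ≫ (β_ (A ⊗ X) (B ⊗ Y)).hom =
      ((β_ A B).hom ⊗ₘ (β_ X Y).hom) ≫ tensorμ B A Y X := by
  simp [tensorμ, SymmetricCategory.braiding_swap_eq_inv_braiding X B,
    MonoidalCategory.tensorHom_def]

/-- The tensor product of two enriched categories. -/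
instance prodEnriched (C : Type w₁) [EnrichedCategory V C] (D : Type w₂) [EnrichedCategory V D] :
    EnrichedCategory V (C × D) where
  Hom p q := (p.1 ⟶[V] q.1) ⊗ (p.2 ⟶[V] q.2)
  id p := (λ_ (𝟙_ V)).inv ≫ (eId V p.1 ⊗ₘ eId V p.2)
  comp p q r := tensorμ _ _ _ _ ≫ (eComp V p.1 q.1 r.1 ⊗ₘ eComp V p.2 q.2 r.2)
  id_comp p q := by
    have h := lam_tensorμ (p.1 ⟶[V] q.1) (p.2 ⟶[V] q.2)
    simp only [comp_whiskerRight, Category.assoc, tensorμ_natural_left_assoc,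
      tensorHom_comp_tensorHom]
    rw [reassoc_of% h, tensorHom_comp_tensorHom]
    simp
  comp_id p q := by
    have h := rho_tensorμ (p.1 ⟶[V] q.1) (p.2 ⟶[V] q.2)
    simp only [MonoidalCategory.whiskerLeft_comp, Category.assoc, tensorμ_natural_right_assoc,
      tensorHom_comp_tensorHom]
    rw [reassoc_of% h, tensorHom_comp_tensorHom]
    simp
  assoc p q r s := by
    have h := tensor_associativity (p.1 ⟶[V] q.1) (p.2 ⟶[V] q.2) (q.1 ⟶[V] r.1) (q.2 ⟶[V] r.2)
      (r.1 ⟶[V] s.1) (r.2 ⟶[V] s.2)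
    simp only [comp_whiskerRight, MonoidalCategory.whiskerLeft_comp, Category.assoc,
      tensorμ_natural_left_assoc, tensorμ_natural_right_assoc, tensorHom_comp_tensorHom]
    rw [Iso.inv_comp_eq, ← e_assoc', ← e_assoc', ← tensorHom_comp_tensorHom, reassoc_of% h]

/-- The unit enriched category, with one object. -/
instance unitEnriched : EnrichedCategory V PUnit.{w + 1} where
  Hom _ _ := 𝟙_ V
  id _ := 𝟙 _
  comp _ _ _ := (λ_ (𝟙_ V)).hom
  id_comp _ _ := by simp
  comp_id _ _ := by simp [unitors_equal]
  assoc _ _ _ _ := by simp [unitors_equal]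

variable {C : Type w₁} [EnrichedCategory V C] {D : Type w₂} [EnrichedCategory V D]
  {C' : Type w₃} [EnrichedCategory V C'] {D' : Type w₄} [EnrichedCategory V D']

theorem prod_eComp (p q r : C × D) : eComp V p q r =
    tensorμ _ _ _ _ ≫ (eComp V p.1 q.1 r.1 ⊗ₘ eComp V p.2 q.2 r.2) := rfl

theorem prod_eId (p : C × D) :
    eId V p = (λ_ (𝟙_ V)).inv ≫ (eId V p.1 ⊗ₘ eId V p.2) := rfl

/-- The element of a hom-object of a tensor product given by a pair of elements. -/
def pairEl {x y : C} {x' y' : D} (a : 𝟙_ V ⟶ (x ⟶[V] y)) (b : 𝟙_ V ⟶ (x' ⟶[V] y')) :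
    𝟙_ V ⟶ ((x, x') ⟶[V] (y, y')) :=
  (λ_ (𝟙_ V)).inv ≫ (a ⊗ₘ b)

/-- The tensor product of two generalized elements. -/
def pairGen {c d : V} {x y : C} {x' y' : D} (f : c ⟶ (x ⟶[V] y)) (g : d ⟶ (x' ⟶[V] y')) :
    c ⊗ d ⟶ ((x, x') ⟶[V] (y, y')) := f ⊗ₘ g

section
variable {c d : V} {x y z : C} {x' y' z' : D}

theorem pairGen_postc (f : c ⟶ (x ⟶[V] y)) (g : d ⟶ (x' ⟶[V] y')) (b : 𝟙_ V ⟶ (y ⟶[V] z))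
    (b' : 𝟙_ V ⟶ (y' ⟶[V] z')) :
    postc (pairGen f g) (pairEl b b') = pairGen (postc f b) (postc g b') := by
  have h := rho_tensorμ c d
  simp only [postc, pairGen, pairEl, prod_eComp]
  have e : (f ⊗ₘ g) ⊗ₘ ((λ_ (𝟙_ V)).inv ≫ (b ⊗ₘ b')) =
      (c ⊗ d) ◁ (λ_ (𝟙_ V)).inv ≫ ((f ⊗ₘ g) ⊗ₘ (b ⊗ₘ b')) := by
    rw [tensorHom_comp']
  rw [e, Category.assoc, tensorμ_natural_assoc, reassoc_of% h, tensorHom_comp_tensorHom,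
    tensorHom_comp_tensorHom]

theorem pairGen_prec (a : 𝟙_ V ⟶ (x ⟶[V] y)) (a' : 𝟙_ V ⟶ (x' ⟶[V] y')) (f : c ⟶ (y ⟶[V] z))
    (g : d ⟶ (y' ⟶[V] z')) :
    prec (pairEl a a') (pairGen f g) = pairGen (prec a f) (prec a' g) := by
  have h := lam_tensorμ c d
  simp only [prec, pairGen, pairEl, prod_eComp]
  have e : ((λ_ (𝟙_ V)).inv ≫ (a ⊗ₘ a')) ⊗ₘ (f ⊗ₘ g) =
      (λ_ (𝟙_ V)).inv ▷ (c ⊗ d) ≫ ((a ⊗ₘ a') ⊗ₘ (f ⊗ₘ g)) := by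
    rw [comp_tensorHom']
  rw [e, Category.assoc, tensorμ_natural_assoc, reassoc_of% h, tensorHom_comp_tensorHom,
    tensorHom_comp_tensorHom]

theorem pairEl_comp (a : 𝟙_ V ⟶ (x ⟶[V] y)) (a' : 𝟙_ V ⟶ (x' ⟶[V] y'))
    (b : 𝟙_ V ⟶ (y ⟶[V] z)) (b' : 𝟙_ V ⟶ (y' ⟶[V] z')) :
    pairEl a a' ⊚ pairEl b b' = pairEl (a ⊚ b) (a' ⊚ b') := by
  have h := pairGen_prec a a' b b'
  have e : pairEl b b' = (λ_ (𝟙_ V)).inv ≫ pairGen b b' := rfl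
  rw [elComp_eq_prec, e, comp_prec, h]
  rfl

@[simp] theorem pairEl_id (x : C) (x' : D) : pairEl (eId V x) (eId V x') = eId V (x, x') := rfl

end

/-- The tensor product of two enriched functors. -/
@[simps]
def prodF (F : EnrichedFunctor V C C') (G : EnrichedFunctor V D D') :
    EnrichedFunctor V (C × D) (C' × D') where
  obj p := (F.obj p.1, G.obj p.2)
  map p q := F.map p.1 q.1 ⊗ₘ G.map p.2 q.2
  map_id p := by
    simp [prod_eId, tensorHom_comp_tensorHom]
  map_comp p q r := by
    simp only [prod_eComp, Category.assoc, tensorHom_comp_tensorHom, EnrichedFunctor.map_comp]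
    rw [tensorμ_natural_assoc, tensorHom_comp_tensorHom]

/-- The associativity isomorphism of the tensor product of enriched categories. -/
@[simps]
def assocF (C : Type w₁) [EnrichedCategory V C] (D : Type w₂) [EnrichedCategory V D]
    (D' : Type w₄) [EnrichedCategory V D'] :
    EnrichedFunctor V ((C × D) × D') (C × (D × D')) where
  obj p := (p.1.1, (p.1.2, p.2))
  map p q := (α_ (p.1.1 ⟶[V] q.1.1) (p.1.2 ⟶[V] q.1.2) (p.2 ⟶[V] q.2)).hom
  map_id p := by
    simp only [prod_eId, Category.assoc]
    have e : ((λ_ (𝟙_ V)).inv ≫ (eId V p.1.1 ⊗ₘ eId V p.1.2)) ⊗ₘ eId V p.2 =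
      (λ_ (𝟙_ V)).inv ▷ _ ≫ ((eId V p.1.1 ⊗ₘ eId V p.1.2) ⊗ₘ eId V p.2) := by
      simp [MonoidalCategory.tensorHom_def]
    have e' : eId V p.1.1 ⊗ₘ ((λ_ (𝟙_ V)).inv ≫ (eId V p.1.2 ⊗ₘ eId V p.2)) =
      _ ◁ (λ_ (𝟙_ V)).inv ≫ (eId V p.1.1 ⊗ₘ (eId V p.1.2 ⊗ₘ eId V p.2)) := by
      simp [MonoidalCategory.tensorHom_def']
    rw [e, e', Category.assoc, associator_naturality]
    simp [unitors_inv_equal]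
  map_comp p q r := by
    have h := associator_monoidal (p.1.1 ⟶[V] q.1.1) (p.1.2 ⟶[V] q.1.2) (p.2 ⟶[V] q.2)
      (q.1.1 ⟶[V] r.1.1) (q.1.2 ⟶[V] r.1.2) (q.2 ⟶[V] r.2)
    simp only [prod_eComp, Category.assoc]
    have e : (tensorμ (p.1.1 ⟶[V] q.1.1) (p.1.2 ⟶[V] q.1.2) (q.1.1 ⟶[V] r.1.1)
        (q.1.2 ⟶[V] r.1.2) ≫ (eComp V p.1.1 q.1.1 r.1.1 ⊗ₘ eComp V p.1.2 q.1.2 r.1.2)) ⊗ₘ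
        eComp V p.2 q.2 r.2 = tensorμ _ _ _ _ ▷ _ ≫ ((eComp V p.1.1 q.1.1 r.1.1 ⊗ₘ
          eComp V p.1.2 q.1.2 r.1.2) ⊗ₘ eComp V p.2 q.2 r.2) := by
      simp [MonoidalCategory.tensorHom_def]
    have e' : eComp V p.1.1 q.1.1 r.1.1 ⊗ₘ (tensorμ (p.1.2 ⟶[V] q.1.2) (p.2 ⟶[V] q.2)
        (q.1.2 ⟶[V] r.1.2) (q.2 ⟶[V] r.2) ≫ (eComp V p.1.2 q.1.2 r.1.2 ⊗ₘ eComp V p.2 q.2 r.2)) =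
        _ ◁ tensorμ _ _ _ _ ≫ (eComp V p.1.1 q.1.1 r.1.1 ⊗ₘ
          (eComp V p.1.2 q.1.2 r.1.2 ⊗ₘ eComp V p.2 q.2 r.2)) := by
      simp [MonoidalCategory.tensorHom_def']
    rw [e, e', Category.assoc, associator_naturality]
    exact (reassoc_of% h) _

/-- The symmetry isomorphism of the tensor product of enriched categories. -/
@[simps]
def swapF (V : Type u) [Category.{v} V] [MonoidalCategory V] [SymmetricCategory V]
    (C : Type w₁) [EnrichedCategory V C] (D : Type w₂) [EnrichedCategory V D] :
    EnrichedFunctor V (C × D) (D × C) where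
  obj p := (p.2, p.1)
  map p q := (β_ (p.1 ⟶[V] q.1) (p.2 ⟶[V] q.2)).hom
  map_id p := by
    simp only [prod_eId, Category.assoc]
    rw [braiding_naturality]
    simp [unitors_inv_equal]
  map_comp p q r := by
    simp only [prod_eComp, Category.assoc]
    rw [braiding_naturality]
    exact (reassoc_of% tensorμ_braid (p.1 ⟶[V] q.1) (p.2 ⟶[V] q.2) (q.1 ⟶[V] r.1)
      (q.2 ⟶[V] r.2)) _

/-- The left unit isomorphism of the tensor product of enriched categories. -/
@[simps]
def leftUnitF (C : Type w₁) [EnrichedCategory V C] :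
    EnrichedFunctor V (PUnit.{w + 1} × C) C where
  obj p := p.2
  map p q := (λ_ (p.2 ⟶[V] q.2)).hom
  map_id p := by
    simp only [prod_eId, Category.assoc]
    have e : eId V p.1 ⊗ₘ eId V p.2 = 𝟙_ V ◁ eId V p.2 := by
      change 𝟙 _ ⊗ₘ _ = _
      simp
    rw [e, leftUnitor_naturality]
    simp
  map_comp p q r := by
    have h := leftUnitor_monoidal (p.2 ⟶[V] q.2) (q.2 ⟶[V] r.2)
    have e : eComp V p.1 q.1 r.1 ⊗ₘ eComp V p.2 q.2 r.2 =
        (λ_ (𝟙_ V)).hom ▷ _ ≫ _ ◁ eComp V p.2 q.2 r.2 :=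
      MonoidalCategory.tensorHom_def _ _
    simp only [prod_eComp, Category.assoc]
    rw [e, Category.assoc, leftUnitor_naturality]
    exact ((reassoc_of% h) _).symm

/-- The right unit isomorphism of the tensor product of enriched categories. -/
@[simps]
def rightUnitF (C : Type w₁) [EnrichedCategory V C] :
    EnrichedFunctor V (C × PUnit.{w + 1}) C where
  obj p := p.1
  map p q := (ρ_ (p.1 ⟶[V] q.1)).hom
  map_id p := by
    simp only [prod_eId, Category.assoc]
    have e : eId V p.1 ⊗ₘ eId V p.2 = eId V p.1 ▷ 𝟙_ V := by
      change _ ⊗ₘ 𝟙 _ = _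
      simp
    rw [e, rightUnitor_naturality]
    rw [← unitors_equal, Iso.inv_hom_id_assoc]
  map_comp p q r := by
    have h := rightUnitor_monoidal (p.1 ⟶[V] q.1) (q.1 ⟶[V] r.1)
    have e : eComp V p.1 q.1 r.1 ⊗ₘ eComp V p.2 q.2 r.2 =
        _ ◁ (λ_ (𝟙_ V)).hom ≫ eComp V p.1 q.1 r.1 ▷ _ :=
      MonoidalCategory.tensorHom_def' _ _
    simp only [prod_eComp, Category.assoc]
    rw [e, Category.assoc, rightUnitor_naturality]
    exact ((reassoc_of% h) _).symm

/-- The enriched functor from the unit enriched category that picks an object. -/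
@[simps]
def pointF {C : Type w₁} [EnrichedCategory V C] (x : C) :
    EnrichedFunctor V PUnit.{w + 1} C where
  obj _ := x
  map _ _ := eId V x
  map_id _ := Category.id_comp _
  map_comp _ _ _ := by
    have := id_prec (eId V x)
    rw [prec_eq, Iso.inv_comp_eq] at this
    exact this.symm

end Products

section Transformations

variable {V : Type u} [Category.{v} V] [MonoidalCategory V]
  {C : Type w₁} [EnrichedCategory V C] {D : Type w₂} [EnrichedCategory V D]

/-- Enriched natural transformations. Naturality is an equality of morphisms
`(x ⟶[V] y) ⟶ (F x ⟶[V] G y)` of `V`. -/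
structure ENatTrans (F G : EnrichedFunctor V C D) where
  app (x : C) : 𝟙_ V ⟶ (F.obj x ⟶[V] G.obj x)
  naturality (x y : C) : postc (F.map x y) (app y) = prec (app x) (G.map x y)

/-- Invertible enriched natural transformations. -/
structure ENatIso (F G : EnrichedFunctor V C D) where
  hom : ENatTrans F G
  inv : ENatTrans G F
  hom_inv (x : C) : hom.app x ⊚ inv.app x = eId V (F.obj x)
  inv_hom (x : C) : inv.app x ⊚ hom.app x = eId V (G.obj x)

theorem ENatTrans.naturality_el {F G : EnrichedFunctor V C D} (t : ENatTrans F G) {x y : C}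
    (a : 𝟙_ V ⟶ (x ⟶[V] y)) : onEl F a ⊚ t.app y = t.app x ⊚ onEl G a := by
  rw [elComp_eq_postc, elComp_eq_prec, onEl, comp_postc, t.naturality, onEl, comp_prec]

theorem ENatIso.inv_naturality_el {F G : EnrichedFunctor V C D} (t : ENatIso F G) {x y : C}
    (a : 𝟙_ V ⟶ (x ⟶[V] y)) : onEl G a ⊚ t.inv.app y = t.inv.app x ⊚ onEl F a :=
  t.inv.naturality_el a

/-- The square of generalized elements that expresses naturality composes vertically. -/
theorem square_comp {c : V} {x y x' y' x'' y'' : C} {f : c ⟶ (x ⟶[V] y)} {g : c ⟶ (x' ⟶[V] y')}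
    {h : c ⟶ (x'' ⟶[V] y'')}
    {a : 𝟙_ V ⟶ (x ⟶[V] x')} {b : 𝟙_ V ⟶ (y ⟶[V] y')}
    {a' : 𝟙_ V ⟶ (x' ⟶[V] x'')} {b' : 𝟙_ V ⟶ (y' ⟶[V] y'')}
    (h₁ : postc f b = prec a g) (h₂ : postc g b' = prec a' h) :
    postc f (b ⊚ b') = prec (a ⊚ a') h := by
  rw [← postc_postc, h₁, prec_postc, h₂, prec_prec]

theorem square_map (F : EnrichedFunctor V C D) {c : V} {x y x' y' : C} {f : c ⟶ (x ⟶[V] y)}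
    {g : c ⟶ (x' ⟶[V] y')} {a : 𝟙_ V ⟶ (x ⟶[V] x')} {b : 𝟙_ V ⟶ (y ⟶[V] y')}
    (h₁ : postc f b = prec a g) :
    postc (f ≫ F.map x y) (onEl F b) = prec (onEl F a) (g ≫ F.map x' y') := by
  rw [← map_postc, h₁, map_prec]

theorem square_precomp {c d : V} (k : d ⟶ c) {x y x' y' : C} {f : c ⟶ (x ⟶[V] y)}
    {g : c ⟶ (x' ⟶[V] y')} {a : 𝟙_ V ⟶ (x ⟶[V] x')} {b : 𝟙_ V ⟶ (y ⟶[V] y')}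
    (h₁ : postc f b = prec a g) :
    postc (k ≫ f) b = prec a (k ≫ g) := by
  rw [comp_postc, h₁, comp_prec]

theorem square_inv {c : V} {x y x' y' : C} {f : c ⟶ (x ⟶[V] y)}
    {g : c ⟶ (x' ⟶[V] y')} {a : 𝟙_ V ⟶ (x ⟶[V] x')} {b : 𝟙_ V ⟶ (y ⟶[V] y')}
    {a' : 𝟙_ V ⟶ (x' ⟶[V] x)} {b' : 𝟙_ V ⟶ (y' ⟶[V] y)}
    (ha : a' ⊚ a = eId V _) (hb : b ⊚ b' = eId V _)
    (h₁ : postc f b = prec a g) :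
    postc g b' = prec a' f := by
  have h₂ : prec a' (prec a g) = g := by rw [prec_prec, ha, id_prec]
  rw [← h₂, ← h₁, prec_postc, postc_postc, hb, postc_id]

theorem square_id {c : V} {x y : C} (f : c ⟶ (x ⟶[V] y)) :
    postc f (eId V y) = prec (eId V x) f := by simp

end Transformations

section Square2
variable {V : Type u} [Category.{v} V] [MonoidalCategory V] [BraidedCategory V]
  {C : Type w₁} [EnrichedCategory V C] {D : Type w₂} [EnrichedCategory V D]

theorem square_prod {c d : V} {x y x' y' : C} {f : c ⟶ (x ⟶[V] y)}
    {g : c ⟶ (x' ⟶[V] y')} {a : 𝟙_ V ⟶ (x ⟶[V] x')} {b : 𝟙_ V ⟶ (y ⟶[V] y')}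
    {X Y X' Y' : D} {f' : d ⟶ (X ⟶[V] Y)}
    {g' : d ⟶ (X' ⟶[V] Y')} {a' : 𝟙_ V ⟶ (X ⟶[V] X')} {b' : 𝟙_ V ⟶ (Y ⟶[V] Y')}
    (h : postc f b = prec a g) (h' : postc f' b' = prec a' g') :
    postc (pairGen f f') (pairEl b b') = prec (pairEl a a') (pairGen g g') := by
  rw [pairGen_postc, pairGen_prec, h, h']
end Square2

section Symmetric

variable (V : Type u) [Category.{v} V] [MonoidalCategory V] [SymmetricCategory V]

/-- Symmetric monoidal enriched categories: symmetric pseudo-monoids in the monoidal 2-category of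
enriched categories. Equalities of 2-morphisms are stated on components. -/
class SymMonECategory (C : Type w) [EnrichedCategory V C] where
  tens : EnrichedFunctor V (C × C) C
  unit : C
  associator : ENatIso ((prodF tens (EnrichedFunctor.id V C)).comp V tens)
    ((assocF C C C).comp V ((prodF (EnrichedFunctor.id V C) tens).comp V tens))
  leftUnitor : ENatIso
    ((prodF (pointF.{v, u, 0} (V := V) unit) (EnrichedFunctor.id V C)).comp V tens) (leftUnitF C)
  rightUnitor : ENatIso
    ((prodF (EnrichedFunctor.id V C) (pointF.{v, u, 0} (V := V) unit)).comp V tens) (rightUnitF C)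
  braiding : ENatTrans tens ((swapF V C C).comp V tens)
  pentagon (x y z t : C) :
    onEl tens (pairEl (associator.hom.app ((x, y), z)) (eId V t)) ⊚
      associator.hom.app ((x, tens.obj (y, z)), t) ⊚
        onEl tens (pairEl (eId V x) (associator.hom.app ((y, z), t))) =
      associator.hom.app ((tens.obj (x, y), z), t) ⊚ associator.hom.app ((x, y), tens.obj (z, t))
  triangle (x y : C) :
    associator.hom.app ((x, unit), y) ⊚ onEl tens (pairEl (eId V x) (leftUnitor.hom.app (⟨⟩, y))) =
      onEl tens (pairEl (rightUnitor.hom.app (x, ⟨⟩)) (eId V y))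
  hexagon (x y z : C) :
    associator.hom.app ((x, y), z) ⊚ braiding.app (x, tens.obj (y, z)) ⊚
        associator.hom.app ((y, z), x) =
      onEl tens (pairEl (braiding.app (x, y)) (eId V z)) ⊚ associator.hom.app ((y, x), z) ⊚
        onEl tens (pairEl (eId V y) (braiding.app (x, z)))
  symmetry (x y : C) : braiding.app (x, y) ⊚ braiding.app (y, x) = eId V (tens.obj (x, y))

end Symmetric

theorem hexagon_reverse_of_forward {C : Type u} [Category.{v} C] [MonoidalCategory C]
    (b : ∀ X Y : C, X ⊗ Y ≅ Y ⊗ X) (sym : ∀ X Y, (b X Y).hom ≫ (b Y X).hom = 𝟙 _)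
    (hex : ∀ X Y Z : C, (α_ X Y Z).hom ≫ (b X (Y ⊗ Z)).hom ≫ (α_ Y Z X).hom =
        ((b X Y).hom ▷ Z) ≫ (α_ Y X Z).hom ≫ (Y ◁ (b X Z).hom)) (X Y Z : C) :
    (α_ X Y Z).inv ≫ (b (X ⊗ Y) Z).hom ≫ (α_ Z X Y).inv =
        (X ◁ (b Y Z).hom) ≫ (α_ X Z Y).inv ≫ ((b X Z).hom ▷ Y) := by
  have sym' : ∀ X Y, (b X Y).hom = (b Y X).inv := fun X Y => by
    rw [← Iso.cancel_iso_hom_right _ _ (b Y X), sym, Iso.inv_hom_id]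
  have h := congrArg (fun i : (Z ⊗ X) ⊗ Y ≅ X ⊗ Y ⊗ Z => i.inv)
    (Iso.ext (α := α_ Z X Y ≪≫ b Z (X ⊗ Y) ≪≫ α_ X Y Z)
      (β := whiskerRightIso (b Z X) Y ≪≫ α_ X Z Y ≪≫ whiskerLeftIso X (b Z Y))
      (by simpa using hex Z X Y))
  simpa [sym' (X ⊗ Y) Z, sym' Y Z, sym' X Z] using h

section Underlying

variable (V : Type u) [Category.{v} V] [MonoidalCategory V]

/-- The underlying category of an enriched category, as a type synonym. -/
def Und (C : Type w) [EnrichedCategory V C] : Type w := C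

/-- The underlying category of an enriched category. -/
instance undCategory (C : Type w) [EnrichedCategory V C] : Category (Und V C) where
  Hom x y := 𝟙_ V ⟶ (EnrichedCategory.Hom (V := V) (C := C) x y)
  id x := eId (C := C) V x
  comp a b := elComp (C := C) a b
  id_comp a := id_elComp (C := C) a
  comp_id a := elComp_id (C := C) a
  assoc a b c := elComp_assoc (C := C) a b c

variable [SymmetricCategory V] {C : Type w} [EnrichedCategory V C] [SymMonECategory V C]

/-- The tensor product of objects of a symmetric monoidal enriched category. -/
abbrev tObj (x y : C) : C := (SymMonECategory.tens (V := V)).obj (x, y)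

variable (C) in
/-- The unit object of a symmetric monoidal enriched category. -/
abbrev unitObj : C := SymMonECategory.unit V

variable {V} in
/-- The tensor product of morphisms of the underlying category. -/
def tEl {x y x' y' : C} (a : 𝟙_ V ⟶ (x ⟶[V] y)) (b : 𝟙_ V ⟶ (x' ⟶[V] y')) :
    𝟙_ V ⟶ (tObj V x x' ⟶[V] tObj V y y') :=
  onEl SymMonECategory.tens (pairEl a b)

/-- The components of the associativity constraint. -/
def aHom (x y z : C) : 𝟙_ V ⟶ (tObj V (tObj V x y) z ⟶[V] tObj V x (tObj V y z)) :=
  SymMonECategory.associator.hom.app ((x, y), z)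

/-- The components of the inverse associativity constraint. -/
def aInv (x y z : C) : 𝟙_ V ⟶ (tObj V x (tObj V y z) ⟶[V] tObj V (tObj V x y) z) :=
  SymMonECategory.associator.inv.app ((x, y), z)

/-- The components of the left unit constraint. -/
def lHom (x : C) : 𝟙_ V ⟶ (tObj V (unitObj V C) x ⟶[V] x) :=
  SymMonECategory.leftUnitor.hom.app (⟨⟩, x)

/-- The components of the inverse left unit constraint. -/
def lInv (x : C) : 𝟙_ V ⟶ (x ⟶[V] tObj V (unitObj V C) x) :=
  SymMonECategory.leftUnitor.inv.app (⟨⟩, x)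

/-- The components of the right unit constraint. -/
def rHom (x : C) : 𝟙_ V ⟶ (tObj V x (unitObj V C) ⟶[V] x) :=
  SymMonECategory.rightUnitor.hom.app (x, ⟨⟩)

/-- The components of the inverse right unit constraint. -/
def rInv (x : C) : 𝟙_ V ⟶ (x ⟶[V] tObj V x (unitObj V C)) :=
  SymMonECategory.rightUnitor.inv.app (x, ⟨⟩)

/-- The components of the symmetry. -/
def bHom (x y : C) : 𝟙_ V ⟶ (tObj V x y ⟶[V] tObj V y x) :=
  SymMonECategory.braiding.app (x, y)

variable {V}

theorem tEl_comp {x y z x' y' z' : C} (a : 𝟙_ V ⟶ (x ⟶[V] y)) (b : 𝟙_ V ⟶ (y ⟶[V] z))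
    (a' : 𝟙_ V ⟶ (x' ⟶[V] y')) (b' : 𝟙_ V ⟶ (y' ⟶[V] z')) :
    tEl (a ⊚ b) (a' ⊚ b') = tEl a a' ⊚ tEl b b' := by
  rw [tEl, ← pairEl_comp, onEl_comp]; rfl

@[simp] theorem tEl_id (x y : C) : tEl (eId V x) (eId V y) = eId V (tObj V x y) := by
  rw [tEl, pairEl_id, onEl_id]

theorem onEl_id_functor {C : Type w} [EnrichedCategory V C] {x y : C} (a : 𝟙_ V ⟶ (x ⟶[V] y)) :
    onEl (EnrichedFunctor.id V C) a = a := Category.comp_id _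

theorem onEl_comp_functor {C : Type w₁} [EnrichedCategory V C] {D : Type w₂} [EnrichedCategory V D]
    {E : Type w₃} [EnrichedCategory V E] (F : EnrichedFunctor V C D) (G : EnrichedFunctor V D E)
    {x y : C} (a : 𝟙_ V ⟶ (x ⟶[V] y)) : onEl (F.comp V G) a = onEl G (onEl F a) := by
  exact (Category.assoc _ _ _).symm

theorem onEl_prodF {C : Type w₁} [EnrichedCategory V C] {D : Type w₂} [EnrichedCategory V D]
    {C' : Type w₃} [EnrichedCategory V C'] {D' : Type w₄} [EnrichedCategory V D']
    (F : EnrichedFunctor V C C') (G : EnrichedFunctor V D D') {x y : C} {x' y' : D}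
    (a : 𝟙_ V ⟶ (x ⟶[V] y)) (b : 𝟙_ V ⟶ (x' ⟶[V] y')) :
    onEl (prodF F G) (pairEl a b) = pairEl (onEl F a) (onEl G b) := by
  exact (Category.assoc _ _ _).trans (congrArg _ (tensorHom_comp_tensorHom _ _ _ _))

theorem onEl_assocF {C : Type w₁} [EnrichedCategory V C] {D : Type w₂} [EnrichedCategory V D]
    {E : Type w₃} [EnrichedCategory V E] {x y : C} {x' y' : D} {x'' y'' : E}
    (a : 𝟙_ V ⟶ (x ⟶[V] y)) (b : 𝟙_ V ⟶ (x' ⟶[V] y')) (c : 𝟙_ V ⟶ (x'' ⟶[V] y'')) :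
    onEl (assocF C D E) (pairEl (pairEl a b) c) = pairEl a (pairEl b c) := by
  have key : ∀ {X Y Z : V} (a : 𝟙_ V ⟶ X) (b : 𝟙_ V ⟶ Y) (c : 𝟙_ V ⟶ Z),
      ((λ_ (𝟙_ V)).inv ≫ (((λ_ (𝟙_ V)).inv ≫ (a ⊗ₘ b)) ⊗ₘ c)) ≫ (α_ X Y Z).hom =
        (λ_ (𝟙_ V)).inv ≫ (a ⊗ₘ ((λ_ (𝟙_ V)).inv ≫ (b ⊗ₘ c))) := by
    intro X Y Z a b c
    rw [comp_tensorHom', tensorHom_comp', Category.assoc, Category.assoc, associator_naturality]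
    simp [unitors_inv_equal]
  exact key a b c

theorem onEl_swapF {C : Type w₁} [EnrichedCategory V C] {D : Type w₂} [EnrichedCategory V D]
    {x y : C} {x' y' : D}
    (a : 𝟙_ V ⟶ (x ⟶[V] y)) (b : 𝟙_ V ⟶ (x' ⟶[V] y')) :
    onEl (swapF V C D) (pairEl a b) = pairEl b a := by
  have key : ∀ {X Y : V} (a : 𝟙_ V ⟶ X) (b : 𝟙_ V ⟶ Y),
      ((λ_ (𝟙_ V)).inv ≫ (a ⊗ₘ b)) ≫ (β_ X Y).hom = (λ_ (𝟙_ V)).inv ≫ (b ⊗ₘ a) := by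
    intro X Y a b
    rw [Category.assoc, braiding_naturality]
    simp [unitors_inv_equal]
  exact key a b

theorem onEl_leftUnitF {C : Type w₁} [EnrichedCategory V C] {x y : C}
    (a : 𝟙_ V ⟶ (x ⟶[V] y)) :
    onEl (leftUnitF C) (pairEl (eId V (⟨⟩ : PUnit.{w + 1})) a) = a := by
  have key : ∀ {X : V} (a : 𝟙_ V ⟶ X),
      ((λ_ (𝟙_ V)).inv ≫ (𝟙 (𝟙_ V) ⊗ₘ a)) ≫ (λ_ X).hom = a := by
    intro X a
    simp
  exact key a

theorem onEl_rightUnitF {C : Type w₁} [EnrichedCategory V C] {x y : C}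
    (a : 𝟙_ V ⟶ (x ⟶[V] y)) :
    onEl (rightUnitF C) (pairEl a (eId V (⟨⟩ : PUnit.{w + 1}))) = a := by
  have key : ∀ {X : V} (a : 𝟙_ V ⟶ X),
      ((λ_ (𝟙_ V)).inv ≫ (a ⊗ₘ 𝟙 (𝟙_ V))) ≫ (ρ_ X).hom = a := by
    intro X a
    simp [unitors_inv_equal]
  exact key a

theorem aHom_natural {x x' y y' z z' : C} (a : 𝟙_ V ⟶ (x ⟶[V] x')) (b : 𝟙_ V ⟶ (y ⟶[V] y'))
    (c : 𝟙_ V ⟶ (z ⟶[V] z')) :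
    tEl (tEl a b) c ⊚ aHom V x' y' z' = aHom V x y z ⊚ tEl a (tEl b c) := by
  have h := (SymMonECategory.associator (V := V) (C := C)).hom.naturality_el
    (pairEl (pairEl a b) c)
  have h₁ : onEl ((prodF SymMonECategory.tens (EnrichedFunctor.id V C)).comp V
      SymMonECategory.tens) (pairEl (pairEl a b) c) = tEl (tEl a b) c := by
    rw [onEl_comp_functor, onEl_prodF, onEl_id_functor]; rfl
  have h₂ : onEl ((assocF C C C).comp V ((prodF (EnrichedFunctor.id V C)
      SymMonECategory.tens).comp V SymMonECategory.tens)) (pairEl (pairEl a b) c) =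
      tEl a (tEl b c) := by
    rw [onEl_comp_functor, onEl_assocF]
    exact (onEl_comp_functor _ _ _).trans
      (congrArg _ ((onEl_prodF _ _ _ _).trans (by rw [onEl_id_functor]; rfl)))
  rw [h₁, h₂] at h
  exact h

theorem lHom_natural {x x' : C} (a : 𝟙_ V ⟶ (x ⟶[V] x')) :
    tEl (eId V (unitObj V C)) a ⊚ lHom V x' = lHom V x ⊚ a := by
  have h := (SymMonECategory.leftUnitor (V := V) (C := C)).hom.naturality_el
    (pairEl (eId V (⟨⟩ : PUnit)) a)
  rw [onEl_leftUnitF, onEl_comp_functor, onEl_prodF, onEl_id_functor, onEl_id] at h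
  exact h

theorem rHom_natural {x x' : C} (a : 𝟙_ V ⟶ (x ⟶[V] x')) :
    tEl a (eId V (unitObj V C)) ⊚ rHom V x' = rHom V x ⊚ a := by
  have h := (SymMonECategory.rightUnitor (V := V) (C := C)).hom.naturality_el
    (pairEl a (eId V (⟨⟩ : PUnit)))
  rw [onEl_rightUnitF, onEl_comp_functor, onEl_prodF, onEl_id_functor, onEl_id] at h
  exact h

theorem bHom_natural {x x' y y' : C} (a : 𝟙_ V ⟶ (x ⟶[V] x')) (b : 𝟙_ V ⟶ (y ⟶[V] y')) :
    tEl a b ⊚ bHom V x' y' = bHom V x y ⊚ tEl b a := by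
  have h := (SymMonECategory.braiding (V := V) (C := C)).naturality_el (pairEl a b)
  rw [onEl_comp_functor, onEl_swapF] at h
  exact h

/-- The tensor product on the underlying category. -/
instance undMonoidalStruct : MonoidalCategoryStruct (Und V C) where
  tensorObj x y := tObj (C := C) V x y
  whiskerLeft x _ _ a := tEl (C := C) (eId (C := C) V x) a
  whiskerRight a y := tEl (C := C) a (eId (C := C) V y)
  tensorHom a b := tEl (C := C) a b
  tensorUnit := unitObj V C
  associator x y z :=
    { hom := aHom (C := C) V x y z
      inv := aInv (C := C) V x y z
      hom_inv_id := (SymMonECategory.associator (V := V) (C := C)).hom_inv ((x, y), z)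
      inv_hom_id := (SymMonECategory.associator (V := V) (C := C)).inv_hom ((x, y), z) }
  leftUnitor x :=
    { hom := lHom (C := C) V x
      inv := lInv (C := C) V x
      hom_inv_id := (SymMonECategory.leftUnitor (V := V) (C := C)).hom_inv (⟨⟩, x)
      inv_hom_id := (SymMonECategory.leftUnitor (V := V) (C := C)).inv_hom (⟨⟩, x) }
  rightUnitor x :=
    { hom := rHom (C := C) V x
      inv := rInv (C := C) V x
      hom_inv_id := (SymMonECategory.rightUnitor (V := V) (C := C)).hom_inv (x, ⟨⟩)
      inv_hom_id := (SymMonECategory.rightUnitor (V := V) (C := C)).inv_hom (x, ⟨⟩) }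

/-- The underlying category of a symmetric monoidal enriched category is monoidal. -/
instance undMonoidal : MonoidalCategory (Und V C) :=
  MonoidalCategory.ofTensorHom
    (id_tensorHom_id := fun x y => tEl_id (V := V) (C := C) x y)
    (id_tensorHom := fun _ _ _ _ => rfl)
    (tensorHom_id := fun _ _ => rfl)
    (tensorHom_comp_tensorHom := fun a a' b b' => (tEl_comp (V := V) (C := C) a b a' b').symm)
    (associator_naturality := fun a b c => aHom_natural (V := V) (C := C) a b c)
    (leftUnitor_naturality := fun a => lHom_natural (V := V) (C := C) a)
    (rightUnitor_naturality := fun a => rHom_natural (V := V) (C := C) a)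
    (pentagon := fun x y z t => SymMonECategory.pentagon (V := V) (C := C) x y z t)
    (triangle := fun x y => SymMonECategory.triangle (V := V) (C := C) x y)

/-- The underlying category of a symmetric monoidal enriched category is symmetric. -/
instance undSymmetric : SymmetricCategory (Und V C) where
  braiding x y :=
    { hom := bHom (C := C) V x y
      inv := bHom (C := C) V y x
      hom_inv_id := SymMonECategory.symmetry (V := V) (C := C) x y
      inv_hom_id := SymMonECategory.symmetry (V := V) (C := C) y x }
  braiding_naturality_right x _ _ a := bHom_natural (V := V) (C := C) (eId (C := C) V x) a
  braiding_naturality_left a z := bHom_natural (V := V) (C := C) a (eId (C := C) V z)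
  hexagon_forward x y z := SymMonECategory.hexagon (V := V) (C := C) x y z
  hexagon_reverse x y z := hexagon_reverse_of_forward (C := Und V C)
    (fun x y =>
    { hom := bHom (C := C) V x y
      inv := bHom (C := C) V y x
      hom_inv_id := SymMonECategory.symmetry (V := V) (C := C) x y
      inv_hom_id := SymMonECategory.symmetry (V := V) (C := C) y x })
    (fun x y => SymMonECategory.symmetry (V := V) (C := C) x y)
    (fun x y z => SymMonECategory.hexagon (V := V) (C := C) x y z) x y z
  symmetry x y := SymMonECategory.symmetry (V := V) (C := C) x y

end Underlying

section Instances

variable {V : Type u} [Category.{v} V] [MonoidalCategory V] [SymmetricCategory V]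

theorem braid_tensorμ (A B X Y : V) :
    (β_ (A ⊗ B) (X ⊗ Y)).hom ≫ tensorμ X Y A B =
      tensorμ A B X Y ≫ ((β_ A X).hom ⊗ₘ (β_ B Y).hom) := by
  simp [tensorμ, SymmetricCategory.braiding_swap_eq_inv_braiding A Y,
    MonoidalCategory.tensorHom_def]

theorem braid_tensorμ_assoc (A B X Y : V) {Z : V} (h : (X ⊗ A) ⊗ (Y ⊗ B) ⟶ Z) :
    (β_ (A ⊗ B) (X ⊗ Y)).hom ≫ tensorμ X Y A B ≫ h =
      tensorμ A B X Y ≫ ((β_ A X).hom ⊗ₘ (β_ B Y).hom) ≫ h := by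
  rw [← Category.assoc, braid_tensorμ, Category.assoc]

section Inter

variable (V) (C : Type w₁) [EnrichedCategory V C] (D : Type w₂) [EnrichedCategory V D]
  (C' : Type w₃) [EnrichedCategory V C'] (D' : Type w₄) [EnrichedCategory V D']

/-- The inverse associativity isomorphism of the tensor product of enriched categories. -/
@[simps]
def assocInvF : EnrichedFunctor V (C × (D × D')) ((C × D) × D') where
  obj p := ((p.1, p.2.1), p.2.2)
  map p q := (α_ (p.1 ⟶[V] q.1) (p.2.1 ⟶[V] q.2.1) (p.2.2 ⟶[V] q.2.2)).inv
  map_id p := by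
    rw [Iso.comp_inv_eq]
    exact ((assocF C D D').map_id ((p.1, p.2.1), p.2.2)).symm
  map_comp p q r := by
    have h := (assocF (V := V) C D D').map_comp ((p.1, p.2.1), p.2.2) ((q.1, q.2.1), q.2.2)
      ((r.1, r.2.1), r.2.2)
    rw [Iso.comp_inv_eq, Category.assoc]
    refine Eq.trans ?_ (congrArg _ h.symm)
    have key : ∀ {X X' Y Y' Z : V} (i : X ≅ X') (j : Y ≅ Y') (k : X' ⊗ Y' ⟶ Z),
        k = (i.inv ⊗ₘ j.inv) ≫ (i.hom ⊗ₘ j.hom) ≫ k := by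
      intro X X' Y Y' Z i j k
      rw [tensorHom_comp_tensorHom_assoc]
      simp
    exact key _ _ _

/-- The interchange isomorphism as a composite of associativity and symmetry isomorphisms. -/
def interAux : EnrichedFunctor V ((C × D) × (C' × D')) ((C × C') × (D × D')) :=
  (assocF C D (C' × D')).comp V ((prodF (EnrichedFunctor.id V C)
    ((assocInvF V D C' D').comp V ((prodF (swapF V D C') (EnrichedFunctor.id V D')).comp V
      (assocF C' D D')))).comp V (assocInvF V C C' (D × D')))

theorem interAux_map (p q : (C × D) × (C' × D')) : (interAux V C D C' D').map p q =
    tensorμ (p.1.1 ⟶[V] q.1.1) (p.1.2 ⟶[V] q.1.2) (p.2.1 ⟶[V] q.2.1) (p.2.2 ⟶[V] q.2.2) := by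
  have key : ∀ A B X Y : V, (α_ A B (X ⊗ Y)).hom ≫ (𝟙 A ⊗ₘ ((α_ B X Y).inv ≫
      ((β_ B X).hom ⊗ₘ 𝟙 Y) ≫ (α_ X B Y).hom)) ≫ (α_ A X (B ⊗ Y)).inv = tensorμ A B X Y := by
    intro A B X Y
    simp [tensorμ]
  exact key _ _ _ _

/-- The interchange isomorphism of the tensor product of enriched categories. -/
@[simps]
def interF : EnrichedFunctor V ((C × D) × (C' × D')) ((C × C') × (D × D')) where
  obj p := ((p.1.1, p.2.1), (p.1.2, p.2.2))
  map p q := tensorμ (p.1.1 ⟶[V] q.1.1) (p.1.2 ⟶[V] q.1.2) (p.2.1 ⟶[V] q.2.1) (p.2.2 ⟶[V] q.2.2)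
  map_id p := by
    exact (congrArg _ (interAux_map V C D C' D' p p).symm).trans
      ((interAux V C D C' D').map_id p)
  map_comp p q r := by
    have h := (interAux V C D C' D').map_comp p q r
    rw [interAux_map, interAux_map, interAux_map] at h
    exact h

end Inter

variable {C : Type w₁} [EnrichedCategory V C] {D : Type w₂} [EnrichedCategory V D]
  {C' : Type w₃} [EnrichedCategory V C'] {D' : Type w₄} [EnrichedCategory V D']

theorem onEl_interF {x y : C} {x' y' : D} {X Y : C'} {X' Y' : D'}
    (a : 𝟙_ V ⟶ (x ⟶[V] y)) (a' : 𝟙_ V ⟶ (x' ⟶[V] y'))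
    (b : 𝟙_ V ⟶ (X ⟶[V] Y)) (b' : 𝟙_ V ⟶ (X' ⟶[V] Y')) :
    onEl (interF V C D C' D') (pairEl (pairEl a a') (pairEl b b')) =
      pairEl (pairEl a b) (pairEl a' b') := by
  have key : ∀ {A B X Y : V} (a : 𝟙_ V ⟶ A) (a' : 𝟙_ V ⟶ B) (b : 𝟙_ V ⟶ X) (b' : 𝟙_ V ⟶ Y),
      ((λ_ (𝟙_ V)).inv ≫ (((λ_ (𝟙_ V)).inv ≫ (a ⊗ₘ a')) ⊗ₘ ((λ_ (𝟙_ V)).inv ≫ (b ⊗ₘ b')))) ≫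
        tensorμ A B X Y =
      (λ_ (𝟙_ V)).inv ≫ (((λ_ (𝟙_ V)).inv ≫ (a ⊗ₘ b)) ⊗ₘ ((λ_ (𝟙_ V)).inv ≫ (a' ⊗ₘ b'))) := by
    intro A B X Y a a' b b'
    have h := lam_tensorμ (𝟙_ V) (𝟙_ V)
    rw [comp_tensorHom', tensorHom_comp', Category.assoc, Category.assoc, Category.assoc,
      tensorμ_natural, ← tensorHom_comp_tensorHom, ← h, ← whisker_exchange_assoc,
      ← leftUnitor_inv_naturality_assoc]
    simp only [Category.assoc]
  exact key a a' b b'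

/-- A transformation between functors on a tensor product, given componentwise. -/
theorem square_prod_of {c d e : V} {x y x' y' : C} {X Y X' Y' : D} (k : e ⟶ c ⊗ d)
    {f : c ⟶ (x ⟶[V] y)} {g : c ⟶ (x' ⟶[V] y')} {a : 𝟙_ V ⟶ (x ⟶[V] x')} {b : 𝟙_ V ⟶ (y ⟶[V] y')}
    {f' : d ⟶ (X ⟶[V] Y)} {g' : d ⟶ (X' ⟶[V] Y')} {a' : 𝟙_ V ⟶ (X ⟶[V] X')}
    {b' : 𝟙_ V ⟶ (Y ⟶[V] Y')} (h : postc f b = prec a g) (h' : postc f' b' = prec a' g')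
    {F : e ⟶ ((x, X) ⟶[V] (y, Y))} {G : e ⟶ ((x', X') ⟶[V] (y', Y'))}
    (hF : F = k ≫ (f ⊗ₘ f')) (hG : G = k ≫ (g ⊗ₘ g')) :
    postc F (pairEl b b') = prec (pairEl a a') G := by
  subst hF hG
  exact square_precomp k (square_prod h h')

section Prod

variable [SymMonECategory V C] [SymMonECategory V D]

variable (V C D) in
/-- The tensor product functor of a tensor product of symmetric monoidal enriched categories. -/
def prodTens : EnrichedFunctor V ((C × D) × (C × D)) (C × D) :=
  (interF V C D C D).comp V (prodF SymMonECategory.tens SymMonECategory.tens)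

theorem onEl_prodTens {x y X Y : C} {x' y' X' Y' : D}
    (a : 𝟙_ V ⟶ (x ⟶[V] y)) (a' : 𝟙_ V ⟶ (x' ⟶[V] y'))
    (b : 𝟙_ V ⟶ (X ⟶[V] Y)) (b' : 𝟙_ V ⟶ (X' ⟶[V] Y')) :
    onEl (prodTens V C D) (pairEl (pairEl a a') (pairEl b b')) =
      pairEl (tEl a b) (tEl a' b') :=
  (onEl_comp_functor _ _ _).trans ((congrArg _ (onEl_interF a a' b b')).trans
    (onEl_prodF _ _ _ _))

theorem prod_left (p q : PUnit.{w + 1} × (C × D)) :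
    ((prodF (pointF (V := V) (unitObj V C, unitObj V D)) (EnrichedFunctor.id V (C × D))).comp V
      (prodTens V C D)).map p q =
      ((λ_ (𝟙_ V)).inv ▷ _ ≫ tensorμ (𝟙_ V) (𝟙_ V) (p.2.1 ⟶[V] q.2.1) (p.2.2 ⟶[V] q.2.2)) ≫
        (((prodF (pointF (V := V) (unitObj V C)) (EnrichedFunctor.id V C)).comp V
          SymMonECategory.tens).map ((⟨⟩ : PUnit.{w + 1}), p.2.1) ((⟨⟩ : PUnit.{w + 1}), q.2.1) ⊗ₘ
        ((prodF (pointF (V := V) (unitObj V D)) (EnrichedFunctor.id V D)).comp V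
          SymMonECategory.tens).map ((⟨⟩ : PUnit.{w + 1}), p.2.2)
            ((⟨⟩ : PUnit.{w + 1}), q.2.2)) := by
  have key : ∀ {A A' Z Z' N N' : V} (f : 𝟙_ V ⟶ A) (f' : 𝟙_ V ⟶ A')
      (g : A ⊗ Z ⟶ N) (g' : A' ⊗ Z' ⟶ N'),
      (((λ_ (𝟙_ V)).inv ≫ (f ⊗ₘ f')) ⊗ₘ 𝟙 (Z ⊗ Z')) ≫ tensorμ A A' Z Z' ≫ (g ⊗ₘ g') =
      ((λ_ (𝟙_ V)).inv ▷ (Z ⊗ Z') ≫ tensorμ (𝟙_ V) (𝟙_ V) Z Z') ≫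
        (((f ⊗ₘ 𝟙 Z) ≫ g) ⊗ₘ ((f' ⊗ₘ 𝟙 Z') ≫ g')) := by
    intro A A' Z Z' N N' f f' g g'
    rw [comp_tensorHom', Category.assoc, Category.assoc, ← tensorHom_comp_tensorHom,
      ← id_tensorHom_id, tensorμ_natural_assoc]
  exact key _ _ _ _

theorem prod_right (p q : (C × D) × PUnit.{w + 1}) :
    ((prodF (EnrichedFunctor.id V (C × D)) (pointF (V := V) (unitObj V C, unitObj V D))).comp V
      (prodTens V C D)).map p q =
      (_ ◁ (λ_ (𝟙_ V)).inv ≫ tensorμ (p.1.1 ⟶[V] q.1.1) (p.1.2 ⟶[V] q.1.2) (𝟙_ V) (𝟙_ V)) ≫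
        (((prodF (EnrichedFunctor.id V C) (pointF (V := V) (unitObj V C))).comp V
          SymMonECategory.tens).map (p.1.1, (⟨⟩ : PUnit.{w + 1})) (q.1.1, (⟨⟩ : PUnit.{w + 1})) ⊗ₘ
        ((prodF (EnrichedFunctor.id V D) (pointF (V := V) (unitObj V D))).comp V
          SymMonECategory.tens).map (p.1.2, (⟨⟩ : PUnit.{w + 1}))
            (q.1.2, (⟨⟩ : PUnit.{w + 1}))) := by
  have key : ∀ {A A' Z Z' N N' : V} (f : 𝟙_ V ⟶ A) (f' : 𝟙_ V ⟶ A')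
      (g : Z ⊗ A ⟶ N) (g' : Z' ⊗ A' ⟶ N'),
      (𝟙 (Z ⊗ Z') ⊗ₘ ((λ_ (𝟙_ V)).inv ≫ (f ⊗ₘ f'))) ≫ tensorμ Z Z' A A' ≫ (g ⊗ₘ g') =
      ((Z ⊗ Z') ◁ (λ_ (𝟙_ V)).inv ≫ tensorμ Z Z' (𝟙_ V) (𝟙_ V)) ≫
        (((𝟙 Z ⊗ₘ f) ≫ g) ⊗ₘ ((𝟙 Z' ⊗ₘ f') ≫ g')) := by
    intro A A' Z Z' N N' f f' g g'
    rw [tensorHom_comp', Category.assoc, Category.assoc, ← tensorHom_comp_tensorHom,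
      ← id_tensorHom_id, tensorμ_natural_assoc]
  exact key _ _ _ _

theorem prod_left_unitF (p q : PUnit.{w + 1} × (C × D)) : (leftUnitF (V := V) (C × D)).map p q =
    ((λ_ (𝟙_ V)).inv ▷ _ ≫ tensorμ (𝟙_ V) (𝟙_ V) (p.2.1 ⟶[V] q.2.1) (p.2.2 ⟶[V] q.2.2)) ≫
      ((leftUnitF (V := V) C).map ((⟨⟩ : PUnit.{w + 1}), p.2.1) ((⟨⟩ : PUnit.{w + 1}), q.2.1) ⊗ₘ
      (leftUnitF (V := V) D).map ((⟨⟩ : PUnit.{w + 1}), p.2.2) ((⟨⟩ : PUnit.{w + 1}), q.2.2)) :=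
  (tensor_left_unitality _ _).trans (Category.assoc _ _ _).symm

theorem prod_right_unitF (p q : (C × D) × PUnit.{w + 1}) : (rightUnitF (V := V) (C × D)).map p q =
    (_ ◁ (λ_ (𝟙_ V)).inv ≫ tensorμ (p.1.1 ⟶[V] q.1.1) (p.1.2 ⟶[V] q.1.2) (𝟙_ V) (𝟙_ V)) ≫
      ((rightUnitF (V := V) C).map (p.1.1, (⟨⟩ : PUnit.{w + 1})) (q.1.1, (⟨⟩ : PUnit.{w + 1})) ⊗ₘ
      (rightUnitF (V := V) D).map (p.1.2, (⟨⟩ : PUnit.{w + 1})) (q.1.2, (⟨⟩ : PUnit.{w + 1}))) :=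
  (tensor_right_unitality _ _).trans (Category.assoc _ _ _).symm

theorem prod_braid (p q : (C × D) × (C × D)) :
    ((swapF V (C × D) (C × D)).comp V (prodTens V C D)).map p q =
      tensorμ (p.1.1 ⟶[V] q.1.1) (p.1.2 ⟶[V] q.1.2) (p.2.1 ⟶[V] q.2.1) (p.2.2 ⟶[V] q.2.2) ≫
        (((swapF V C C).comp V SymMonECategory.tens).map (p.1.1, p.2.1) (q.1.1, q.2.1) ⊗ₘ
        ((swapF V D D).comp V SymMonECategory.tens).map (p.1.2, p.2.2) (q.1.2, q.2.2)) := by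
  have key : ∀ {A A' Z Z' N N' : V} (g : Z ⊗ A ⟶ N) (g' : Z' ⊗ A' ⟶ N'),
      (β_ (A ⊗ A') (Z ⊗ Z')).hom ≫ tensorμ Z Z' A A' ≫ (g ⊗ₘ g') =
      tensorμ A A' Z Z' ≫ (((β_ A Z).hom ≫ g) ⊗ₘ ((β_ A' Z').hom ≫ g')) := by
    intro A A' Z Z' N N' g g'
    rw [← tensorHom_comp_tensorHom, ← Category.assoc, braid_tensorμ, Category.assoc]
  exact key _ _

theorem prod_assoc_left (p q : ((C × D) × (C × D)) × (C × D)) :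
    ((prodF (prodTens V C D) (EnrichedFunctor.id V (C × D))).comp V (prodTens V C D)).map p q =
      (tensorμ (p.1.1.1 ⟶[V] q.1.1.1) (p.1.1.2 ⟶[V] q.1.1.2) (p.1.2.1 ⟶[V] q.1.2.1)
          (p.1.2.2 ⟶[V] q.1.2.2) ▷ _ ≫ tensorμ _ _ (p.2.1 ⟶[V] q.2.1) (p.2.2 ⟶[V] q.2.2)) ≫
        (((prodF SymMonECategory.tens (EnrichedFunctor.id V C)).comp V
          SymMonECategory.tens).map ((p.1.1.1, p.1.2.1), p.2.1) ((q.1.1.1, q.1.2.1), q.2.1) ⊗ₘ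
        ((prodF SymMonECategory.tens (EnrichedFunctor.id V D)).comp V
          SymMonECategory.tens).map ((p.1.1.2, p.1.2.2), p.2.2) ((q.1.1.2, q.1.2.2), q.2.2)) := by
  have key : ∀ {A A' B B' Z Z' M N M' N' : V} (f : A ⊗ B ⟶ M) (f' : A' ⊗ B' ⟶ M')
      (g : M ⊗ Z ⟶ N) (g' : M' ⊗ Z' ⟶ N'),
      ((tensorμ A A' B B' ≫ (f ⊗ₘ f')) ⊗ₘ 𝟙 (Z ⊗ Z')) ≫ tensorμ M M' Z Z' ≫ (g ⊗ₘ g') =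
      (tensorμ A A' B B' ▷ (Z ⊗ Z') ≫ tensorμ (A ⊗ B) (A' ⊗ B') Z Z') ≫
        (((f ⊗ₘ 𝟙 Z) ≫ g) ⊗ₘ ((f' ⊗ₘ 𝟙 Z') ≫ g')) := by
    intro A A' B B' Z Z' M N M' N' f f' g g'
    rw [comp_tensorHom', Category.assoc, Category.assoc, ← tensorHom_comp_tensorHom,
      ← id_tensorHom_id, tensorμ_natural_assoc]
  exact key _ _ _ _

theorem prod_assoc_right (p q : ((C × D) × (C × D)) × (C × D)) :
    ((assocF (C × D) (C × D) (C × D)).comp V ((prodF (EnrichedFunctor.id V (C × D))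
        (prodTens V C D)).comp V (prodTens V C D))).map p q =
      (tensorμ (p.1.1.1 ⟶[V] q.1.1.1) (p.1.1.2 ⟶[V] q.1.1.2) (p.1.2.1 ⟶[V] q.1.2.1)
          (p.1.2.2 ⟶[V] q.1.2.2) ▷ _ ≫ tensorμ _ _ (p.2.1 ⟶[V] q.2.1) (p.2.2 ⟶[V] q.2.2)) ≫
        (((assocF C C C).comp V ((prodF (EnrichedFunctor.id V C) SymMonECategory.tens).comp V
          SymMonECategory.tens)).map ((p.1.1.1, p.1.2.1), p.2.1) ((q.1.1.1, q.1.2.1), q.2.1) ⊗ₘ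
        ((assocF D D D).comp V ((prodF (EnrichedFunctor.id V D) SymMonECategory.tens).comp V
          SymMonECategory.tens)).map ((p.1.1.2, p.1.2.2), p.2.2)
            ((q.1.1.2, q.1.2.2), q.2.2)) := by
  have key : ∀ {A A' B B' Z Z' M N M' N' : V} (f : B ⊗ Z ⟶ M) (f' : B' ⊗ Z' ⟶ M')
      (g : A ⊗ M ⟶ N) (g' : A' ⊗ M' ⟶ N'),
      (α_ (A ⊗ A') (B ⊗ B') (Z ⊗ Z')).hom ≫
      (𝟙 (A ⊗ A') ⊗ₘ (tensorμ B B' Z Z' ≫ (f ⊗ₘ f'))) ≫ tensorμ A A' M M' ≫ (g ⊗ₘ g') =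
      (tensorμ A A' B B' ▷ (Z ⊗ Z') ≫ tensorμ (A ⊗ B) (A' ⊗ B') Z Z') ≫
        (((α_ A B Z).hom ≫ (𝟙 A ⊗ₘ f) ≫ g) ⊗ₘ ((α_ A' B' Z').hom ≫ (𝟙 A' ⊗ₘ f') ≫ g')) := by
    intro A A' B B' Z Z' M N M' N' f f' g g'
    rw [tensorHom_comp', Category.assoc, Category.assoc, ← tensorHom_comp_tensorHom,
      ← tensorHom_comp_tensorHom,
      ← id_tensorHom_id, tensorμ_natural_assoc, tensor_associativity_assoc]
  exact key _ _ _ _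

/-- The tensor product of symmetric monoidal enriched categories. -/
instance prodSymMon : SymMonECategory V (C × D) where
  tens := prodTens V C D
  unit := (unitObj V C, unitObj V D)
  associator :=
    { hom :=
      { app p := pairEl (aHom V p.1.1.1 p.1.2.1 p.2.1) (aHom V p.1.1.2 p.1.2.2 p.2.2)
        naturality p q := square_prod_of _
          (SymMonECategory.associator.hom.naturality ((p.1.1.1, p.1.2.1), p.2.1)
            ((q.1.1.1, q.1.2.1), q.2.1))
          (SymMonECategory.associator.hom.naturality ((p.1.1.2, p.1.2.2), p.2.2)
            ((q.1.1.2, q.1.2.2), q.2.2))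
          (prod_assoc_left p q) (prod_assoc_right p q) }
      inv :=
      { app p := pairEl (aInv V p.1.1.1 p.1.2.1 p.2.1) (aInv V p.1.1.2 p.1.2.2 p.2.2)
        naturality p q := square_prod_of _
          (SymMonECategory.associator.inv.naturality ((p.1.1.1, p.1.2.1), p.2.1)
            ((q.1.1.1, q.1.2.1), q.2.1))
          (SymMonECategory.associator.inv.naturality ((p.1.1.2, p.1.2.2), p.2.2)
            ((q.1.1.2, q.1.2.2), q.2.2))
          (prod_assoc_right p q) (prod_assoc_left p q) }
      hom_inv p := (pairEl_comp _ _ _ _).trans (congrArg₂ pairEl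
        (SymMonECategory.associator.hom_inv ((p.1.1.1, p.1.2.1), p.2.1))
        (SymMonECategory.associator.hom_inv ((p.1.1.2, p.1.2.2), p.2.2)))
      inv_hom p := (pairEl_comp _ _ _ _).trans (congrArg₂ pairEl
        (SymMonECategory.associator.inv_hom ((p.1.1.1, p.1.2.1), p.2.1))
        (SymMonECategory.associator.inv_hom ((p.1.1.2, p.1.2.2), p.2.2))) }
  leftUnitor :=
    { hom :=
      { app p := pairEl (lHom V p.2.1) (lHom V p.2.2)
        naturality p q := square_prod_of _
          (SymMonECategory.leftUnitor.hom.naturality (⟨⟩, p.2.1) (⟨⟩, q.2.1))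
          (SymMonECategory.leftUnitor.hom.naturality (⟨⟩, p.2.2) (⟨⟩, q.2.2))
          (prod_left p q) (prod_left_unitF p q) }
      inv :=
      { app p := pairEl (lInv V p.2.1) (lInv V p.2.2)
        naturality p q := square_prod_of _
          (SymMonECategory.leftUnitor.inv.naturality (⟨⟩, p.2.1) (⟨⟩, q.2.1))
          (SymMonECategory.leftUnitor.inv.naturality (⟨⟩, p.2.2) (⟨⟩, q.2.2))
          (prod_left_unitF p q) (prod_left p q) }
      hom_inv p := (pairEl_comp _ _ _ _).trans (congrArg₂ pairEl
        (SymMonECategory.leftUnitor.hom_inv (⟨⟩, p.2.1))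
        (SymMonECategory.leftUnitor.hom_inv (⟨⟩, p.2.2)))
      inv_hom p := (pairEl_comp _ _ _ _).trans (congrArg₂ pairEl
        (SymMonECategory.leftUnitor.inv_hom (⟨⟩, p.2.1))
        (SymMonECategory.leftUnitor.inv_hom (⟨⟩, p.2.2))) }
  rightUnitor :=
    { hom :=
      { app p := pairEl (rHom V p.1.1) (rHom V p.1.2)
        naturality p q := square_prod_of _
          (SymMonECategory.rightUnitor.hom.naturality (p.1.1, ⟨⟩) (q.1.1, ⟨⟩))
          (SymMonECategory.rightUnitor.hom.naturality (p.1.2, ⟨⟩) (q.1.2, ⟨⟩))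
          (prod_right p q) (prod_right_unitF p q) }
      inv :=
      { app p := pairEl (rInv V p.1.1) (rInv V p.1.2)
        naturality p q := square_prod_of _
          (SymMonECategory.rightUnitor.inv.naturality (p.1.1, ⟨⟩) (q.1.1, ⟨⟩))
          (SymMonECategory.rightUnitor.inv.naturality (p.1.2, ⟨⟩) (q.1.2, ⟨⟩))
          (prod_right_unitF p q) (prod_right p q) }
      hom_inv p := (pairEl_comp _ _ _ _).trans (congrArg₂ pairEl
        (SymMonECategory.rightUnitor.hom_inv (p.1.1, ⟨⟩))
        (SymMonECategory.rightUnitor.hom_inv (p.1.2, ⟨⟩)))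
      inv_hom p := (pairEl_comp _ _ _ _).trans (congrArg₂ pairEl
        (SymMonECategory.rightUnitor.inv_hom (p.1.1, ⟨⟩))
        (SymMonECategory.rightUnitor.inv_hom (p.1.2, ⟨⟩))) }
  braiding :=
    { app p := pairEl (bHom V p.1.1 p.2.1) (bHom V p.1.2 p.2.2)
      naturality p q := square_prod_of _
        (SymMonECategory.braiding.naturality (p.1.1, p.2.1) (q.1.1, q.2.1))
        (SymMonECategory.braiding.naturality (p.1.2, p.2.2) (q.1.2, q.2.2))
        rfl (prod_braid p q) }
  pentagon x y z t :=
    (congrArg₂ elComp (onEl_prodTens _ _ (eId V t.1) (eId V t.2)) (congrArg₂ elComp rfl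
      (onEl_prodTens (eId V x.1) (eId V x.2) _ _))).trans
    (((congrArg _ (pairEl_comp _ _ _ _)).trans (pairEl_comp _ _ _ _)).trans
      ((congrArg₂ pairEl (SymMonECategory.pentagon x.1 y.1 z.1 t.1)
        (SymMonECategory.pentagon x.2 y.2 z.2 t.2)).trans (pairEl_comp _ _ _ _).symm))
  triangle x y :=
    (congrArg₂ elComp rfl (onEl_prodTens (eId V x.1) (eId V x.2) _ _)).trans
    ((pairEl_comp _ _ _ _).trans
      ((congrArg₂ pairEl (SymMonECategory.triangle x.1 y.1)
        (SymMonECategory.triangle x.2 y.2)).trans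
          (onEl_prodTens _ _ (eId V y.1) (eId V y.2)).symm))
  hexagon x y z :=
    ((congrArg _ (pairEl_comp _ _ _ _)).trans (pairEl_comp _ _ _ _)).trans
      ((congrArg₂ pairEl (SymMonECategory.hexagon x.1 y.1 z.1)
        (SymMonECategory.hexagon x.2 y.2 z.2)).trans
      ((congrArg₂ elComp (onEl_prodTens _ _ (eId V z.1) (eId V z.2)) (congrArg₂ elComp rfl
        (onEl_prodTens (eId V y.1) (eId V y.2) _ _))).trans
        ((congrArg _ (pairEl_comp _ _ _ _)).trans (pairEl_comp _ _ _ _))).symm)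
  symmetry x y := (pairEl_comp _ _ _ _).trans (congrArg₂ pairEl
    (SymMonECategory.symmetry x.1 y.1) (SymMonECategory.symmetry x.2 y.2))

end Prod

end Instances

section UnitInstance

variable {V : Type u} [Category.{v} V] [MonoidalCategory V] [SymmetricCategory V]

theorem square_of_eq {C : Type w₁} [EnrichedCategory V C] {c : V} {x y : C}
    {f g : c ⟶ (x ⟶[V] y)} (h : f = g) : postc f (eId V y) = prec (eId V x) g := by
  rw [postc_id, id_prec, h]

theorem unit_key (x : PUnit.{w + 1}) (a b c d : 𝟙_ V ⟶ (x ⟶[V] x)) (ha : a = eId V x)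
    (hb : b = eId V x) (hc : c = eId V x) (hd : d = eId V x) : a ⊚ b ⊚ c = d := by
  rw [ha, hb, hc, hd, elComp_id, elComp_id]

/-- The unit enriched category as a symmetric monoidal enriched category. -/
instance unitSymMon : SymMonECategory V PUnit.{w + 1} where
  tens := leftUnitF PUnit.{w + 1}
  unit := ⟨⟩
  associator :=
    { hom :=
      { app _ := eId V (⟨⟩ : PUnit.{w + 1})
        naturality _ _ := square_of_eq (by
          change ((λ_ (𝟙_ V)).hom ⊗ₘ 𝟙 (𝟙_ V)) ≫ (λ_ (𝟙_ V)).hom =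
            (α_ (𝟙_ V) (𝟙_ V) (𝟙_ V)).hom ≫ (𝟙 (𝟙_ V) ⊗ₘ (λ_ (𝟙_ V)).hom) ≫ (λ_ (𝟙_ V)).hom
          monoidal) }
      inv :=
      { app _ := eId V (⟨⟩ : PUnit.{w + 1})
        naturality _ _ := square_of_eq (by
          change (α_ (𝟙_ V) (𝟙_ V) (𝟙_ V)).hom ≫ (𝟙 (𝟙_ V) ⊗ₘ (λ_ (𝟙_ V)).hom) ≫ (λ_ (𝟙_ V)).hom =
            ((λ_ (𝟙_ V)).hom ⊗ₘ 𝟙 (𝟙_ V)) ≫ (λ_ (𝟙_ V)).hom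
          monoidal) }
      hom_inv _ := elComp_id _
      inv_hom _ := elComp_id _ }
  leftUnitor :=
    { hom :=
      { app _ := eId V (⟨⟩ : PUnit.{w + 1})
        naturality _ _ := square_of_eq (by
          change (𝟙 (𝟙_ V) ⊗ₘ 𝟙 (𝟙_ V)) ≫ (λ_ (𝟙_ V)).hom = (λ_ (𝟙_ V)).hom
          monoidal) }
      inv :=
      { app _ := eId V (⟨⟩ : PUnit.{w + 1})
        naturality _ _ := square_of_eq (by
          change (λ_ (𝟙_ V)).hom = (𝟙 (𝟙_ V) ⊗ₘ 𝟙 (𝟙_ V)) ≫ (λ_ (𝟙_ V)).hom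
          monoidal) }
      hom_inv _ := elComp_id _
      inv_hom _ := elComp_id _ }
  rightUnitor :=
    { hom :=
      { app _ := eId V (⟨⟩ : PUnit.{w + 1})
        naturality _ _ := square_of_eq (by
          change (𝟙 (𝟙_ V) ⊗ₘ 𝟙 (𝟙_ V)) ≫ (λ_ (𝟙_ V)).hom = (ρ_ (𝟙_ V)).hom
          monoidal) }
      inv :=
      { app _ := eId V (⟨⟩ : PUnit.{w + 1})
        naturality _ _ := square_of_eq (by
          change (ρ_ (𝟙_ V)).hom = (𝟙 (𝟙_ V) ⊗ₘ 𝟙 (𝟙_ V)) ≫ (λ_ (𝟙_ V)).hom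
          monoidal) }
      hom_inv _ := elComp_id _
      inv_hom _ := elComp_id _ }
  braiding :=
    { app _ := eId V (⟨⟩ : PUnit.{w + 1})
      naturality _ _ := square_of_eq (by
        change (λ_ (𝟙_ V)).hom = (β_ (𝟙_ V) (𝟙_ V)).hom ≫ (λ_ (𝟙_ V)).hom
        rw [braiding_tensorUnit_left, unitors_equal]; simp) }
  pentagon _ _ _ _ := unit_key _ _ _ _ _ (onEl_id _ _) rfl (onEl_id _ _) (elComp_id _)
  triangle _ _ := (congrArg (elComp _) (onEl_id _ _)).trans ((elComp_id _).trans (onEl_id _ _).symm)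
  hexagon _ _ _ := by
    refine Eq.trans (b := eId V (⟨⟩ : PUnit.{w + 1})) ?_ (Eq.symm ?_)
    · exact unit_key _ _ _ _ _ rfl rfl rfl rfl
    · exact unit_key _ _ _ _ _ (onEl_id _ _) rfl (onEl_id _ _) rfl
  symmetry _ _ := elComp_id _

end UnitInstance

section Op

open Opposite

variable {V : Type u} [Category.{v} V] [MonoidalCategory V] [SymmetricCategory V]
  {C : Type w} [EnrichedCategory V C]

theorem op_postc {c : V} {x y z : Cᵒᵖ} (f : c ⟶ (x ⟶[V] y)) (b : 𝟙_ V ⟶ (y ⟶[V] z)) :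
    postc f b = prec (C := C) (x := z.unop) (y := y.unop) (z := x.unop) b f := by
  have key : ∀ {X Y Z : V} (f : c ⟶ X) (b : 𝟙_ V ⟶ Y) (k : Y ⊗ X ⟶ Z),
      (ρ_ c).inv ≫ (f ⊗ₘ b) ≫ (β_ X Y).hom ≫ k = (λ_ c).inv ≫ (b ⊗ₘ f) ≫ k := by
    intro X Y Z f b k
    rw [braiding_naturality_assoc]
    simp
  exact key f b _

theorem op_prec {c : V} {x y z : Cᵒᵖ} (a : 𝟙_ V ⟶ (x ⟶[V] y)) (f : c ⟶ (y ⟶[V] z)) :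
    prec a f = postc (C := C) (x := z.unop) (y := y.unop) (z := x.unop) f a := by
  have key : ∀ {X Y Z : V} (f : c ⟶ X) (b : 𝟙_ V ⟶ Y) (k : X ⊗ Y ⟶ Z),
      (λ_ c).inv ≫ (b ⊗ₘ f) ≫ (β_ Y X).hom ≫ k = (ρ_ c).inv ≫ (f ⊗ₘ b) ≫ k := by
    intro X Y Z f b k
    rw [braiding_naturality_assoc]
    simp
  exact key f a _

theorem op_elComp {x y z : Cᵒᵖ} (a : 𝟙_ V ⟶ (x ⟶[V] y)) (b : 𝟙_ V ⟶ (y ⟶[V] z)) :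
    a ⊚ b = elComp (C := C) (x := z.unop) (y := y.unop) (z := x.unop) b a := by
  rw [elComp_eq_postc]
  exact op_postc a b

theorem op_elComp₃ {x y z t : Cᵒᵖ} (a : 𝟙_ V ⟶ (x ⟶[V] y)) (b : 𝟙_ V ⟶ (y ⟶[V] z))
    (c : 𝟙_ V ⟶ (z ⟶[V] t)) :
    a ⊚ b ⊚ c = elComp (C := C) (x := t.unop) (y := z.unop) (z := x.unop) c
      (elComp (C := C) (x := z.unop) (y := y.unop) (z := x.unop) b a) := by
  rw [op_elComp, op_elComp]
  exact elComp_assoc (C := C) _ _ _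

variable [SymMonECategory V C]

variable (V C) in
/-- The tensor product functor of the opposite of a symmetric monoidal enriched category. -/
def opTens : EnrichedFunctor V (Cᵒᵖ × Cᵒᵖ) Cᵒᵖ where
  obj p := op (tObj V p.1.unop p.2.unop)
  map p q := (SymMonECategory.tens (V := V) (C := C)).map (q.1.unop, q.2.unop)
    (p.1.unop, p.2.unop)
  map_id p := (SymMonECategory.tens (V := V) (C := C)).map_id (p.1.unop, p.2.unop)
  map_comp p q r := by
    have h := (SymMonECategory.tens (V := V) (C := C)).map_comp (r.1.unop, r.2.unop)
      (q.1.unop, q.2.unop) (p.1.unop, p.2.unop)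
    have key : ∀ {A A' B B' M M' N T T' : V} (f : B ⊗ A ⟶ M) (f' : B' ⊗ A' ⟶ M')
        (g : M ⊗ M' ⟶ N) (k : B ⊗ B' ⟶ T) (k' : A ⊗ A' ⟶ T') (e : T ⊗ T' ⟶ N),
        (tensorμ B B' A A' ≫ (f ⊗ₘ f')) ≫ g = (k ⊗ₘ k') ≫ e →
        (tensorμ A A' B B' ≫ (((β_ A B).hom ≫ f) ⊗ₘ ((β_ A' B').hom ≫ f'))) ≫ g =
          (k' ⊗ₘ k) ≫ (β_ T' T).hom ≫ e := by
      intro A A' B B' M M' N T T' f f' g k k' e h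
      rw [braiding_naturality_assoc, ← h, ← tensorHom_comp_tensorHom, ← braid_tensorμ_assoc]
      simp only [Category.assoc]
    exact key _ _ _ _ _ _ h

/-- The opposite of a symmetric monoidal enriched category. -/
instance opSymMon : SymMonECategory V Cᵒᵖ where
  tens := opTens V C
  unit := op (unitObj V C)
  associator :=
    { hom :=
      { app p := aInv V p.1.1.unop p.1.2.unop p.2.unop
        naturality p q := (op_postc _ _).trans
          ((SymMonECategory.associator.inv.naturality ((q.1.1.unop, q.1.2.unop), q.2.unop)
            ((p.1.1.unop, p.1.2.unop), p.2.unop)).symm.trans (op_prec _ _).symm) }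
      inv :=
      { app p := aHom V p.1.1.unop p.1.2.unop p.2.unop
        naturality p q := (op_postc _ _).trans
          ((SymMonECategory.associator.hom.naturality ((q.1.1.unop, q.1.2.unop), q.2.unop)
            ((p.1.1.unop, p.1.2.unop), p.2.unop)).symm.trans (op_prec _ _).symm) }
      hom_inv p := (op_elComp _ _).trans (SymMonECategory.associator.hom_inv
        ((p.1.1.unop, p.1.2.unop), p.2.unop))
      inv_hom p := (op_elComp _ _).trans (SymMonECategory.associator.inv_hom
        ((p.1.1.unop, p.1.2.unop), p.2.unop)) }
  leftUnitor :=
    { hom :=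
      { app p := lInv V p.2.unop
        naturality p q := (op_postc _ _).trans
          ((SymMonECategory.leftUnitor.inv.naturality (⟨⟩, q.2.unop) (⟨⟩, p.2.unop)).symm.trans
            (op_prec _ _).symm) }
      inv :=
      { app p := lHom V p.2.unop
        naturality p q := (op_postc _ _).trans
          ((SymMonECategory.leftUnitor.hom.naturality (⟨⟩, q.2.unop) (⟨⟩, p.2.unop)).symm.trans
            (op_prec _ _).symm) }
      hom_inv p := (op_elComp _ _).trans (SymMonECategory.leftUnitor.hom_inv (⟨⟩, p.2.unop))
      inv_hom p := (op_elComp _ _).trans (SymMonECategory.leftUnitor.inv_hom (⟨⟩, p.2.unop)) }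
  rightUnitor :=
    { hom :=
      { app p := rInv V p.1.unop
        naturality p q := (op_postc _ _).trans
          ((SymMonECategory.rightUnitor.inv.naturality (q.1.unop, ⟨⟩) (p.1.unop, ⟨⟩)).symm.trans
            (op_prec _ _).symm) }
      inv :=
      { app p := rHom V p.1.unop
        naturality p q := (op_postc _ _).trans
          ((SymMonECategory.rightUnitor.hom.naturality (q.1.unop, ⟨⟩) (p.1.unop, ⟨⟩)).symm.trans
            (op_prec _ _).symm) }
      hom_inv p := (op_elComp _ _).trans (SymMonECategory.rightUnitor.hom_inv (p.1.unop, ⟨⟩))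
      inv_hom p := (op_elComp _ _).trans (SymMonECategory.rightUnitor.inv_hom (p.1.unop, ⟨⟩)) }
  braiding :=
    { app p := bHom V p.2.unop p.1.unop
      naturality p q := by
        have h := (SymMonECategory.braiding (V := V) (C := C)).naturality
          (q.2.unop, q.1.unop) (p.2.unop, p.1.unop)
        have h' := square_precomp (β_ (p.1 ⟶[V] q.1) (p.2 ⟶[V] q.2)).hom h
        have e : (β_ (p.1 ⟶[V] q.1) (p.2 ⟶[V] q.2)).hom ≫ ((swapF V C C).comp V
            (SymMonECategory.tens (V := V) (C := C))).map (q.2.unop, q.1.unop)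
              (p.2.unop, p.1.unop) = (opTens V C).map p q :=
          (SymmetricCategory.symmetry_assoc _ _ _)
        exact (op_postc _ _).trans ((congrArg _ e.symm).trans (h'.symm.trans
          (op_prec (C := C) _ _).symm)) }
  pentagon x y z t := (op_elComp₃ _ _ _).trans
    ((pentagon_inv (C := Und V C) (W := x.unop) (X := y.unop) (Y := z.unop)
      (Z := t.unop)).trans (op_elComp _ _).symm)
  triangle x y := (op_elComp _ _).trans
    (triangle_assoc_comp_left_inv (C := Und V C) x.unop y.unop)
  hexagon x y z := (op_elComp₃ _ _ _).trans
    ((hexagon_reverse (C := Und V C) y.unop z.unop x.unop).trans (op_elComp₃ _ _ _).symm)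
  symmetry x y := (op_elComp _ _).trans (SymMonECategory.symmetry (V := V) x.unop y.unop)

end Op

section Self

variable {V : Type u} [Category.{v} V] [MonoidalCategory V] [MonoidalClosed V]

/-- A closed monoidal category as a category enriched over itself. -/
instance selfEnriched : EnrichedCategory V V := MonoidalClosed.enrichedCategorySelf V

/-- The internal hom-objects. -/
abbrev iHom (x y : V) : V := EnrichedCategory.Hom (V := V) x y

/-- The element of the internal hom-object corresponding to a morphism. -/
def nm {X Y : V} (f : X ⟶ Y) : 𝟙_ V ⟶ (iHom X Y) := MonoidalClosed.curry' f

/-- The morphism `x ⊗ c ⟶ y` corresponding to a generalized element of `[x, y]`. -/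
def unc {c x y : V} (f : c ⟶ (iHom x y)) : x ⊗ c ⟶ y := MonoidalClosed.uncurry f

/-- The generalized element of `[x, y]` corresponding to a morphism `x ⊗ c ⟶ y`. -/
def cur {c x y : V} (f : x ⊗ c ⟶ y) : c ⟶ (iHom x y) := MonoidalClosed.curry f

/-- The evaluation morphism. -/
def evl (x y : V) : x ⊗ (iHom x y) ⟶ y := (ihom.ev x).app y

theorem unc_injective {c x y : V} {f g : c ⟶ (iHom x y)} (h : unc f = unc g) : f = g :=
  MonoidalClosed.uncurry_injective h

@[simp] theorem unc_cur {c x y : V} (f : x ⊗ c ⟶ y) : unc (cur f) = f := MonoidalClosed.uncurry_curry f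

@[simp] theorem cur_unc {c x y : V} (f : c ⟶ (iHom x y)) : cur (unc f) = f := MonoidalClosed.curry_uncurry f

theorem unc_eq {c x y : V} (f : c ⟶ (iHom x y)) : unc f = x ◁ f ≫ evl x y := MonoidalClosed.uncurry_eq f

theorem unc_comp {c d x y : V} (h : d ⟶ c) (f : c ⟶ (iHom x y)) : unc (h ≫ f) = x ◁ h ≫ unc f :=
  MonoidalClosed.uncurry_natural_left h f

@[simp] theorem unc_nm {X Y : V} (f : X ⟶ Y) : unc (nm f) = (ρ_ X).hom ≫ f := MonoidalClosed.uncurry_curry _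

@[simp] theorem unc_eId (X : V) : unc (eId V X) = (ρ_ X).hom := MonoidalClosed.uncurry_curry _

theorem unc_eComp {c d x y z : V} (f : c ⟶ (iHom x y)) (g : d ⟶ (iHom y z)) :
    unc ((f ⊗ₘ g) ≫ eComp V x y z) = (α_ x c d).inv ≫ unc f ▷ d ≫ unc g := by
  have e : unc (eComp V x y z) = (α_ x (iHom x y) (iHom y z)).inv ≫
      evl x y ▷ (iHom y z) ≫ evl y z := MonoidalClosed.uncurry_curry _
  rw [unc_comp, e, unc_eq, unc_eq, MonoidalCategory.tensorHom_def,
    MonoidalCategory.whiskerLeft_comp, Category.assoc, associator_inv_naturality_right_assoc,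
    whisker_exchange_assoc, associator_inv_naturality_middle_assoc, comp_whiskerRight,
    Category.assoc]

theorem unc_postc {c x y z : V} (f : c ⟶ (iHom x y)) (b : y ⟶ z) :
    unc (postc f (nm b)) = unc f ≫ b := by
  rw [postc, unc_comp, unc_eComp, unc_nm]
  simp

theorem unc_prec {c x y z : V} (a : x ⟶ y) (f : c ⟶ (iHom y z)) :
    unc (prec (nm a) f) = a ▷ c ≫ unc f := by
  rw [prec, unc_comp, unc_eComp, unc_nm]
  simp

theorem self_square {c x y x' y' : V} {f : c ⟶ (iHom x y)} {g : c ⟶ (iHom x' y')} {a : x ⟶ x'}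
    {b : y ⟶ y'} (h : unc f ≫ b = a ▷ c ≫ unc g) : postc f (nm b) = prec (nm a) g := by
  apply unc_injective
  rw [unc_postc, unc_prec, h]

theorem nm_comp {x y z : V} (a : x ⟶ y) (b : y ⟶ z) : nm a ⊚ nm b = nm (a ≫ b) := by
  apply unc_injective
  rw [elComp_eq_prec, unc_prec]
  simp

theorem nm_id (x : V) : nm (𝟙 x) = eId V x := by
  apply unc_injective
  simp

theorem nm_hom_inv {x y : V} (i : x ≅ y) : nm i.hom ⊚ nm i.inv = eId V x := by
  rw [nm_comp, Iso.hom_inv_id, nm_id]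

theorem nm_inv_hom {x y : V} (i : x ≅ y) : nm i.inv ⊚ nm i.hom = eId V y := by
  rw [nm_comp, Iso.inv_hom_id, nm_id]

end Self

section SelfTensor

variable {V : Type u} [Category.{v} V] [MonoidalCategory V] [SymmetricCategory V]
  [MonoidalClosed V]

/-- The tensor product of internal hom-objects, `[x, y] ⊗ [x', y'] ⟶ [x ⊗ x', y ⊗ y']`. -/
def homTensor (x x' y y' : V) : (iHom x y) ⊗ (iHom x' y') ⟶ (iHom (x ⊗ x') (y ⊗ y')) :=
  cur (tensorμ x x' (iHom x y) (iHom x' y') ≫ (evl x y ⊗ₘ evl x' y'))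

theorem unc_homTensor {c d x x' y y' : V} (f : c ⟶ (iHom x y)) (g : d ⟶ (iHom x' y')) :
    unc ((f ⊗ₘ g) ≫ homTensor x x' y y') = tensorμ x x' c d ≫ (unc f ⊗ₘ unc g) := by
  rw [unc_comp, homTensor, unc_cur, unc_eq, unc_eq, ← tensorHom_comp_tensorHom,
    ← tensorμ_natural_right_assoc]

theorem unc_homTensor' {x x' y y' : V} :
    unc (homTensor x x' y y') = tensorμ x x' (iHom x y) (iHom x' y') ≫ (evl x y ⊗ₘ evl x' y') :=
  unc_cur _

theorem homTensor_nm {x x' y y' : V} (f : x ⟶ y) (g : x' ⟶ y') :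
    (λ_ (𝟙_ V)).inv ≫ (nm f ⊗ₘ nm g) ≫ homTensor x x' y y' = nm (f ⊗ₘ g) := by
  apply unc_injective
  have h := tensor_right_unitality x x'
  rw [unc_comp, unc_homTensor, unc_nm, unc_nm, unc_nm, ← tensorHom_comp_tensorHom, h]
  simp

variable (V) in
/-- The tensor product as an enriched functor. -/
def selfTens : EnrichedFunctor V (V × V) V where
  obj p := p.1 ⊗ p.2
  map p q := homTensor p.1 p.2 q.1 q.2
  map_id p := by
    rw [prod_eId, Category.assoc, ← nm_id, ← nm_id, homTensor_nm, id_tensorHom_id, nm_id]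
  map_comp p q r := by
    apply unc_injective
    have key : ∀ {A A' B B' X X' Y Y' Z Z' : V} (f : X ⊗ A ⟶ Y) (f' : X' ⊗ A' ⟶ Y')
      (g : Y ⊗ B ⟶ Z) (g' : Y' ⊗ B' ⟶ Z'),
      (X ⊗ X') ◁ tensorμ A A' B B' ≫ tensorμ X X' (A ⊗ B) (A' ⊗ B') ≫
        (((α_ X A B).inv ≫ f ▷ B ≫ g) ⊗ₘ ((α_ X' A' B').inv ≫ f' ▷ B' ≫ g')) =
      (α_ (X ⊗ X') (A ⊗ A') (B ⊗ B')).inv ≫ (tensorμ X X' A A' ≫ (f ⊗ₘ f')) ▷ (B ⊗ B') ≫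
        tensorμ Y Y' B B' ≫ (g ⊗ₘ g') := by
      intro A A' B B' X X' Y Y' Z Z' f f' g g'
      rw [comp_whiskerRight, Category.assoc, tensorμ_natural_left_assoc,
        ← tensorHom_comp_tensorHom, ← tensorHom_comp_tensorHom, Iso.eq_inv_comp,
        ← tensor_associativity_assoc, tensorHom_comp_tensorHom_assoc]
      simp
    have e : ∀ x y z : V, unc (eComp V x y z) = (α_ x (iHom x y) (iHom y z)).inv ≫
        evl x y ▷ (iHom y z) ≫ evl y z := fun _ _ _ => MonoidalClosed.uncurry_curry _
    rw [prod_eComp, Category.assoc, unc_comp, unc_homTensor, unc_eComp, e, e]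
    refine (key _ _ _ _).trans ?_
    rw [unc_homTensor', unc_homTensor']
    rfl

theorem self_assoc (p q : (V × V) × V) :
    postc (((prodF (selfTens V) (EnrichedFunctor.id V V)).comp V (selfTens V)).map p q)
      (nm (α_ q.1.1 q.1.2 q.2).hom) =
    prec (nm (α_ p.1.1 p.1.2 p.2).hom) (((assocF V V V).comp V ((prodF (EnrichedFunctor.id V V)
      (selfTens V)).comp V (selfTens V))).map p q) := by
  apply self_square
  have key : ∀ {A B C X Y Z X' Y' Z' : V} (f : X ⊗ A ⟶ X') (g : Y ⊗ B ⟶ Y') (h : Z ⊗ C ⟶ Z'),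
      (tensorμ (X ⊗ Y) Z (A ⊗ B) C ≫ ((tensorμ X Y A B ≫ (f ⊗ₘ g)) ⊗ₘ h)) ≫ (α_ X' Y' Z').hom =
      (α_ X Y Z).hom ▷ ((A ⊗ B) ⊗ C) ≫ (X ⊗ Y ⊗ Z) ◁ (α_ A B C).hom ≫
        tensorμ X (Y ⊗ Z) A (B ⊗ C) ≫ (f ⊗ₘ (tensorμ Y Z B C ≫ (g ⊗ₘ h))) := by
    intro A B C X Y Z X' Y' Z' f g h
    have hm := associator_monoidal X Y Z A B C
    rw [comp_tensorHom', tensorHom_comp', Category.assoc, Category.assoc, associator_naturality]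
    rw [MonoidalCategory.tensorHom_def, Category.assoc] at hm
    exact (reassoc_of% hm) _
  have h₁ : unc (((prodF (selfTens V) (EnrichedFunctor.id V V)).comp V (selfTens V)).map p q) =
      tensorμ (p.1.1 ⊗ p.1.2) p.2 ((iHom p.1.1 q.1.1) ⊗ (iHom p.1.2 q.1.2)) (iHom p.2 q.2) ≫
        ((tensorμ p.1.1 p.1.2 (iHom p.1.1 q.1.1) (iHom p.1.2 q.1.2) ≫
          (evl p.1.1 q.1.1 ⊗ₘ evl p.1.2 q.1.2)) ⊗ₘ evl p.2 q.2) := by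
    refine (unc_homTensor (homTensor p.1.1 p.1.2 q.1.1 q.1.2) (𝟙 (iHom p.2 q.2))).trans ?_
    rw [unc_homTensor', unc_eq (𝟙 _)]
    simp
  have h₂ : unc (((assocF V V V).comp V ((prodF (EnrichedFunctor.id V V)
      (selfTens V)).comp V (selfTens V))).map p q) =
      (p.1.1 ⊗ p.1.2 ⊗ p.2) ◁ (α_ (iHom p.1.1 q.1.1) (iHom p.1.2 q.1.2) (iHom p.2 q.2)).hom ≫
      tensorμ p.1.1 (p.1.2 ⊗ p.2) (iHom p.1.1 q.1.1) ((iHom p.1.2 q.1.2) ⊗ (iHom p.2 q.2)) ≫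
        (evl p.1.1 q.1.1 ⊗ₘ (tensorμ p.1.2 p.2 (iHom p.1.2 q.1.2) (iHom p.2 q.2) ≫
          (evl p.1.2 q.1.2 ⊗ₘ evl p.2 q.2))) := by
    refine (unc_comp (α_ (iHom p.1.1 q.1.1) (iHom p.1.2 q.1.2) (iHom p.2 q.2)).hom
      ((𝟙 (iHom p.1.1 q.1.1) ⊗ₘ homTensor p.1.2 p.2 q.1.2 q.2) ≫ homTensor p.1.1 (p.1.2 ⊗ p.2)
        q.1.1 (q.1.2 ⊗ q.2))).trans ?_
    rw [unc_homTensor, unc_homTensor', unc_eq (𝟙 _)]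
    simp
  exact (congrArg (fun k => k ≫ (α_ q.1.1 q.1.2 q.2).hom) h₁).trans ((key _ _ _).trans
    (congrArg (fun k => (α_ p.1.1 p.1.2 p.2).hom ▷ _ ≫ k) h₂.symm))

theorem self_left (p q : PUnit.{w + 1} × V) :
    postc (((prodF (pointF (V := V) (𝟙_ V)) (EnrichedFunctor.id V V)).comp V (selfTens V)).map p q)
      (nm (λ_ q.2).hom) = prec (nm (λ_ p.2).hom) ((leftUnitF V).map p q) := by
  apply self_square
  have key : ∀ {A X Y : V} (f : X ⊗ A ⟶ Y),
      (tensorμ (𝟙_ V) X (𝟙_ V) A ≫ ((ρ_ (𝟙_ V)).hom ⊗ₘ f)) ≫ (λ_ Y).hom =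
      (λ_ X).hom ▷ (𝟙_ V ⊗ A) ≫ X ◁ (λ_ A).hom ≫ f := by
    intro A X Y f
    have hm := leftUnitor_monoidal X A
    rw [MonoidalCategory.tensorHom_def] at hm
    rw [← Category.assoc, hm, ← unitors_equal, MonoidalCategory.tensorHom_def]
    simp
  have h₁ : unc (((prodF (pointF (V := V) (𝟙_ V)) (EnrichedFunctor.id V V)).comp V
      (selfTens V)).map p q) =
      tensorμ (𝟙_ V) p.2 (𝟙_ V) (iHom p.2 q.2) ≫ ((ρ_ (𝟙_ V)).hom ⊗ₘ evl p.2 q.2) := by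
    refine (unc_homTensor (eId V (𝟙_ V)) (𝟙 (iHom p.2 q.2))).trans ?_
    rw [unc_eId, unc_eq (𝟙 _)]
    simp
  rw [h₁]
  exact key _

theorem self_right (p q : V × PUnit.{w + 1}) :
    postc (((prodF (EnrichedFunctor.id V V) (pointF (V := V) (𝟙_ V))).comp V (selfTens V)).map p q)
      (nm (ρ_ q.1).hom) = prec (nm (ρ_ p.1).hom) ((rightUnitF V).map p q) := by
  apply self_square
  have key : ∀ {A X Y : V} (f : X ⊗ A ⟶ Y),
      (tensorμ X (𝟙_ V) A (𝟙_ V) ≫ (f ⊗ₘ (ρ_ (𝟙_ V)).hom)) ≫ (ρ_ Y).hom =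
      (ρ_ X).hom ▷ (A ⊗ 𝟙_ V) ≫ X ◁ (ρ_ A).hom ≫ f := by
    intro A X Y f
    have hm := rightUnitor_monoidal X A
    rw [MonoidalCategory.tensorHom_def] at hm
    rw [← Category.assoc, hm, ← unitors_equal, MonoidalCategory.tensorHom_def']
    simp
  have h₁ : unc (((prodF (EnrichedFunctor.id V V) (pointF (V := V) (𝟙_ V))).comp V
      (selfTens V)).map p q) =
      tensorμ p.1 (𝟙_ V) (iHom p.1 q.1) (𝟙_ V) ≫ (evl p.1 q.1 ⊗ₘ (ρ_ (𝟙_ V)).hom) := by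
    refine (unc_homTensor (𝟙 (iHom p.1 q.1)) (eId V (𝟙_ V))).trans ?_
    rw [unc_eId, unc_eq (𝟙 _)]
    simp
  rw [h₁]
  exact key _

theorem self_braid (p q : V × V) :
    postc ((selfTens V).map p q) (nm (β_ q.1 q.2).hom) =
      prec (nm (β_ p.1 p.2).hom) (((swapF V V V).comp V (selfTens V)).map p q) := by
  apply self_square
  have key : ∀ {A B X Y X' Y' : V} (f : X ⊗ A ⟶ X') (g : Y ⊗ B ⟶ Y'),
      (tensorμ X Y A B ≫ (f ⊗ₘ g)) ≫ (β_ X' Y').hom =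
      (β_ X Y).hom ▷ (A ⊗ B) ≫ (Y ⊗ X) ◁ (β_ A B).hom ≫ tensorμ Y X B A ≫ (g ⊗ₘ f) := by
    intro A B X Y X' Y' f g
    have hm := tensorμ_braid X Y A B
    rw [MonoidalCategory.tensorHom_def, Category.assoc] at hm
    rw [Category.assoc, braiding_naturality]
    exact (reassoc_of% hm) _
  have h₁ : unc ((selfTens V).map p q) = _ := unc_homTensor'
  have h₂ : unc (((swapF V V V).comp V (selfTens V)).map p q) =
      (p.2 ⊗ p.1) ◁ (β_ (iHom p.1 q.1) (iHom p.2 q.2)).hom ≫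
        unc (homTensor p.2 p.1 q.2 q.1) := unc_comp _ _
  rw [unc_homTensor'] at h₂
  exact (congrArg (fun k => k ≫ (β_ q.1 q.2).hom) h₁).trans ((key _ _).trans
    (congrArg (fun k => (β_ p.1 p.2).hom ▷ _ ≫ k) h₂.symm))

theorem onEl_selfTens {x x' y y' : V} (f : x ⟶ y) (g : x' ⟶ y') :
    onEl (selfTens V) (pairEl (nm f) (nm g)) = nm (f ⊗ₘ g) :=
  (Category.assoc _ _ _).trans (homTensor_nm f g)

theorem onEl_selfTens_left {x y : V} (f : x ⟶ y) (z : V) :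
    onEl (selfTens V) (pairEl (nm f) (eId V z)) = nm (f ▷ z) := by
  rw [← nm_id, onEl_selfTens, tensorHom_id]

theorem onEl_selfTens_right {x y : V} (z : V) (f : x ⟶ y) :
    onEl (selfTens V) (pairEl (eId V z) (nm f)) = nm (z ◁ f) := by
  rw [← nm_id, onEl_selfTens, id_tensorHom]

theorem nm_pentagon (x y z t : V) : nm ((α_ x y z).hom ▷ t) ⊚ nm (α_ x (y ⊗ z) t).hom ⊚
    nm (x ◁ (α_ y z t).hom) = nm (α_ (x ⊗ y) z t).hom ⊚ nm (α_ x y (z ⊗ t)).hom := by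
  rw [nm_comp, nm_comp, nm_comp, MonoidalCategory.pentagon]

theorem nm_triangle (x y : V) : nm (α_ x (𝟙_ V) y).hom ⊚ nm (x ◁ (λ_ y).hom) =
    nm ((ρ_ x).hom ▷ y) := by
  rw [nm_comp, MonoidalCategory.triangle]

theorem nm_hexagon (x y z : V) : nm (α_ x y z).hom ⊚ nm (β_ x (y ⊗ z)).hom ⊚ nm (α_ y z x).hom =
    nm ((β_ x y).hom ▷ z) ⊚ nm (α_ y x z).hom ⊚ nm (y ◁ (β_ x z).hom) := by
  rw [nm_comp, nm_comp, nm_comp, nm_comp, hexagon_forward]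

theorem nm_symmetry (x y : V) : nm (β_ x y).hom ⊚ nm (β_ y x).hom = eId V (x ⊗ y) := by
  rw [nm_comp, SymmetricCategory.symmetry, nm_id]

/-- A symmetric closed monoidal category as a symmetric monoidal enriched category. -/
instance selfSymMon : SymMonECategory V V where
  tens := selfTens V
  unit := 𝟙_ V
  associator :=
    { hom :=
      { app p := nm (α_ p.1.1 p.1.2 p.2).hom
        naturality p q := self_assoc p q }
      inv :=
      { app p := nm (α_ p.1.1 p.1.2 p.2).inv
        naturality p q := square_inv (nm_inv_hom _)
          (nm_hom_inv _) (self_assoc p q) }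
      hom_inv _ := nm_hom_inv _
      inv_hom _ := nm_inv_hom _ }
  leftUnitor :=
    { hom :=
      { app p := nm (λ_ p.2).hom
        naturality p q := self_left p q }
      inv :=
      { app p := nm (λ_ p.2).inv
        naturality p q := square_inv (nm_inv_hom _)
          (nm_hom_inv _) (self_left p q) }
      hom_inv _ := nm_hom_inv _
      inv_hom _ := nm_inv_hom _ }
  rightUnitor :=
    { hom :=
      { app p := nm (ρ_ p.1).hom
        naturality p q := self_right p q }
      inv :=
      { app p := nm (ρ_ p.1).inv
        naturality p q := square_inv (nm_inv_hom _)
          (nm_hom_inv _) (self_right p q) }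
      hom_inv _ := nm_hom_inv _
      inv_hom _ := nm_inv_hom _ }
  braiding :=
    { app p := nm (β_ p.1 p.2).hom
      naturality p q := self_braid p q }
  pentagon x y z t := (congrArg₂ elComp (onEl_selfTens_left _ t) (congrArg (elComp _)
    (onEl_selfTens_right x _))).trans (nm_pentagon x y z t)
  triangle x y := (congrArg (elComp _) (onEl_selfTens_right x _)).trans
    ((nm_triangle x y).trans (onEl_selfTens_left _ y).symm)
  hexagon x y z := (nm_hexagon x y z).trans (congrArg₂ elComp (onEl_selfTens_left _ z)
    (congrArg (elComp _) (onEl_selfTens_right y _))).symm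
  symmetry x y := nm_symmetry x y

open Opposite

/-- The morphism `[x, y] ⊗ ([y, y'] ⊗ [x', x]) ⟶ [x', y']` given by composition. -/
def conjHom (x y x' y' : V) :
    (iHom x y) ⊗ ((iHom y y') ⊗ (iHom x' x)) ⟶ (iHom x' y') :=
  (α_ _ _ _).inv ≫ eComp V x y y' ▷ _ ≫ (β_ _ _).hom ≫ eComp V x' x y'

end SelfTensor

section InternalHom
open Opposite
variable {V : Type u} [Category.{v} V] [MonoidalCategory V] [SymmetricCategory V]

theorem tensorμ_assoc_left (P A B X Y : V) :
    P ◁ tensorμ A B X Y ≫ (α_ P (A ⊗ X) (B ⊗ Y)).inv ≫ (α_ P A X).inv ▷ (B ⊗ Y) =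
      (α_ P (A ⊗ B) (X ⊗ Y)).inv ≫ (α_ P A B).inv ▷ (X ⊗ Y) ≫ tensorμ (P ⊗ A) B X Y := by
  simp only [tensorμ]
  monoidal

theorem shuffle_eq (X B A Y : V) :
    tensorμ X B A Y ≫ (β_ (X ⊗ A) (B ⊗ Y)).hom ≫ (β_ B Y).hom ▷ (X ⊗ A) ≫
      (α_ Y B (X ⊗ A)).hom =
    (β_ X B).hom ▷ (A ⊗ Y) ≫ (α_ (B ⊗ X) A Y).inv ≫ (β_ ((B ⊗ X) ⊗ A) Y).hom ≫
      Y ◁ (α_ B X A).hom := by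
  have e : (β_ ((B ⊗ X) ⊗ A) Y).hom ≫ Y ◁ (α_ B X A).hom =
      (α_ B X A).hom ▷ Y ≫ (β_ (B ⊗ X ⊗ A) Y).hom := by
    rw [braiding_naturality_left]
  rw [e, braiding_tensor_left_hom B (X ⊗ A) Y, braiding_tensor_right_hom (X ⊗ A) B Y,
    braiding_tensor_left_hom X A B]
  simp only [tensorμ, comp_whiskerRight, Category.assoc]
  have h : (α_ X B (A ⊗ Y)).hom ≫ X ◁ (α_ B A Y).inv ≫ X ◁ (β_ B A).hom ▷ Y ≫
      X ◁ (α_ A B Y).hom ≫ (α_ X A (B ⊗ Y)).inv ≫ (α_ (X ⊗ A) B Y).inv ≫ (α_ X A B).hom ▷ Y ≫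
      (X ◁ (β_ A B).hom) ▷ Y ≫ (α_ X B A).inv ▷ Y = (α_ (X ⊗ B) A Y).inv := by
    have h' : (α_ X B (A ⊗ Y)).hom ≫ X ◁ (α_ B A Y).inv ≫ X ◁ (β_ B A).hom ▷ Y ≫
      X ◁ (α_ A B Y).hom ≫ (α_ X A (B ⊗ Y)).inv ≫ (α_ (X ⊗ A) B Y).inv ≫ (α_ X A B).hom ▷ Y ≫
      (X ◁ (β_ A B).hom) ▷ Y ≫ (α_ X B A).inv ▷ Y =
        (α_ (X ⊗ B) A Y).inv ≫ (α_ X B A).hom ▷ Y ≫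
          (X ◁ ((β_ B A).hom ≫ (β_ A B).hom)) ▷ Y ≫ (α_ X B A).inv ▷ Y := by
      monoidal
    rw [h', SymmetricCategory.symmetry]
    simp
  rw [reassoc_of% h, associator_inv_naturality_left_assoc]

variable [MonoidalClosed V]

variable (V) in
/-- The internal hom as an enriched functor, covariant in the first variable and contravariant
in the second one. -/
def internalHom : EnrichedFunctor V (V × Vᵒᵖ) V where
  obj p := iHom p.2.unop p.1
  map p q := cur (conjHom p.2.unop p.1 q.2.unop q.1)
  map_id p := by
    apply unc_injective
    have key : ∀ {P A B : V} (a : 𝟙_ V ⟶ A) (b : 𝟙_ V ⟶ B) (m : P ⊗ A ⟶ P) (n : B ⊗ P ⟶ P),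
        P ◁ a ≫ m = (ρ_ P).hom → b ▷ P ≫ n = (λ_ P).hom →
        P ◁ ((λ_ (𝟙_ V)).inv ≫ (a ⊗ₘ b)) ≫ (α_ P A B).inv ≫ m ▷ B ≫ (β_ P B).hom ≫ n =
          (ρ_ P).hom := by
      intro P A B a b m n h h'
      rw [MonoidalCategory.tensorHom_def]
      simp only [MonoidalCategory.whiskerLeft_comp, Category.assoc,
        associator_inv_naturality_right_assoc]
      rw [whisker_exchange_assoc, associator_inv_naturality_middle_assoc]
      rw [← comp_whiskerRight_assoc, h, braiding_naturality_right_assoc, h']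
      simp
    rw [unc_comp, unc_cur, unc_eId]
    have h := e_comp_id V p.2.unop p.1
    have h' := e_id_comp V p.2.unop p.1
    rw [Iso.inv_comp_eq, Category.comp_id] at h h'
    exact key _ _ _ _ h h'
  map_comp p q r := by
    apply unc_injective
    have key : ∀ {P A B A' B' PA PAA AA BB S T N : V} (m₁ : P ⊗ A ⟶ PA) (m₂ : PA ⊗ A' ⟶ PAA)
      (m : A ⊗ A' ⟶ AA) (m₃ : P ⊗ AA ⟶ PAA) (n : B' ⊗ B ⟶ BB) (n₁ : BB ⊗ PAA ⟶ N)
      (n₂ : B ⊗ PAA ⟶ S) (n₃ : B' ⊗ S ⟶ N) (k : B ⊗ PA ⟶ T) (k₁ : T ⊗ A' ⟶ S),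
      (α_ P A A').inv ≫ m₁ ▷ A' ≫ m₂ = P ◁ m ≫ m₃ →
      (α_ B' B PAA).inv ≫ n ▷ PAA ≫ n₁ = B' ◁ n₂ ≫ n₃ →
      (α_ B PA A').inv ≫ k ▷ A' ≫ k₁ = B ◁ m₂ ≫ n₂ →
      P ◁ (tensorμ A B A' B' ≫ (m ⊗ₘ ((β_ B B').hom ≫ n))) ≫ (α_ P AA BB).inv ≫ m₃ ▷ BB ≫
        (β_ PAA BB).hom ≫ n₁ =
      (α_ P (A ⊗ B) (A' ⊗ B')).inv ≫ ((α_ P A B).inv ≫ m₁ ▷ B ≫ (β_ PA B).hom ≫ k) ▷ (A' ⊗ B') ≫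
        (α_ T A' B').inv ≫ k₁ ▷ B' ≫ (β_ S B').hom ≫ n₃ := by
      intro P A B A' B' PA PAA AA BB S T N m₁ m₂ m m₃ n n₁ n₂ n₃ k k₁ h₁ h₂ h₃
      have h₂' : n ▷ PAA ≫ n₁ = (α_ B' B PAA).hom ≫ B' ◁ n₂ ≫ n₃ := by
        rw [← h₂, Iso.hom_inv_id_assoc]
      have e₁ : P ◁ (tensorμ A B A' B' ≫ (m ⊗ₘ ((β_ B B').hom ≫ n))) ≫ (α_ P AA BB).inv ≫
          m₃ ▷ BB ≫ (β_ PAA BB).hom ≫ n₁ =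
        P ◁ tensorμ A B A' B' ≫ (α_ P (A ⊗ A') (B ⊗ B')).inv ≫ (P ◁ m ≫ m₃) ▷ (B ⊗ B') ≫
          (β_ PAA (B ⊗ B')).hom ≫ (β_ B B').hom ▷ PAA ≫ n ▷ PAA ≫ n₁ := by
        rw [MonoidalCategory.tensorHom_def]
        simp only [MonoidalCategory.whiskerLeft_comp, Category.assoc, comp_whiskerRight,
          associator_inv_naturality_right_assoc, associator_inv_naturality_middle_assoc]
        rw [← braiding_naturality_right_assoc, ← braiding_naturality_right_assoc,
          whisker_exchange_assoc, whisker_exchange_assoc]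
      rw [e₁, ← h₁, h₂']
      simp only [comp_whiskerRight, Category.assoc]
      rw [reassoc_of% tensorμ_assoc_left P A B A' B']
      have e₂ : tensorμ (P ⊗ A) B A' B' ≫ m₁ ▷ A' ▷ (B ⊗ B') =
          m₁ ▷ B ▷ (A' ⊗ B') ≫ tensorμ PA B A' B' := by
        have := tensorμ_natural_left m₁ (𝟙 B) A' B'
        simpa using this.symm
      have e₃ : m₂ ▷ (B ⊗ B') ≫ (β_ PAA (B ⊗ B')).hom ≫ (β_ B B').hom ▷ PAA ≫
          (α_ B' B PAA).hom ≫ B' ◁ n₂ = ((β_ (PA ⊗ A') (B ⊗ B')).hom ≫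
          (β_ B B').hom ▷ (PA ⊗ A') ≫ (α_ B' B (PA ⊗ A')).hom) ≫ B' ◁ (B ◁ m₂ ≫ n₂) := by
        rw [braiding_naturality_left_assoc, whisker_exchange_assoc]
        simp
      rw [reassoc_of% e₂, reassoc_of% e₃, ← h₃]
      rw [reassoc_of% shuffle_eq PA B A' B']
      simp only [MonoidalCategory.whiskerLeft_comp, Category.assoc, whiskerLeft_hom_inv_assoc]
      rw [← braiding_naturality_left_assoc, ← braiding_naturality_left_assoc]
      simp only [associator_inv_naturality_left_assoc]
    rw [unc_comp, unc_eComp, unc_cur, unc_cur, unc_cur, prod_eComp]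
    exact key _ _ _ _ _ _ _ _ _ _ (e_assoc V _ _ _ _)
      (e_assoc V r.2.unop q.2.unop p.2.unop r.1) (e_assoc V q.2.unop p.2.unop q.1 r.1)

end InternalHom

section LaxFunctors

variable {V : Type u} [Category.{v} V] [MonoidalCategory V] [SymmetricCategory V]
  {C : Type w₁} [EnrichedCategory V C] [SymMonECategory V C]
  {D : Type w₂} [EnrichedCategory V D] [SymMonECategory V D]
  {E : Type w₃} [EnrichedCategory V E] [SymMonECategory V E]
  {C' : Type w₄} [EnrichedCategory V C'] [SymMonECategory V C']
  {D' : Type w₅} [EnrichedCategory V D'] [SymMonECategory V D']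

/-- Lax symmetric monoidal structures on an enriched functor: `ε` has type `1 ⟶ F 1`, the components
of the enriched natural transformation `μ` have type `F x ⊗ F y ⟶ F (x ⊗ y)`, and they are
compatible with the associativity, unit and symmetry constraints. -/
structure LaxStr (F : EnrichedFunctor V C D) where
  ε : 𝟙_ V ⟶ (unitObj V D ⟶[V] F.obj (unitObj V C))
  μ : ENatTrans ((prodF F F).comp V (SymMonECategory.tens (V := V) (C := D)))
    ((SymMonECategory.tens (V := V) (C := C)).comp V F)
  associativity (x y z : C) :
    tEl (μ.app (x, y)) (eId V (F.obj z)) ⊚ μ.app (tObj V x y, z) ⊚ onEl F (aHom V x y z) =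
      aHom V (F.obj x) (F.obj y) (F.obj z) ⊚
        tEl (eId V (F.obj x)) (μ.app (y, z)) ⊚ μ.app (x, tObj V y z)
  left_unitality (x : C) : lHom V (F.obj x) =
    tEl ε (eId V (F.obj x)) ⊚ μ.app (unitObj V C, x) ⊚ onEl F (lHom V x)
  right_unitality (x : C) : rHom V (F.obj x) =
    tEl (eId V (F.obj x)) ε ⊚ μ.app (x, unitObj V C) ⊚ onEl F (rHom V x)
  braided (x y : C) : μ.app (x, y) ⊚ onEl F (bHom V x y) =
    bHom V (F.obj x) (F.obj y) ⊚ μ.app (y, x)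

variable (V C D) in
/-- Lax symmetric monoidal enriched functors. -/
structure LaxSMFunctor where
  toF : EnrichedFunctor V C D
  str : LaxStr toF

variable (V) in
/-- The ordinary functor underlying an enriched functor. -/
@[simps]
def undF {C : Type w₁} [EnrichedCategory V C] {D : Type w₂} [EnrichedCategory V D]
    (F : EnrichedFunctor V C D) : Und V C ⥤ Und V D where
  obj x := F.obj x
  map a := onEl F a
  map_id x := onEl_id (C := C) F x
  map_comp a b := onEl_comp (C := C) F a b

theorem LaxStr.μ_natural {F : EnrichedFunctor V C D} (L : LaxStr F) {x x' y y' : C}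
    (a : 𝟙_ V ⟶ (x ⟶[V] x')) (b : 𝟙_ V ⟶ (y ⟶[V] y')) :
    tEl (onEl F a) (onEl F b) ⊚ L.μ.app (x', y') = L.μ.app (x, y) ⊚ onEl F (tEl a b) := by
  have h := L.μ.naturality_el (pairEl a b)
  rw [onEl_comp_functor, onEl_prodF, onEl_comp_functor] at h
  exact h

theorem LaxStr.μ_natural_left {F : EnrichedFunctor V C D} (L : LaxStr F) {x x' : C} (y : C)
    (a : 𝟙_ V ⟶ (x ⟶[V] x')) : tEl (onEl F a) (eId V (F.obj y)) ⊚ L.μ.app (x', y) =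
      L.μ.app (x, y) ⊚ onEl F (tEl a (eId V y)) := by
  rw [← onEl_id, L.μ_natural]

theorem LaxStr.μ_natural_right {F : EnrichedFunctor V C D} (L : LaxStr F) {x x' : C} (y : C)
    (a : 𝟙_ V ⟶ (x ⟶[V] x')) : tEl (eId V (F.obj y)) (onEl F a) ⊚ L.μ.app (y, x') =
      L.μ.app (y, x) ⊚ onEl F (tEl (eId V y) a) := by
  rw [← onEl_id, L.μ_natural]

/-- The lax monoidal structure on the underlying functor. -/
@[reducible]
def LaxStr.toLaxBraided {F : EnrichedFunctor V C D} (L : LaxStr F) : (undF V F).LaxBraided where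
  ε := L.ε
  μ x y := L.μ.app (x, y)
  μ_natural_left a x' := L.μ_natural_left x' a
  μ_natural_right x' a := L.μ_natural_right x' a
  associativity x y z := L.associativity x y z
  left_unitality x := L.left_unitality x
  right_unitality x := L.right_unitality x
  braided x y := L.braided x y

theorem square_congr {c : V} {C : Type w} [EnrichedCategory V C] {x y x' y' : C}
    {f f' : c ⟶ (x ⟶[V] y)}
    {g g' : c ⟶ (x' ⟶[V] y')} {a : 𝟙_ V ⟶ (x ⟶[V] x')} {b : 𝟙_ V ⟶ (y ⟶[V] y')}
    (hf : f' = f) (hg : g' = g) (h : postc f b = prec a g) : postc f' b = prec a g' := by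
  rw [hf, hg, h]

/-- The identity lax functor. -/
def LaxStr.id : LaxStr (EnrichedFunctor.id V C) where
  ε := eId V _
  μ :=
    { app p := eId V (tObj V p.1 p.2)
      naturality p q := square_of_eq (by
        have key : ∀ {A B N : V} (t : A ⊗ B ⟶ N), (𝟙 A ⊗ₘ 𝟙 B) ≫ t = t ≫ 𝟙 N := by simp
        exact key _) }
  associativity x y z := by
    simp only [onEl_id_functor]
    exact Functor.LaxMonoidal.associativity (𝟭 (Und V C)) x y z
  left_unitality x := by
    simp only [onEl_id_functor]
    exact Functor.LaxMonoidal.left_unitality (𝟭 (Und V C)) x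
  right_unitality x := by
    simp only [onEl_id_functor]
    exact Functor.LaxMonoidal.right_unitality (𝟭 (Und V C)) x
  braided x y := by
    simp only [onEl_id_functor]
    exact Functor.LaxBraided.braided (F := 𝟭 (Und V C)) x y

/-- The composite of lax functors. -/
def LaxStr.comp {F : EnrichedFunctor V C D} {G : EnrichedFunctor V D E} (L : LaxStr F)
    (M : LaxStr G) : LaxStr (F.comp V G) where
  ε := M.ε ⊚ onEl G L.ε
  μ :=
    { app p := M.μ.app (F.obj p.1, F.obj p.2) ⊚ onEl G (L.μ.app p)
      naturality p q := by
        refine square_congr ?_ ?_ (square_comp (square_precomp ((prodF F F).map p q)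
          (M.μ.naturality (F.obj p.1, F.obj p.2) (F.obj q.1, F.obj q.2)))
          (square_congr (Category.assoc _ _ _).symm rfl (square_map G (L.μ.naturality p q))))
        · have key : ∀ {A B A' B' A'' B'' N : V} (f : A ⟶ A') (f' : A' ⟶ A'') (g : B ⟶ B')
            (g' : B' ⟶ B'') (t : A'' ⊗ B'' ⟶ N), ((f ≫ f') ⊗ₘ (g ≫ g')) ≫ t =
              (f ⊗ₘ g) ≫ (f' ⊗ₘ g') ≫ t := by
            intros
            rw [tensorHom_comp_tensorHom_assoc]
          exact key _ _ _ _ _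
        · exact (Category.assoc _ _ _).symm }
  associativity x y z := by
    simp only [onEl_comp_functor]
    let := L.toLaxBraided
    let := M.toLaxBraided
    exact Functor.LaxMonoidal.associativity (undF V F ⋙ undF V G) x y z
  left_unitality x := by
    simp only [onEl_comp_functor]
    let := L.toLaxBraided
    let := M.toLaxBraided
    exact Functor.LaxMonoidal.left_unitality (undF V F ⋙ undF V G) x
  right_unitality x := by
    simp only [onEl_comp_functor]
    let := L.toLaxBraided
    let := M.toLaxBraided
    exact Functor.LaxMonoidal.right_unitality (undF V F ⋙ undF V G) x
  braided x y := by
    simp only [onEl_comp_functor]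
    let := L.toLaxBraided
    let := M.toLaxBraided
    exact Functor.LaxBraided.braided (F := undF V F ⋙ undF V G) x y

/-- The tensor product of lax functors. -/
def LaxStr.prod {F : EnrichedFunctor V C C'} {G : EnrichedFunctor V D D'} (L : LaxStr F)
    (M : LaxStr G) : LaxStr (prodF F G) where
  ε := pairEl L.ε M.ε
  μ :=
    { app p := pairEl (L.μ.app (p.1.1, p.2.1)) (M.μ.app (p.1.2, p.2.2))
      naturality p q := by
        refine square_prod_of (tensorμ _ _ _ _) (L.μ.naturality (p.1.1, p.2.1) (q.1.1, q.2.1))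
          (M.μ.naturality (p.1.2, p.2.2) (q.1.2, q.2.2)) ?_ ?_
        · have key : ∀ {A B A' B' X Y X' Y' N N' : V} (f : A ⟶ A') (g : B ⟶ B') (h : X ⟶ X')
            (k : Y ⟶ Y') (t : A' ⊗ X' ⟶ N) (t' : B' ⊗ Y' ⟶ N'),
            ((f ⊗ₘ g) ⊗ₘ (h ⊗ₘ k)) ≫ tensorμ A' B' X' Y' ≫ (t ⊗ₘ t') =
              tensorμ A B X Y ≫ (((f ⊗ₘ h) ≫ t) ⊗ₘ ((g ⊗ₘ k) ≫ t')) := by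
            intros
            rw [tensorμ_natural_assoc, tensorHom_comp_tensorHom]
          exact key _ _ _ _ _ _
        · exact (Category.assoc _ _ _).trans (congrArg _ (tensorHom_comp_tensorHom _ _ _ _)) }
  associativity x y z := by
    refine (congrArg₂ elComp (onEl_prodTens _ _ (eId V (F.obj z.1)) (eId V (G.obj z.2)))
      ((congrArg (elComp _) (onEl_prodF F G _ _)).trans (pairEl_comp _ _ _ _))).trans
      ((pairEl_comp _ _ _ _).trans ?_)
    refine Eq.trans ?_ ((congrArg (elComp _) ((congrArg₂ elComp (onEl_prodTens
      (eId V (F.obj x.1)) (eId V (G.obj x.2)) _ _) rfl).trans (pairEl_comp _ _ _ _))).trans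
      (pairEl_comp _ _ _ _)).symm
    exact congrArg₂ pairEl (L.associativity x.1 y.1 z.1) (M.associativity x.2 y.2 z.2)
  left_unitality x := by
    refine Eq.trans ?_ (congrArg₂ elComp (onEl_prodTens _ _ (eId V (F.obj x.1))
      (eId V (G.obj x.2))) ((congrArg (elComp _) (onEl_prodF F G _ _)).trans
        (pairEl_comp _ _ _ _))).symm
    exact (congrArg₂ pairEl (L.left_unitality x.1) (M.left_unitality x.2)).trans
      (pairEl_comp _ _ _ _).symm
  right_unitality x := by
    refine Eq.trans ?_ (congrArg₂ elComp (onEl_prodTens (eId V (F.obj x.1))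
      (eId V (G.obj x.2)) _ _) ((congrArg (elComp _) (onEl_prodF F G _ _)).trans
        (pairEl_comp _ _ _ _))).symm
    exact (congrArg₂ pairEl (L.right_unitality x.1) (M.right_unitality x.2)).trans
      (pairEl_comp _ _ _ _).symm
  braided x y := by
    refine (congrArg (elComp _) (onEl_prodF F G _ _)).trans ((pairEl_comp _ _ _ _).trans ?_)
    exact (congrArg₂ pairEl (L.braided x.1 y.1) (M.braided x.2 y.2)).trans
      (pairEl_comp _ _ _ _).symm

end LaxFunctors

section Strict

variable {V : Type u} [Category.{v} V] [MonoidalCategory V] [SymmetricCategory V]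
  {C : Type w₁} [EnrichedCategory V C] [SymMonECategory V C]
  {D : Type w₂} [EnrichedCategory V D] [SymMonECategory V D]
  {E : Type w₃} [EnrichedCategory V E] [SymMonECategory V E]

theorem strict_assoc {C : Type w} [EnrichedCategory V C] {x y : C} {a b : 𝟙_ V ⟶ (x ⟶[V] x)}
    {c d : 𝟙_ V ⟶ (x ⟶[V] y)} {e f : 𝟙_ V ⟶ (y ⟶[V] y)} (ha : a = eId V x) (hb : b = eId V x)
    (he : e = eId V y) (hf : f = eId V y) (h : c = d) : a ⊚ b ⊚ c = d ⊚ e ⊚ f := by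
  rw [ha, hb, he, hf, h]
  simp

theorem strict_unit {C : Type w} [EnrichedCategory V C] {x y : C} {a b : 𝟙_ V ⟶ (x ⟶[V] x)}
    {c d : 𝟙_ V ⟶ (x ⟶[V] y)} (ha : a = eId V x) (hb : b = eId V x)
    (h : c = d) : d = a ⊚ b ⊚ c := by
  rw [ha, hb, h]
  simp

theorem strict_braid {C : Type w} [EnrichedCategory V C] {x y : C} {a : 𝟙_ V ⟶ (x ⟶[V] x)}
    {c d : 𝟙_ V ⟶ (x ⟶[V] y)} {e : 𝟙_ V ⟶ (y ⟶[V] y)} (ha : a = eId V x)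
    (he : e = eId V y) (h : c = d) : a ⊚ c = d ⊚ e := by
  rw [ha, he, h]
  simp

variable (V C D E) in
/-- The associativity isomorphism is a strict symmetric monoidal functor. -/
def LaxStr.assoc : LaxStr (assocF (V := V) C D E) where
  ε := eId V (unitObj V (C × (D × E)))
  μ :=
    { app p := eId V (tObj V ((assocF (V := V) C D E).obj p.1) ((assocF (V := V) C D E).obj p.2))
      naturality p q := square_of_eq (by
        have key : ∀ {A B X A' B' X' N N' N'' : V} (t : A ⊗ A' ⟶ N) (t' : B ⊗ B' ⟶ N')
            (t'' : X ⊗ X' ⟶ N''), ((α_ A B X).hom ⊗ₘ (α_ A' B' X').hom) ≫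
              tensorμ A (B ⊗ X) A' (B' ⊗ X') ≫ (t ⊗ₘ (tensorμ B X B' X' ≫ (t' ⊗ₘ t''))) =
            (tensorμ (A ⊗ B) X (A' ⊗ B') X' ≫ ((tensorμ A B A' B' ≫ (t ⊗ₘ t')) ⊗ₘ t'')) ≫
              (α_ N N' N'').hom := by
          intro A B X A' B' X' N N' N'' t t' t''
          have h := associator_monoidal A B X A' B' X'
          rw [comp_tensorHom', tensorHom_comp', Category.assoc, Category.assoc,
            associator_naturality]
          exact ((reassoc_of% h) _).symm
        exact key _ _ _) }
  associativity x y z := strict_assoc (tEl_id _ _) rfl (tEl_id _ _) rfl (onEl_assocF _ _ _)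
  left_unitality x := strict_unit (tEl_id _ _) rfl (onEl_assocF _ _ _)
  right_unitality x := strict_unit (tEl_id _ _) rfl (onEl_assocF _ _ _)
  braided x y := strict_braid rfl rfl (onEl_assocF _ _ _)

variable (V C) in
/-- The left unit isomorphism is a strict symmetric monoidal functor. -/
def LaxStr.leftUnit : LaxStr (leftUnitF.{v, u, w} (V := V) C) where
  ε := eId V (unitObj V C)
  μ :=
    { app p := eId V (tObj V p.1.2 p.2.2)
      naturality p q := square_of_eq (by
        have key : ∀ {A A' N : V} (t : A ⊗ A' ⟶ N), ((λ_ A).hom ⊗ₘ (λ_ A').hom) ≫ t =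
            (tensorμ (𝟙_ V) A (𝟙_ V) A' ≫ ((λ_ (𝟙_ V)).hom ⊗ₘ t)) ≫ (λ_ N).hom := by
          intro A A' N t
          rw [leftUnitor_monoidal, MonoidalCategory.tensorHom_def]
          simp
        exact key _) }
  associativity x y z := strict_assoc (tEl_id _ _) rfl (tEl_id _ _) rfl (onEl_leftUnitF _)
  left_unitality x := strict_unit (tEl_id _ _) rfl (onEl_leftUnitF _)
  right_unitality x := strict_unit (tEl_id _ _) rfl (onEl_leftUnitF _)
  braided x y := strict_braid rfl rfl (onEl_leftUnitF _)

variable (V C) in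
/-- The right unit isomorphism is a strict symmetric monoidal functor. -/
def LaxStr.rightUnit : LaxStr (rightUnitF.{v, u, w} (V := V) C) where
  ε := eId V (unitObj V C)
  μ :=
    { app p := eId V (tObj V p.1.1 p.2.1)
      naturality p q := square_of_eq (by
        have key : ∀ {A A' N : V} (t : A ⊗ A' ⟶ N), ((ρ_ A).hom ⊗ₘ (ρ_ A').hom) ≫ t =
            (tensorμ A (𝟙_ V) A' (𝟙_ V) ≫ (t ⊗ₘ (λ_ (𝟙_ V)).hom)) ≫ (ρ_ N).hom := by
          intro A A' N t
          rw [rightUnitor_monoidal, MonoidalCategory.tensorHom_def']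
          simp
        exact key _) }
  associativity x y z := strict_assoc (tEl_id _ _) rfl (tEl_id _ _) rfl (onEl_rightUnitF _)
  left_unitality x := strict_unit (tEl_id _ _) rfl (onEl_rightUnitF _)
  right_unitality x := strict_unit (tEl_id _ _) rfl (onEl_rightUnitF _)
  braided x y := strict_braid rfl rfl (onEl_rightUnitF _)

theorem point_assoc (M : Type u) [Category.{v} M] [MonoidalCategory M] :
    (λ_ (𝟙_ M)).hom ▷ (𝟙_ M) ≫ (λ_ (𝟙_ M)).hom ≫ 𝟙 (𝟙_ M) =
      (α_ (𝟙_ M) (𝟙_ M) (𝟙_ M)).hom ≫ (𝟙_ M) ◁ (λ_ (𝟙_ M)).hom ≫ (λ_ (𝟙_ M)).hom := by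
  monoidal

theorem point_left (M : Type u) [Category.{v} M] [MonoidalCategory M] :
    (λ_ (𝟙_ M)).hom = 𝟙 (𝟙_ M) ▷ (𝟙_ M) ≫ (λ_ (𝟙_ M)).hom ≫ 𝟙 (𝟙_ M) := by
  monoidal

theorem point_right (M : Type u) [Category.{v} M] [MonoidalCategory M] :
    (ρ_ (𝟙_ M)).hom = 𝟙 (𝟙_ M) ▷ (𝟙_ M) ≫ (λ_ (𝟙_ M)).hom ≫ 𝟙 (𝟙_ M) := by
  monoidal

theorem point_braid (M : Type u) [Category.{v} M] [MonoidalCategory M] [BraidedCategory M] :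
    (λ_ (𝟙_ M)).hom ≫ 𝟙 (𝟙_ M) = (β_ (𝟙_ M) (𝟙_ M)).hom ≫ (λ_ (𝟙_ M)).hom := by
  rw [braiding_tensorUnit_left, unitors_equal]
  simp

/-- The unit of a symmetric monoidal enriched category as a lax functor. -/
def LaxStr.point : LaxStr (pointF.{v, u, w} (V := V) (unitObj V C)) where
  ε := eId V (unitObj V C)
  μ :=
    { app p := lHom V (unitObj V C)
      naturality p q := by
        have h := (SymMonECategory.leftUnitor (V := V) (C := C)).hom.naturality
          (⟨⟩, unitObj V C) (⟨⟩, unitObj V C)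
        have h' := square_precomp (𝟙_ V ◁ eId V (unitObj V C)) h
        refine square_congr ?_ ?_ h'
        · have key : ∀ {A N : V} (a : 𝟙_ V ⟶ A) (t : A ⊗ A ⟶ N), (a ⊗ₘ a) ≫ t =
              𝟙_ V ◁ a ≫ (a ⊗ₘ 𝟙 A) ≫ t := by
            intro A N a t
            rw [tensorHom_id, ← tensorHom_def'_assoc]
          exact key _ _
        · exact (leftUnitor_naturality _).symm }
  associativity x y z := (congrArg (fun k => elComp _ (elComp _ k))
    (onEl_id (pointF (V := V) (unitObj V C)) ⟨⟩)).trans (point_assoc (Und V C))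
  left_unitality x := (point_left (Und V C)).trans (congrArg (fun k => elComp _ (elComp _ k))
    (onEl_id (pointF (V := V) (unitObj V C)) ⟨⟩).symm)
  right_unitality x := (point_right (Und V C)).trans (congrArg (fun k => elComp _ (elComp _ k))
    (onEl_id (pointF (V := V) (unitObj V C)) ⟨⟩).symm)
  braided x y := (congrArg (fun k => elComp _ k)
    (onEl_id (pointF (V := V) (unitObj V C)) ⟨⟩)).trans (point_braid (Und V C))

/-- The tensor product of generalized elements. -/
def tGen {c d : V} {x y x' y' : C} (f : c ⟶ (x ⟶[V] y)) (g : d ⟶ (x' ⟶[V] y')) :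
    c ⊗ d ⟶ (tObj V x x' ⟶[V] tObj V y y') :=
  pairGen f g ≫ (SymMonECategory.tens (V := V) (C := C)).map (x, x') (y, y')

section TGen

variable {c d e c' d' e' : V} {x y x' y' X Y X' Y' z t z' t' : C}

theorem tGen_precomp_left (k : c' ⟶ c) (f : c ⟶ (x ⟶[V] y)) (g : d ⟶ (x' ⟶[V] y')) :
    tGen (k ≫ f) g = k ▷ d ≫ tGen f g := by
  rw [tGen, tGen, pairGen, pairGen, comp_tensorHom', Category.assoc]

theorem tGen_precomp_right (k : d' ⟶ d) (f : c ⟶ (x ⟶[V] y)) (g : d ⟶ (x' ⟶[V] y')) :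
    tGen f (k ≫ g) = c ◁ k ≫ tGen f g := by
  rw [tGen, tGen, pairGen, pairGen, tensorHom_comp', Category.assoc]

theorem square_tGen {f : c ⟶ (x ⟶[V] y)}
    {g : c ⟶ (x' ⟶[V] y')} {a : 𝟙_ V ⟶ (x ⟶[V] x')} {b : 𝟙_ V ⟶ (y ⟶[V] y')}
    {f' : d ⟶ (X ⟶[V] Y)}
    {g' : d ⟶ (X' ⟶[V] Y')} {a' : 𝟙_ V ⟶ (X ⟶[V] X')} {b' : 𝟙_ V ⟶ (Y ⟶[V] Y')}
    (h : postc f b = prec a g) (h' : postc f' b' = prec a' g') :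
    postc (tGen f f') (tEl b b') = prec (tEl a a') (tGen g g') :=
  square_map _ (square_prod h h')

theorem square_aHom (f : c ⟶ (x ⟶[V] y)) (g : d ⟶ (x' ⟶[V] y')) (h : e ⟶ (z ⟶[V] t)) :
    postc (tGen (tGen f g) h) (aHom V y y' t) =
      prec (aHom V x x' z) ((α_ c d e).hom ≫ tGen f (tGen g h)) := by
  refine square_congr ?_ ?_ (square_precomp ((f ⊗ₘ g) ⊗ₘ h)
    ((SymMonECategory.associator (V := V) (C := C)).hom.naturality ((x, x'), z) ((y, y'), t)))
  · have key : ∀ {A B X N M : V} (f : c ⟶ A) (g : d ⟶ B) (h : e ⟶ X) (k : A ⊗ B ⟶ N)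
        (l : N ⊗ X ⟶ M), (((f ⊗ₘ g) ≫ k) ⊗ₘ h) ≫ l = ((f ⊗ₘ g) ⊗ₘ h) ≫ (k ⊗ₘ 𝟙 X) ≫ l := by
      intros
      rw [tensorHom_comp_tensorHom_assoc, Category.comp_id]
    exact key _ _ _ _ _
  · have key : ∀ {A B X N M : V} (f : c ⟶ A) (g : d ⟶ B) (h : e ⟶ X) (k : B ⊗ X ⟶ N)
        (l : A ⊗ N ⟶ M), (α_ c d e).hom ≫ (f ⊗ₘ ((g ⊗ₘ h) ≫ k)) ≫ l =
          ((f ⊗ₘ g) ⊗ₘ h) ≫ (α_ A B X).hom ≫ (𝟙 A ⊗ₘ k) ≫ l := by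
      intros
      rw [associator_naturality_assoc, tensorHom_comp_tensorHom_assoc, Category.comp_id]
    exact key _ _ _ _ _

theorem square_aInv (f : c ⟶ (x ⟶[V] y)) (g : d ⟶ (x' ⟶[V] y')) (h : e ⟶ (z ⟶[V] t)) :
    postc (tGen f (tGen g h)) (aInv V y y' t) =
      prec (aInv V x x' z) ((α_ c d e).inv ≫ tGen (tGen f g) h) := by
  have hs := square_inv ((SymMonECategory.associator (V := V) (C := C)).inv_hom ((x, x'), z))
    ((SymMonECategory.associator (V := V) (C := C)).hom_inv ((y, y'), t)) (square_aHom f g h)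
  exact square_congr (Iso.inv_hom_id_assoc _ _).symm rfl (square_precomp (α_ c d e).inv hs)

theorem square_bHom (f : c ⟶ (x ⟶[V] y)) (g : d ⟶ (x' ⟶[V] y')) :
    postc (tGen f g) (bHom V y y') = prec (bHom V x x') ((β_ c d).hom ≫ tGen g f) := by
  refine square_congr rfl ?_ (square_precomp (f ⊗ₘ g)
    ((SymMonECategory.braiding (V := V) (C := C)).naturality (x, x') (y, y')))
  have key : ∀ {A B M : V} (f : c ⟶ A) (g : d ⟶ B)
      (l : B ⊗ A ⟶ M), (β_ c d).hom ≫ (g ⊗ₘ f) ≫ l = (f ⊗ₘ g) ≫ (β_ A B).hom ≫ l := by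
    intros
    rw [braiding_naturality_assoc]
  exact key _ _ _

variable (V) in
/-- The interchange map `(x ⊗ y) ⊗ (z ⊗ t) ⟶ (x ⊗ z) ⊗ (y ⊗ t)`. -/
def interEl (x y z t : C) :
    𝟙_ V ⟶ (tObj V (tObj V x y) (tObj V z t) ⟶[V] tObj V (tObj V x z) (tObj V y t)) :=
  aHom V x y (tObj V z t) ⊚ tEl (eId V x) (aInv V y z t) ⊚
    tEl (eId V x) (tEl (bHom V y z) (eId V t)) ⊚ tEl (eId V x) (aHom V z y t) ⊚
      aInv V x z (tObj V y t)

theorem square_inter (f : c ⟶ (x ⟶[V] y)) (g : d ⟶ (x' ⟶[V] y')) (h : c' ⟶ (X ⟶[V] Y))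
    (k : d' ⟶ (X' ⟶[V] Y')) :
    postc (tGen (tGen f g) (tGen h k)) (interEl V y y' Y Y') =
      prec (interEl V x x' X X') (tensorμ c d c' d' ≫ tGen (tGen f h) (tGen g k)) := by
  have s₁ := square_aHom f g (tGen h k)
  have s₂ := square_tGen (square_id f) (square_aInv g h k)
  have s₃ := square_tGen (square_id f) (square_tGen (square_bHom g h) (square_id k))
  have s₄ := square_tGen (square_id f) (square_aHom h g k)
  have s₅ := square_aInv f h (tGen g k)
  simp only [tGen_precomp_left, tGen_precomp_right] at s₂ s₃ s₄
  have r := square_comp s₁ (square_precomp (α_ c d (c' ⊗ d')).hom (square_comp s₂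
    (square_precomp (c ◁ (α_ d c' d').inv) (square_comp s₃
      (square_precomp (c ◁ (β_ d c').hom ▷ d') (square_comp s₄
        (square_precomp (c ◁ (α_ c' d d').hom) s₅)))))))
  exact square_congr rfl (by simp only [tensorμ, Category.assoc]) r

end TGen

variable (V C) in
/-- The tensor product of a symmetric monoidal enriched category as a lax functor. -/
def LaxStr.tens : LaxStr (SymMonECategory.tens (V := V) (C := C)) where
  ε := lInv V (unitObj V C)
  μ :=
    { app p := interEl V p.1.1 p.1.2 p.2.1 p.2.2
      naturality p q := by
        refine square_congr ?_ ?_ (square_inter (𝟙 (p.1.1 ⟶[V] q.1.1)) (𝟙 (p.1.2 ⟶[V] q.1.2))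
          (𝟙 (p.2.1 ⟶[V] q.2.1)) (𝟙 (p.2.2 ⟶[V] q.2.2)))
        · have key : ∀ {A A' B B' N N' M : V} (k : A ⊗ A' ⟶ N) (k' : B ⊗ B' ⟶ N')
              (l : N ⊗ N' ⟶ M), (k ⊗ₘ k') ≫ l =
                (((𝟙 A ⊗ₘ 𝟙 A') ≫ k) ⊗ₘ ((𝟙 B ⊗ₘ 𝟙 B') ≫ k')) ≫ l := by
            intros
            simp
          exact key _ _ _
        · have key : ∀ {A A' B B' N N' M : V} (k : A ⊗ B ⟶ N) (k' : A' ⊗ B' ⟶ N')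
              (l : N ⊗ N' ⟶ M), (tensorμ A A' B B' ≫ (k ⊗ₘ k')) ≫ l = tensorμ A A' B B' ≫
                (((𝟙 A ⊗ₘ 𝟙 B) ≫ k) ⊗ₘ ((𝟙 A' ⊗ₘ 𝟙 B') ≫ k')) ≫ l := by
            intros
            simp
          exact key _ _ _ }
  associativity x y z := tensor_associativity (C := Und V C) x.1 x.2 y.1 y.2 z.1 z.2
  left_unitality x := tensor_left_unitality (C := Und V C) x.1 x.2
  right_unitality x := tensor_right_unitality (C := Und V C) x.1 x.2
  braided x y := (braid_tensorμ (V := Und V C) x.1 x.2 y.1 y.2).symm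

end Strict

section TwoCategory

variable {V : Type u} [Category.{v} V] [MonoidalCategory V] [SymmetricCategory V]
  {C : Type w₁} [EnrichedCategory V C] [SymMonECategory V C]
  {D : Type w₂} [EnrichedCategory V D] [SymMonECategory V D]
  {E : Type w₃} [EnrichedCategory V E] [SymMonECategory V E]
  {C' : Type w₄} [EnrichedCategory V C'] [SymMonECategory V C']
  {D' : Type w₅} [EnrichedCategory V D'] [SymMonECategory V D']

namespace LaxSMFunctor

variable (V C) in
/-- The identity lax functor. -/
def id : LaxSMFunctor V C C := ⟨EnrichedFunctor.id V C, LaxStr.id⟩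

/-- The composite (in diagrammatic order) of lax functors. -/
def comp (F : LaxSMFunctor V C D) (G : LaxSMFunctor V D E) : LaxSMFunctor V C E :=
  ⟨F.toF.comp V G.toF, F.str.comp G.str⟩

/-- The tensor product of lax functors. -/
def prod (F : LaxSMFunctor V C C') (G : LaxSMFunctor V D D') :
    LaxSMFunctor V (C × D) (C' × D') :=
  ⟨prodF F.toF G.toF, F.str.prod G.str⟩

variable (V C D E) in
/-- The associativity isomorphism `(C ⊗ D) ⊗ E ⟶ C ⊗ (D ⊗ E)`. -/
def assoc : LaxSMFunctor V ((C × D) × E) (C × (D × E)) := ⟨assocF C D E, LaxStr.assoc V C D E⟩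

variable (V C) in
/-- The left unit isomorphism. -/
def leftUnit : LaxSMFunctor V (PUnit.{1} × C) C := ⟨leftUnitF C, LaxStr.leftUnit V C⟩

variable (V C) in
/-- The right unit isomorphism. -/
def rightUnit : LaxSMFunctor V (C × PUnit.{1}) C := ⟨rightUnitF C, LaxStr.rightUnit V C⟩

variable (V C) in
/-- The tensor product functor of a symmetric monoidal enriched category. -/
def tens : LaxSMFunctor V (C × C) C := ⟨SymMonECategory.tens, LaxStr.tens V C⟩

variable (V C) in
/-- The unit object of a symmetric monoidal enriched category. -/
def point : LaxSMFunctor V PUnit.{1} C := ⟨pointF (unitObj V C), LaxStr.point⟩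

end LaxSMFunctor

/-- Monoidal enriched natural transformations between lax functors. -/
structure MonENatTrans (F G : LaxSMFunctor V C D) extends ENatTrans F.toF G.toF where
  monoidal_unit : F.str.ε ⊚ app (unitObj V C) = G.str.ε
  monoidal_tensor (x y : C) : F.str.μ.app (x, y) ⊚ app (tObj V x y) =
    tEl (app x) (app y) ⊚ G.str.μ.app (x, y)

/-- A monoidal enriched natural transformation is invertible if it has an inverse that is again a
monoidal enriched natural transformation. -/
def MonENatTrans.IsInvertible {F G : LaxSMFunctor V C D} (t : MonENatTrans F G) : Prop :=
  ∃ s : MonENatTrans G F, (∀ x, t.app x ⊚ s.app x = eId V (F.toF.obj x)) ∧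
    ∀ x, s.app x ⊚ t.app x = eId V (G.toF.obj x)

/-- Invertible monoidal enriched natural transformations. -/
structure MonENatIso (F G : LaxSMFunctor V C D) where
  hom : MonENatTrans F G
  inv : MonENatTrans G F
  hom_inv (x : C) : hom.app x ⊚ inv.app x = eId V (F.toF.obj x)
  inv_hom (x : C) : inv.app x ⊚ hom.app x = eId V (G.toF.obj x)

theorem elComp_inv_key {C : Type w} [EnrichedCategory V C] {x x' y y' : C}
    {p : 𝟙_ V ⟶ (x ⟶[V] x')} {p' : 𝟙_ V ⟶ (x' ⟶[V] x)} {q : 𝟙_ V ⟶ (y ⟶[V] y')}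
    {q' : 𝟙_ V ⟶ (y' ⟶[V] y)} {m : 𝟙_ V ⟶ (x ⟶[V] y)} {n : 𝟙_ V ⟶ (x' ⟶[V] y')}
    (hp : p' ⊚ p = eId V x') (hq : q ⊚ q' = eId V y) (h : m ⊚ q = p ⊚ n) :
    n ⊚ q' = p' ⊚ m := by
  have h' : n = p' ⊚ m ⊚ q := by rw [h, ← elComp_assoc, hp, id_elComp]
  rw [h', elComp_assoc, elComp_assoc, hq, elComp_id]

/-- The inverse of a monoidal enriched transformation is monoidal. -/
def MonENatIso.ofHom {F G : LaxSMFunctor V C D} (i : ENatIso F.toF G.toF)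
    (hε : F.str.ε ⊚ i.hom.app (unitObj V C) = G.str.ε)
    (hμ : ∀ x y : C, F.str.μ.app (x, y) ⊚ i.hom.app (tObj V x y) =
      tEl (i.hom.app x) (i.hom.app y) ⊚ G.str.μ.app (x, y)) : MonENatIso F G where
  hom :=
    { i.hom with
      monoidal_unit := hε
      monoidal_tensor := hμ }
  inv :=
    { i.inv with
      monoidal_unit := by
        rw [← hε, elComp_assoc]
        exact (congrArg _ (i.hom_inv _)).trans (elComp_id _)
      monoidal_tensor x y := elComp_inv_key
        ((tEl_comp _ _ _ _).symm.trans ((congrArg₂ tEl (i.inv_hom x) (i.inv_hom y)).trans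
          (tEl_id _ _))) (i.hom_inv _) (hμ x y) }
  hom_inv := i.hom_inv
  inv_hom := i.inv_hom

variable (V) in
/-- Pseudo-monoids in the monoidal 2-category of symmetric monoidal enriched categories, lax
symmetric monoidal enriched functors and monoidal enriched natural transformations. -/
structure PseudoMonoid (A : Type w) [EnrichedCategory V A] [SymMonECategory V A] where
  mul : LaxSMFunctor V (A × A) A
  unit : LaxSMFunctor V PUnit.{1} A
  assoc : MonENatIso ((mul.prod (LaxSMFunctor.id V A)).comp mul)
    ((LaxSMFunctor.assoc V A A A).comp (((LaxSMFunctor.id V A).prod mul).comp mul))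
  left : MonENatIso ((unit.prod (LaxSMFunctor.id V A)).comp mul) (LaxSMFunctor.leftUnit V A)
  right : MonENatIso (((LaxSMFunctor.id V A).prod unit).comp mul) (LaxSMFunctor.rightUnit V A)
  pentagon (x y z t : A) :
    onEl mul.toF (pairEl (assoc.hom.app ((x, y), z)) (eId V t)) ⊚
      assoc.hom.app ((x, mul.toF.obj (y, z)), t) ⊚
        onEl mul.toF (pairEl (eId V x) (assoc.hom.app ((y, z), t))) =
      assoc.hom.app ((mul.toF.obj (x, y), z), t) ⊚ assoc.hom.app ((x, y), mul.toF.obj (z, t))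
  triangle (x y : A) :
    assoc.hom.app ((x, unit.toF.obj ⟨⟩), y) ⊚
      onEl mul.toF (pairEl (eId V x) (left.hom.app (⟨⟩, y))) =
      onEl mul.toF (pairEl (right.hom.app (x, ⟨⟩)) (eId V y))

section Canonical

variable (M : Type u) [Category.{v} M] [MonoidalCategory M]

theorem canonical_assoc_unit : ((λ_ (𝟙_ M)).inv ≫ ((λ_ (𝟙_ M)).inv ⊗ₘ 𝟙 (𝟙_ M))) ≫
    (α_ (𝟙_ M) (𝟙_ M) (𝟙_ M)).hom =
      ((λ_ (𝟙_ M)).inv ≫ (𝟙 (𝟙_ M) ⊗ₘ (λ_ (𝟙_ M)).inv)) ≫ 𝟙 _ := by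
  monoidal

theorem canonical_left_unit : ((λ_ (𝟙_ M)).inv ≫ (𝟙 (𝟙_ M) ⊗ₘ 𝟙 (𝟙_ M))) ≫
    (λ_ (𝟙_ M)).hom = 𝟙 (𝟙_ M) := by
  monoidal

theorem canonical_right_unit : ((λ_ (𝟙_ M)).inv ≫ (𝟙 (𝟙_ M) ⊗ₘ 𝟙 (𝟙_ M))) ≫
    (ρ_ (𝟙_ M)).hom = 𝟙 (𝟙_ M) := by
  monoidal

variable {M} [BraidedCategory M]

theorem canonical_assoc_tensor (a b c a' b' c' : M) :
    (tensorμ (a ⊗ b) c (a' ⊗ b') c' ≫ (tensorμ a b a' b' ⊗ₘ 𝟙 (c ⊗ c'))) ≫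
        (α_ (a ⊗ a') (b ⊗ b') (c ⊗ c')).hom =
      ((α_ a b c).hom ⊗ₘ (α_ a' b' c').hom) ≫ (tensorμ a (b ⊗ c) a' (b' ⊗ c') ≫
        (𝟙 (a ⊗ a') ⊗ₘ tensorμ b c b' c')) ≫ 𝟙 _ := by
  rw [tensorHom_id, id_tensorHom, Category.assoc, associator_monoidal, Category.comp_id]

theorem canonical_left_tensor (a a' : M) :
    (tensorμ (𝟙_ M) a (𝟙_ M) a' ≫ ((λ_ (𝟙_ M)).hom ⊗ₘ 𝟙 (a ⊗ a'))) ≫ (λ_ (a ⊗ a')).hom =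
      ((λ_ a).hom ⊗ₘ (λ_ a').hom) ≫ 𝟙 _ := by
  rw [tensorHom_id, Category.assoc, Category.comp_id, leftUnitor_monoidal]

theorem canonical_right_tensor (a a' : M) :
    (tensorμ a (𝟙_ M) a' (𝟙_ M) ≫ (𝟙 (a ⊗ a') ⊗ₘ (λ_ (𝟙_ M)).hom)) ≫ (ρ_ (a ⊗ a')).hom =
      ((ρ_ a).hom ⊗ₘ (ρ_ a').hom) ≫ 𝟙 _ := by
  rw [id_tensorHom, Category.assoc, Category.comp_id, rightUnitor_monoidal]

end Canonical

variable (V C) in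
/-- The canonical pseudo-monoid structure on a symmetric monoidal enriched category, given by its
tensor product and its unit object. -/
def PseudoMonoid.canonical : PseudoMonoid V C where
  mul := LaxSMFunctor.tens V C
  unit := LaxSMFunctor.point V C
  assoc := MonENatIso.ofHom (SymMonECategory.associator (V := V) (C := C))
    ((canonical_assoc_unit (Und V C)).trans (congrArg (elComp _)
      (onEl_id (((LaxSMFunctor.id V C).prod (LaxSMFunctor.tens V C)).comp
        (LaxSMFunctor.tens V C)).toF (unitObj V C, (unitObj V C, unitObj V C))).symm))
    (fun x y => (canonical_assoc_tensor (M := Und V C) x.1.1 x.1.2 x.2 y.1.1 y.1.2 y.2).trans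
      (congrArg (fun k => elComp _ (elComp _ k))
      (onEl_id (((LaxSMFunctor.id V C).prod (LaxSMFunctor.tens V C)).comp
        (LaxSMFunctor.tens V C)).toF (tObj V x.1.1 y.1.1, (tObj V x.1.2 y.1.2,
          tObj V x.2 y.2))).symm))
  left := MonENatIso.ofHom (SymMonECategory.leftUnitor (V := V) (C := C))
    (canonical_left_unit (Und V C))
    (fun x y => canonical_left_tensor (M := Und V C) x.2 y.2)
  right := MonENatIso.ofHom (SymMonECategory.rightUnitor (V := V) (C := C))
    (canonical_right_unit (Und V C))
    (fun x y => canonical_right_tensor (M := Und V C) x.1 y.1)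
  pentagon := SymMonECategory.pentagon
  triangle := SymMonECategory.triangle

/-- Right module structures over a pseudo-monoid `A` on a symmetric monoidal enriched category `M`
(in the oplax sense) with a given action 1-morphism `M ⊗ A ⟶ M`: the structural 2-morphisms
`assoc` and `unit` go from `(m · a) · b` to `m · (a b)` and from `m` to `m · 1`, and they satisfy
the pentagon axiom and the two unit axioms. -/
structure RightModuleStr {A : Type w₁} [EnrichedCategory V A] [SymMonECategory V A]
    {M : Type w₂} [EnrichedCategory V M] [SymMonECategory V M]
    (P : PseudoMonoid V A) (act : LaxSMFunctor V (M × A) M) where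
  assoc : MonENatTrans ((act.prod (LaxSMFunctor.id V A)).comp act)
    ((LaxSMFunctor.assoc V M A A).comp (((LaxSMFunctor.id V M).prod P.mul).comp act))
  unit : MonENatTrans (LaxSMFunctor.rightUnit V M)
    (((LaxSMFunctor.id V M).prod P.unit).comp act)
  pentagon (m : M) (a b c : A) :
    assoc.app ((act.toF.obj (m, a), b), c) ⊚ assoc.app ((m, a), P.mul.toF.obj (b, c)) =
      onEl act.toF (pairEl (assoc.app ((m, a), b)) (eId V c)) ⊚
        assoc.app ((m, P.mul.toF.obj (a, b)), c) ⊚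
          onEl act.toF (pairEl (eId V m) (P.assoc.hom.app ((a, b), c)))
  left_unit (m : M) (a : A) :
    onEl act.toF (pairEl (unit.app (m, ⟨⟩)) (eId V a)) ⊚
      assoc.app ((m, P.unit.toF.obj ⟨⟩), a) ⊚
        onEl act.toF (pairEl (eId V m) (P.left.hom.app (⟨⟩, a))) = eId V (act.toF.obj (m, a))
  right_unit (m : M) (a : A) :
    unit.app (act.toF.obj (m, a), ⟨⟩) ⊚ assoc.app ((m, a), P.unit.toF.obj ⟨⟩) ⊚
        onEl act.toF (pairEl (eId V m) (P.right.hom.app (a, ⟨⟩))) = eId V (act.toF.obj (m, a))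

/-- A right module is strong if its two structural 2-morphisms are invertible. -/
def RightModuleStr.IsStrong {A : Type w₁} [EnrichedCategory V A] [SymMonECategory V A]
    {M : Type w₂} [EnrichedCategory V M] [SymMonECategory V M]
    {P : PseudoMonoid V A} {act : LaxSMFunctor V (M × A) M} (S : RightModuleStr P act) : Prop :=
  S.assoc.IsInvertible ∧ S.unit.IsInvertible

end TwoCategory

section Curry

variable {V : Type u} [Category.{v} V] [MonoidalCategory V] [MonoidalClosed V]

/-- The currying morphism `[x', [x, y]] ⟶ [x ⊗ x', y]`. -/
def curryHom (x x' y : V) : iHom x' (iHom x y) ⟶ iHom (x ⊗ x') y :=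
  cur ((α_ x x' (iHom x' (iHom x y))).hom ≫ x ◁ evl x' (iHom x y) ≫ evl x y)

/-- The canonical morphism `y ⟶ [𝟙, y]`. -/
def unitHom (y : V) : y ⟶ iHom (𝟙_ V) y := cur (λ_ y).hom

end Curry

end EnrichedSM

/-!
The data of the module are names `nm f` of morphisms `f` of `V`: elements `𝟙_ V ⟶ [x, y]` of
internal homs. Names compose as morphisms do (`nm_comp`), and the internal hom functor acts on names
as the ordinary internal hom `homMap` (`onEl_internalHom`). Hence every axiom that is stated on
elements is an equation between morphisms of `V` into an internal hom, and such an equation can be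
checked after uncurrying. The rules `unc_comp_homMap`, `unc_comp_curryHom`, `unc_comp_unitHom` and
`unc_homTensor` compute the uncurried morphisms and leave identities between structural morphisms
and evaluations. The associativity, unit and symmetry axioms of the lax structure are the
naturality of the constraints of `V` as a category enriched over itself. That currying is monoidal
is the associativity of `tensorμ`.

Enriched naturality is an equation between generalized elements. For the lax structure it says that
the tensor product of internal homs commutes with conjugation, which is the interchange law between
tensor product and composition used twice (`conjHom_homTensor`). For currying it is checked in one
variable at a time: a pair of generalized elements is a composite of two pairs, each constant in
one variable, and naturality squares compose (`naturality_of_separate`). In one variable the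
internal hom is postcomposition `postHom` or precomposition `preHom`, and naturality becomes
`curryHom_natural`, `curryHom_natural_left` and `curryHom_natural_right`.

Both transformations are invertible because currying and `y ⟶ [𝟙, y]` are isomorphisms of `V`
(`curryIso`, `unitIso`).
-/

namespace EnrichedSM

/-! ### The internal hom on morphisms and the currying isomorphism -/

section Interchange

variable {V : Type u} [Category.{v} V] [MonoidalCategory V] [SymmetricCategory V]

theorem tensorμ_tensorμ (A B X Y : V) : tensorμ A B X Y ≫ tensorμ A X B Y = 𝟙 _ := by
  have h : A ◁ (β_ B X).hom ▷ Y ≫ A ◁ (β_ X B).hom ▷ Y = 𝟙 _ := by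
    rw [← MonoidalCategory.whiskerLeft_comp, ← comp_whiskerRight, SymmetricCategory.symmetry]
    simp
  simp [tensorμ, reassoc_of% h]

theorem tensorμ_tensorμ_assoc (A B X Y : V) {Z : V} (h : (A ⊗ B) ⊗ (X ⊗ Y) ⟶ Z) :
    tensorμ A B X Y ≫ tensorμ A X B Y ≫ h = h := by
  rw [← Category.assoc, tensorμ_tensorμ, Category.id_comp]

end Interchange

section HomMap
open Opposite

variable {V : Type u} [Category.{v} V] [MonoidalCategory V] [MonoidalClosed V]

/-- The action `[x, y] ⟶ [z, t]` of the internal hom on morphisms `z ⟶ x` and `y ⟶ t`. -/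
def homMap {x y z t : V} (g : z ⟶ x) (f : y ⟶ t) : iHom x y ⟶ iHom z t :=
  cur (g ▷ iHom x y ≫ evl x y ≫ f)

theorem unc_id (x y : V) : unc (𝟙 (iHom x y)) = evl x y := by
  rw [unc_eq]; simp

theorem eq_nm {x y : V} {a : 𝟙_ V ⟶ iHom x y} {f : x ⟶ y} (h : unc a = (ρ_ x).hom ≫ f) :
    a = nm f :=
  unc_injective (h.trans (unc_nm f).symm)

theorem unc_comp_homMap {c x y z t : V} (k : c ⟶ iHom x y) (g : z ⟶ x) (f : y ⟶ t) :
    unc (k ≫ homMap g f) = g ▷ c ≫ unc k ≫ f := by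
  rw [unc_comp, homMap, unc_cur, whisker_exchange_assoc, unc_eq, Category.assoc]

theorem comp_homMap {c x y z t : V} (k : c ⟶ iHom x y) (g : z ⟶ x) (f : y ⟶ t) :
    k ≫ homMap g f = prec (nm g) (postc k (nm f)) := by
  apply unc_injective
  rw [unc_comp_homMap, unc_prec, unc_postc]

theorem homMap_comp_homMap {x y z t p q : V} (g : z ⟶ x) (f : y ⟶ t) (g' : p ⟶ z) (f' : t ⟶ q) :
    homMap g f ≫ homMap g' f' = homMap (g' ≫ g) (f ≫ f') := by
  apply unc_injective
  rw [unc_comp_homMap, ← Category.id_comp (homMap g f), unc_comp_homMap,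
    ← Category.id_comp (homMap (g' ≫ g) (f ≫ f')), unc_comp_homMap]
  simp

/-- Up to associativity, uncurrying a composite with the currying morphism is uncurrying twice. -/
theorem unc_comp_curryHom {c x x' y : V} (k : c ⟶ iHom x' (iHom x y)) :
    unc (k ≫ curryHom x x' y) = (α_ x x' c).hom ≫ unc (unc k) := by
  rw [unc_comp, curryHom, unc_cur, unc_eq (unc k), unc_eq k]
  simp

theorem unc_comp_unitHom {c y : V} (k : c ⟶ y) :
    unc (k ≫ unitHom y) = (λ_ c).hom ≫ k := by
  rw [unc_comp, unitHom, unc_cur, leftUnitor_naturality]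

/-- The inverse of the currying morphism. -/
def curryHomInv (x x' y : V) : iHom (x ⊗ x') y ⟶ iHom x' (iHom x y) :=
  cur (cur ((α_ x x' _).inv ≫ evl (x ⊗ x') y))

/-- The inverse of the canonical morphism `y ⟶ [𝟙, y]`. -/
def unitHomInv (y : V) : iHom (𝟙_ V) y ⟶ y := (λ_ _).inv ≫ evl (𝟙_ V) y

theorem unc_unc_comp_curryHomInv {c x x' y : V} (k : c ⟶ iHom (x ⊗ x') y) :
    unc (unc (k ≫ curryHomInv x x' y)) = (α_ x x' c).inv ≫ unc k := by
  rw [unc_comp, unc_comp, curryHomInv, unc_cur, unc_cur, unc_eq k]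
  simp

/-- The currying isomorphism. -/
def curryIso (x x' y : V) : iHom x' (iHom x y) ≅ iHom (x ⊗ x') y where
  hom := curryHom x x' y
  inv := curryHomInv x x' y
  hom_inv_id := by
    apply unc_injective
    apply unc_injective
    rw [unc_unc_comp_curryHomInv, ← Category.id_comp (curryHom x x' y), unc_comp_curryHom,
      Iso.inv_hom_id_assoc]
  inv_hom_id := by
    apply unc_injective
    rw [unc_comp_curryHom, ← Category.id_comp (curryHomInv x x' y), unc_unc_comp_curryHomInv,
      Iso.hom_inv_id_assoc]

/-- The canonical isomorphism `y ≅ [𝟙, y]`. -/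
def unitIso (y : V) : y ≅ iHom (𝟙_ V) y where
  hom := unitHom y
  inv := unitHomInv y
  hom_inv_id := by
    have h := unc_comp_unitHom (𝟙 y)
    rw [Category.id_comp, Category.comp_id, unc_eq] at h
    rw [unitHomInv, leftUnitor_inv_naturality_assoc, h, Iso.inv_hom_id]
  inv_hom_id := by
    apply unc_injective
    rw [unc_comp_unitHom, unitHomInv, Iso.hom_inv_id_assoc, unc_id]

end HomMap

section Action
open Opposite
variable {V : Type u} [Category.{v} V] [MonoidalCategory V] [SymmetricCategory V]
  [MonoidalClosed V]

/-- In the covariant variable the internal hom acts by postcomposition. -/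
theorem unc_internalHom_left {c x y t : V} (f : c ⟶ iHom y t) :
    unc ((pairGen f (eId V (op x)) : c ⊗ 𝟙_ V ⟶ ((y, op x) ⟶[V] (t, op x))) ≫
      (internalHom V).map (y, op x) (t, op x)) =
      iHom x y ◁ ((ρ_ c).hom ≫ f) ≫ eComp V x y t := by
  -- `h` says that composing with the name `b` of an identity does nothing.
  have key : ∀ {P A B Q : V} (f : c ⟶ A) (b : 𝟙_ V ⟶ B) (m : P ⊗ A ⟶ Q) (n : B ⊗ Q ⟶ Q),
      b ▷ Q ≫ n = (λ_ Q).hom →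
      P ◁ (f ⊗ₘ b) ≫ (α_ P A B).inv ≫ m ▷ B ≫ (β_ Q B).hom ≫ n =
        P ◁ ((ρ_ c).hom ≫ f) ≫ m := by
    intro P A B Q f b m n h
    rw [MonoidalCategory.tensorHom_def]
    simp only [MonoidalCategory.whiskerLeft_comp, Category.assoc,
      associator_inv_naturality_right_assoc]
    rw [whisker_exchange_assoc, braiding_naturality_right_assoc, h]
    simp
  have h := e_id_comp V x t
  rw [Iso.inv_comp_eq, Category.comp_id] at h
  exact (unc_comp _ _).trans ((congrArg _ (unc_cur _)).trans (key f (eId V x) _ _ h))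

/-- In the contravariant variable the internal hom acts by precomposition. -/
theorem unc_internalHom_right {d x y z : V} (g : d ⟶ iHom z x) :
    unc ((pairGen (eId V y) g : 𝟙_ V ⊗ d ⟶ ((y, op x) ⟶[V] (y, op z))) ≫
      (internalHom V).map (y, op x) (y, op z)) =
      iHom x y ◁ ((λ_ d).hom ≫ g) ≫ (β_ _ _).hom ≫ eComp V z x y := by
  -- `h` says that composing with the name `a` of an identity does nothing.
  have key : ∀ {P A B Q : V} (a : 𝟙_ V ⟶ A) (g : d ⟶ B) (m : P ⊗ A ⟶ P) (n : B ⊗ P ⟶ Q),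
      P ◁ a ≫ m = (ρ_ P).hom →
      P ◁ (a ⊗ₘ g) ≫ (α_ P A B).inv ≫ m ▷ B ≫ (β_ P B).hom ≫ n =
        P ◁ ((λ_ d).hom ≫ g) ≫ (β_ P B).hom ≫ n := by
    intro P A B Q a g m n h
    rw [MonoidalCategory.tensorHom_def']
    simp only [MonoidalCategory.whiskerLeft_comp, Category.assoc,
      associator_inv_naturality_middle_assoc]
    rw [← comp_whiskerRight_assoc, h, triangle_assoc_comp_right_assoc,
      ← MonoidalCategory.whiskerLeft_comp_assoc, leftUnitor_naturality]
    simp only [MonoidalCategory.whiskerLeft_comp, Category.assoc]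
  have h := e_comp_id V x y
  rw [Iso.inv_comp_eq, Category.comp_id] at h
  exact (unc_comp _ _).trans ((congrArg _ (unc_cur _)).trans (key (eId V y) g _ _ h))

/-- On elements the internal hom functor is the ordinary internal hom. -/
theorem onEl_internalHom {x y z t : V} (f : y ⟶ t) (g : z ⟶ x) :
    onEl (internalHom V) (pairEl (x := y) (y := t) (x' := op x) (y' := op z) (nm f) (nm g)) =
      nm (homMap g f) := by
  have key₁ : ∀ {P A Q : V} (a : 𝟙_ V ⟶ A) (m : P ⊗ A ⟶ Q),
      P ◁ (λ_ (𝟙_ V)).inv ≫ P ◁ ((ρ_ (𝟙_ V)).hom ≫ a) ≫ m =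
        (ρ_ P).hom ≫ (ρ_ P).inv ≫ (𝟙 P ⊗ₘ a) ≫ m := by
    intro P A Q a m
    rw [Iso.hom_inv_id_assoc, ← MonoidalCategory.whiskerLeft_comp_assoc, ← unitors_equal,
      Iso.inv_hom_id_assoc, id_tensorHom]
  have key₂ : ∀ {P A Q : V} (a : 𝟙_ V ⟶ A) (m : A ⊗ P ⟶ Q),
      P ◁ (λ_ (𝟙_ V)).inv ≫ P ◁ ((λ_ (𝟙_ V)).hom ≫ a) ≫ (β_ P A).hom ≫ m =
        (ρ_ P).hom ≫ (λ_ P).inv ≫ (a ⊗ₘ 𝟙 P) ≫ m := by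
    intro P A Q a m
    rw [← MonoidalCategory.whiskerLeft_comp_assoc, Iso.inv_hom_id_assoc,
      braiding_naturality_right_assoc, braiding_tensorUnit_right, tensorHom_id]
    simp only [Category.assoc]
  -- Each variable is treated separately, and the pair is a composite of two such pairs.
  have h₁ : onEl (internalHom V) (pairEl (x := y) (y := t) (x' := op x) (y' := op x) (nm f)
      (eId V (op x))) = nm (homMap (𝟙 x) f) := by
    have e := comp_homMap (𝟙 (iHom x y)) (𝟙 x) f
    rw [nm_id, id_prec, Category.id_comp] at e
    rw [e]
    refine eq_nm ((congrArg unc (Category.assoc _ _ _)).trans ((unc_comp _ _).trans ?_))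
    exact (congrArg _ (unc_internalHom_left (nm f))).trans (key₁ _ _)
  have h₂ : onEl (internalHom V) (pairEl (x := t) (y := t) (x' := op x) (y' := op z) (eId V t)
      (nm g)) = nm (homMap g (𝟙 t)) := by
    have e := comp_homMap (𝟙 (iHom x t)) g (𝟙 t)
    rw [nm_id, postc_id, Category.id_comp] at e
    rw [e]
    refine eq_nm ((congrArg unc (Category.assoc _ _ _)).trans ((unc_comp _ _).trans ?_))
    exact (congrArg _ (unc_internalHom_right (nm g))).trans (key₂ _ _)
  have h := pairEl_comp (C := V) (D := Vᵒᵖ) (nm f) (eId V (op x)) (eId V t)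
    (nm g : 𝟙_ V ⟶ (op x ⟶[V] op z))
  rw [elComp_id, id_elComp] at h
  rw [← h, onEl_comp]
  refine (congrArg₂ elComp h₁ h₂).trans ((nm_comp _ _).trans (congrArg nm
    ((homMap_comp_homMap _ _ _ _).trans ?_)))
  rw [Category.comp_id, Category.comp_id]

end Action

/-! ### The lax symmetric monoidal structure of the internal hom -/

section LaxInternalHom
open Opposite
variable {V : Type u} [Category.{v} V] [MonoidalCategory V] [SymmetricCategory V]
  [MonoidalClosed V]

theorem nm_comp₃ {x y z t : V} (a : x ⟶ y) (b : y ⟶ z) (c : z ⟶ t) :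
    nm a ⊚ nm b ⊚ nm c = nm (a ≫ b ≫ c) := by
  rw [nm_comp, nm_comp]

/-- A square of generalized elements along an invertible `g` can be solved for its lower side. It
turns the naturality of a constraint of `V` into an axiom of the lax structure. -/
theorem comp_homMap_eq_of_square {c x y z t : V} {k : c ⟶ iHom x y} {l : c ⟶ iHom z t}
    {g : z ⟶ x} {g' : x ⟶ z} {f : y ⟶ t} (hg : g ≫ g' = 𝟙 z)
    (h : postc k (nm f) = prec (nm g') l) : k ≫ homMap g f = l := by
  rw [comp_homMap, h, prec_prec, nm_comp, hg, nm_id, id_prec]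

theorem homTensor_associativity (x₁ x₂ x₃ y₁ y₂ y₃ : V) :
    homTensor x₁ x₂ y₁ y₂ ▷ iHom x₃ y₃ ≫ homTensor (x₁ ⊗ x₂) x₃ (y₁ ⊗ y₂) y₃ ≫
        homMap (α_ x₁ x₂ x₃).inv (α_ y₁ y₂ y₃).hom =
      (α_ _ _ _).hom ≫ iHom x₁ y₁ ◁ homTensor x₂ x₃ y₂ y₃ ≫
        homTensor x₁ (x₂ ⊗ x₃) y₁ (y₂ ⊗ y₃) := by
  have h := self_assoc ((x₁, x₂), x₃) ((y₁, y₂), y₃)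
  have h' := comp_homMap_eq_of_square (Iso.inv_hom_id (α_ x₁ x₂ x₃)) h
  rw [← tensorHom_id, ← id_tensorHom]
  exact (Category.assoc _ _ _).symm.trans h'

theorem homTensor_left_unitality (x y : V) :
    (λ_ (iHom x y)).hom = eId V (𝟙_ V) ▷ iHom x y ≫ homTensor (𝟙_ V) x (𝟙_ V) y ≫
      homMap (λ_ x).inv (λ_ y).hom := by
  have h := self_left (V := V) ((⟨⟩ : PUnit.{1}), x) (⟨⟩, y)
  have h' := comp_homMap_eq_of_square (Iso.inv_hom_id (λ_ x)) h
  rw [← tensorHom_id]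
  exact h'.symm.trans (Category.assoc _ _ _)

theorem homTensor_right_unitality (x y : V) :
    (ρ_ (iHom x y)).hom = iHom x y ◁ eId V (𝟙_ V) ≫ homTensor x (𝟙_ V) y (𝟙_ V) ≫
      homMap (ρ_ x).inv (ρ_ y).hom := by
  have h := self_right (V := V) (x, (⟨⟩ : PUnit.{1})) (y, ⟨⟩)
  have h' := comp_homMap_eq_of_square (Iso.inv_hom_id (ρ_ x)) h
  rw [← id_tensorHom]
  exact h'.symm.trans (Category.assoc _ _ _)

theorem homTensor_braided (x x' y y' : V) :
    homTensor x x' y y' ≫ homMap (β_ x' x).hom (β_ y y').hom =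
      (β_ _ _).hom ≫ homTensor x' x y' y :=
  comp_homMap_eq_of_square (SymmetricCategory.symmetry x' x) (self_braid (x, x') (y, y'))

/-- Tensoring commutes with conjugation: this is the interchange law between the tensor product of
internal homs and composition, used twice. -/
theorem conjHom_homTensor (x y x' y' z t z' t' : V) :
    tensorμ (iHom x y) (iHom x' y') (iHom y t ⊗ iHom z x) (iHom y' t' ⊗ iHom z' x') ≫
      (conjHom x y z t ⊗ₘ conjHom x' y' z' t') ≫ homTensor z z' t t' =
    (homTensor x x' y y' ⊗ₘ (tensorμ (iHom y t) (iHom z x) (iHom y' t') (iHom z' x') ≫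
      (homTensor y y' t t' ⊗ₘ homTensor z z' x x'))) ≫
        conjHom (x ⊗ x') (y ⊗ y') (z ⊗ z') (t ⊗ t') := by
  have hc (a b c a' b' c' : V) : (eComp V a b c ⊗ₘ eComp V a' b' c') ≫ homTensor a a' c c' =
      tensorμ (iHom a b) (iHom b c) (iHom a' b') (iHom b' c') ≫
        (homTensor a a' b b' ⊗ₘ homTensor b b' c c') ≫ eComp V (a ⊗ a') (b ⊗ b') (c ⊗ c') := by
    have h := (selfTens V).map_comp (a, a') (b, b') (c, c')
    rw [prod_eComp, Category.assoc] at h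
    rw [← tensorμ_tensorμ_assoc (iHom a b) (iHom b c) (iHom a' b') (iHom b' c')
      ((eComp V a b c ⊗ₘ eComp V a' b' c') ≫ homTensor a a' c c')]
    exact congrArg _ h
  -- The same for arbitrary maps `e`, `n` in place of compositions and `hP`, …, `hR` in place of
  -- tensor products of internal homs: `h₁` and `h₂` are the two interchange laws.
  have key {P P' A A' B B' Q Q' R R' PP AA BB QQ RR : V} (e : P ⊗ A ⟶ Q) (e' : P' ⊗ A' ⟶ Q')
      (n : B ⊗ Q ⟶ R) (n' : B' ⊗ Q' ⟶ R') (hP : P ⊗ P' ⟶ PP) (hA : A ⊗ A' ⟶ AA)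
      (hB : B ⊗ B' ⟶ BB) (hQ : Q ⊗ Q' ⟶ QQ) (hR : R ⊗ R' ⟶ RR) (E : PP ⊗ AA ⟶ QQ)
      (N : BB ⊗ QQ ⟶ RR) (h₁ : (e ⊗ₘ e') ≫ hQ = tensorμ P A P' A' ≫ (hP ⊗ₘ hA) ≫ E)
      (h₂ : (n ⊗ₘ n') ≫ hR = tensorμ B Q B' Q' ≫ (hB ⊗ₘ hQ) ≫ N) :
      tensorμ P P' (A ⊗ B) (A' ⊗ B') ≫ (((α_ P A B).inv ≫ e ▷ B ≫ (β_ Q B).hom ≫ n) ⊗ₘ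
        ((α_ P' A' B').inv ≫ e' ▷ B' ≫ (β_ Q' B').hom ≫ n')) ≫ hR =
      (hP ⊗ₘ (tensorμ A B A' B' ≫ (hA ⊗ₘ hB))) ≫ (α_ PP AA BB).inv ≫ E ▷ BB ≫
        (β_ QQ BB).hom ≫ N := by
    -- The coherence of the permutations of the six factors.
    have hs : tensorμ P P' (A ⊗ B) (A' ⊗ B') ≫ ((α_ P A B).inv ⊗ₘ (α_ P' A' B').inv) ≫
        tensorμ (P ⊗ A) B (P' ⊗ A') B' ≫ tensorμ P A P' A' ▷ (B ⊗ B') =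
        (P ⊗ P') ◁ tensorμ A B A' B' ≫ (α_ _ _ _).inv := by
      have h : tensorμ P P' (A ⊗ B) (A' ⊗ B') ≫ ((α_ P A B).inv ⊗ₘ (α_ P' A' B').inv) =
          (P ⊗ P') ◁ tensorμ A B A' B' ≫ (α_ _ _ _).inv ≫ tensorμ P P' A A' ▷ (B ⊗ B') ≫
            tensorμ (P ⊗ A) (P' ⊗ A') B B' := by
        have ha := tensor_associativity_assoc P P' A A' B B'
          ((α_ P A B).inv ⊗ₘ (α_ P' A' B').inv)
        rw [tensorHom_comp_tensorHom, Iso.hom_inv_id, Iso.hom_inv_id, id_tensorHom_id,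
          Category.comp_id] at ha
        rw [ha, Iso.inv_hom_id_assoc, ← MonoidalCategory.whiskerLeft_comp_assoc, tensorμ_tensorμ,
          MonoidalCategory.whiskerLeft_id, Category.id_comp]
      rw [reassoc_of% h, tensorμ_tensorμ_assoc, ← comp_whiskerRight, tensorμ_tensorμ,
        id_whiskerRight, Category.comp_id]
    simp only [← tensorHom_comp_tensorHom, Category.assoc]
    rw [h₂, ← reassoc_of% tensorμ_braid Q B Q' B', ← tensorHom_id, ← tensorHom_id,
      tensorμ_natural_assoc, ← braiding_naturality_assoc, id_tensorHom_id,
      tensorHom_comp_tensorHom_assoc, h₁, Category.id_comp, comp_tensorHom', Category.assoc,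
      reassoc_of% hs, tensorHom_comp', Category.assoc, associator_inv_naturality_assoc,
      ← tensorHom_id, tensorHom_comp_tensorHom_assoc, Category.comp_id]
  exact key _ _ _ _ _ _ _ _ _ _ _ (hc x y t x' y' t') (hc z x t z' x' t')

variable (V) in
/-- The lax symmetric monoidal structure of the internal hom. -/
def laxInternalHom : LaxStr (internalHom V) where
  ε := nm (eId V (𝟙_ V))
  μ :=
    { app p := nm (homTensor p.1.2.unop p.2.2.unop p.1.1 p.2.1)
      naturality p q := by
        refine self_square ?_
        have h₁ := unc_homTensor
          (cur (conjHom p.1.2.unop p.1.1 q.1.2.unop q.1.1))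
          (cur (conjHom p.2.2.unop p.2.1 q.2.2.unop q.2.1))
        rw [unc_cur, unc_cur] at h₁
        have h₂ := congrArg (fun k => homTensor p.1.2.unop p.2.2.unop p.1.1 p.2.1 ▷ _ ≫ k)
          (unc_comp (tensorμ _ _ _ _ ≫ (homTensor p.1.1 p.2.1 q.1.1 q.2.1 ⊗ₘ
            homTensor q.1.2.unop q.2.2.unop p.1.2.unop p.2.2.unop))
            (cur (conjHom (p.1.2.unop ⊗ p.2.2.unop) (p.1.1 ⊗ p.2.1) (q.1.2.unop ⊗ q.2.2.unop)
              (q.1.1 ⊗ q.2.1))))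
        rw [unc_cur, ← tensorHom_def_assoc] at h₂
        exact (congrArg (fun k => k ≫ homTensor _ _ _ _) h₁).trans ((Category.assoc _ _ _).trans
          ((conjHom_homTensor _ _ _ _ _ _ _ _).trans h₂.symm)) }
  associativity x y z :=
    (congrArg₂ elComp (onEl_selfTens_left _ _)
      (congrArg (elComp _) (onEl_internalHom _ _))).trans
    ((nm_comp₃ _ _ _).trans
    ((congrArg nm (homTensor_associativity x.2.unop y.2.unop z.2.unop x.1 y.1 z.1)).trans
    ((nm_comp₃ _ _ _).symm.trans
    (congrArg (fun k => elComp _ (elComp k _)) (onEl_selfTens_right _ _)).symm)))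
  left_unitality x :=
    ((congrArg₂ elComp (onEl_selfTens_left _ _)
      (congrArg (elComp _) (onEl_internalHom _ _))).trans
    ((nm_comp₃ _ _ _).trans
      (congrArg nm (homTensor_left_unitality x.2.unop x.1).symm))).symm
  right_unitality x :=
    ((congrArg₂ elComp (onEl_selfTens_right _ _)
      (congrArg (elComp _) (onEl_internalHom _ _))).trans
    ((nm_comp₃ _ _ _).trans
      (congrArg nm (homTensor_right_unitality x.2.unop x.1).symm))).symm
  braided x y :=
    (congrArg (elComp _) (onEl_internalHom _ _)).trans ((nm_comp _ _).trans
      ((congrArg nm (homTensor_braided x.2.unop y.2.unop x.1 y.1)).trans (nm_comp _ _).symm))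

end LaxInternalHom

/-! ### Enriched naturality in each variable separately -/

section Separate

variable {V : Type u} [Category.{v} V] [MonoidalCategory V]
  {C : Type w₁} [EnrichedCategory V C] {D : Type w₂} [EnrichedCategory V D]

/-- Composition with an element between two composable generalized elements is associative. -/
theorem postc_tensorHom_eComp {c d : V} {x y z t : C} (f : c ⟶ (x ⟶[V] y))
    (b : 𝟙_ V ⟶ (y ⟶[V] z)) (g : d ⟶ (z ⟶[V] t)) :
    (postc f b ⊗ₘ g) ≫ eComp V x z t = (f ⊗ₘ prec b g) ≫ eComp V x y t := by
  have h := e_assoc V x y z t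
  rw [Iso.inv_comp_eq] at h
  have e₁ : ((f ⊗ₘ b) ≫ eComp V x y z) ⊗ₘ g =
      ((f ⊗ₘ b) ⊗ₘ g) ≫ eComp V x y z ▷ (z ⟶[V] t) := by
    rw [← tensorHom_id, tensorHom_comp_tensorHom, Category.comp_id]
  have e₂ : f ⊗ₘ ((b ⊗ₘ g) ≫ eComp V y z t) =
      (f ⊗ₘ (b ⊗ₘ g)) ≫ (x ⟶[V] y) ◁ eComp V y z t := by
    rw [← id_tensorHom, tensorHom_comp_tensorHom, Category.comp_id]
  rw [postc_eq, prec_eq, comp_tensorHom', tensorHom_comp', e₁, e₂]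
  simp only [Category.assoc]
  rw [h, associator_naturality_assoc]
  simp

/-- Naturality squares of generalized elements compose horizontally. -/
theorem square_eComp {c d : V} {x y z x' y' z' : C} {f : c ⟶ (x ⟶[V] y)} {g : d ⟶ (y ⟶[V] z)}
    {f' : c ⟶ (x' ⟶[V] y')} {g' : d ⟶ (y' ⟶[V] z')} {a : 𝟙_ V ⟶ (x ⟶[V] x')}
    {b : 𝟙_ V ⟶ (y ⟶[V] y')} {e : 𝟙_ V ⟶ (z ⟶[V] z')}
    (h₁ : postc f b = prec a f') (h₂ : postc g e = prec b g') :
    postc ((f ⊗ₘ g) ≫ eComp V x y z) e = prec a ((f' ⊗ₘ g') ≫ eComp V x' y' z') := by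
  rw [postc_eComp, h₂, ← postc_tensorHom_eComp, h₁, prec_eComp]

/-- Naturality of a family of components at a generalized element of a hom-object. Enriched
naturality is the case of the identity of the hom-object. -/
def NaturalAt {F G : EnrichedFunctor V C D} (app : ∀ x, 𝟙_ V ⟶ (F.obj x ⟶[V] G.obj x)) {c : V}
    {x y : C} (k : c ⟶ (x ⟶[V] y)) : Prop :=
  postc (k ≫ F.map x y) (app y) = prec (app x) (k ≫ G.map x y)

variable {F G : EnrichedFunctor V C D} {app : ∀ x, 𝟙_ V ⟶ (F.obj x ⟶[V] G.obj x)}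

theorem NaturalAt.precomp {c d : V} {x y : C} {k : c ⟶ (x ⟶[V] y)} (h : NaturalAt app k)
    (s : d ⟶ c) : NaturalAt app (s ≫ k) := by
  rw [NaturalAt, Category.assoc, Category.assoc]
  exact square_precomp s h

theorem NaturalAt.eComp {c d : V} {x y z : C} {k : c ⟶ (x ⟶[V] y)} {l : d ⟶ (y ⟶[V] z)}
    (h : NaturalAt app k) (h' : NaturalAt app l) : NaturalAt app ((k ⊗ₘ l) ≫ eComp V x y z) := by
  rw [NaturalAt, Category.assoc, Category.assoc, F.map_comp, G.map_comp,
    tensorHom_comp_tensorHom_assoc, tensorHom_comp_tensorHom_assoc]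
  exact square_eComp h h'

end Separate

section SeparateProduct

variable {V : Type u} [Category.{v} V] [MonoidalCategory V] [SymmetricCategory V]
  {C : Type w₁} [EnrichedCategory V C] {D : Type w₂} [EnrichedCategory V D]
  {D' : Type w₃} [EnrichedCategory V D'] {E : Type w₄} [EnrichedCategory V E]

/-- A pair of generalized elements is a composite of two pairs, one constant in each variable. -/
theorem pairGen_eq_eComp {c d : V} {x y : C} {x' y' : D} (f : c ⟶ (x ⟶[V] y))
    (g : d ⟶ (x' ⟶[V] y')) :
    pairGen f g = (((ρ_ c).inv ⊗ₘ (λ_ d).inv) ≫ tensorμ c (𝟙_ V) (𝟙_ V) d) ≫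
      (pairGen f (eId V x') ⊗ₘ pairGen (eId V y) g) ≫ eComp V (x, x') (y, x') (y, y') := by
  have h₁ : (ρ_ c).inv ≫ (f ⊗ₘ eId V y) ≫ eComp V x y y = f := postc_id f
  have h₂ : (λ_ d).inv ≫ (eId V x' ⊗ₘ g) ≫ eComp V x' x' y' = g := id_prec g
  simp only [pairGen, prod_eComp, Category.assoc]
  rw [tensorμ_natural_assoc, tensorμ_tensorμ_assoc, tensorHom_comp_tensorHom,
    tensorHom_comp_tensorHom, h₁, h₂]

/-- Pairing with a constant second variable is compatible with composition. -/
theorem pairGen_eComp_eId {c d : V} {x y z : C} (t : D) (f : c ⟶ (x ⟶[V] y))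
    (g : d ⟶ (y ⟶[V] z)) :
    pairGen ((f ⊗ₘ g) ≫ eComp V x y z) (eId V t) =
      ((c ⊗ d) ◁ (λ_ (𝟙_ V)).inv ≫ tensorμ c d (𝟙_ V) (𝟙_ V)) ≫
        (pairGen f (eId V t) ⊗ₘ pairGen g (eId V t)) ≫ eComp V (x, t) (y, t) (z, t) := by
  have h : (λ_ (𝟙_ V)).inv ≫ (eId V t ⊗ₘ eId V t) ≫ eComp V t t t = eId V t := id_prec _
  simp only [pairGen, prod_eComp, Category.assoc]
  rw [tensorμ_natural_assoc, tensorμ_tensorμ_assoc, tensorHom_comp_tensorHom, ← tensorHom_comp',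
    h]

/-- Enriched naturality on a tensor product of three enriched categories can be checked in each
variable separately. -/
theorem naturality_of_separate {F G : EnrichedFunctor V ((C × D) × D') E}
    {app : ∀ x, 𝟙_ V ⟶ (F.obj x ⟶[V] G.obj x)}
    (h₁ : ∀ (x x' : C) (y : D) (z : D'),
      NaturalAt app (pairGen (pairGen (𝟙 (x ⟶[V] x')) (eId V y)) (eId V z)))
    (h₂ : ∀ (x : C) (y y' : D) (z : D'),
      NaturalAt app (pairGen (pairGen (eId V x) (𝟙 (y ⟶[V] y'))) (eId V z)))
    (h₃ : ∀ (x : C) (y : D) (z z' : D'),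
      NaturalAt app (pairGen (eId V (x, y)) (𝟙 (z ⟶[V] z')))) (p q : (C × D) × D') :
    postc (F.map p q) (app q) = prec (app p) (G.map p q) := by
  have h₁₂ : NaturalAt app (pairGen (pairGen (𝟙 (p.1.1 ⟶[V] q.1.1)) (𝟙 (p.1.2 ⟶[V] q.1.2)))
      (eId V p.2)) := by
    rw [pairGen_eq_eComp (𝟙 (p.1.1 ⟶[V] q.1.1)), pairGen, comp_tensorHom']
    refine NaturalAt.precomp ?_ _
    refine (congrArg (NaturalAt app) (pairGen_eComp_eId _ _ _)).mpr ?_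
    exact ((h₁ _ _ _ _).eComp (h₂ _ _ _ _)).precomp _
  have h := (h₁₂.eComp (h₃ _ _ _ q.2)).precomp
    (((ρ_ _).inv ⊗ₘ (λ_ _).inv) ≫ tensorμ _ (𝟙_ V) (𝟙_ V) _)
  have e := (congrArg (NaturalAt app) (pairGen_eq_eComp (pairGen (𝟙 (p.1.1 ⟶[V] q.1.1))
    (𝟙 (p.1.2 ⟶[V] q.1.2))) (𝟙 (p.2 ⟶[V] q.2)))).mpr h
  -- The identity of a hom-object of the tensor product is a pair of identities.
  have e' : ∀ A B X : V, (𝟙 A ⊗ₘ 𝟙 B) ⊗ₘ 𝟙 X = 𝟙 ((A ⊗ B) ⊗ X) := by simp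
  have e'' := (congrArg (NaturalAt app) (e' _ _ _)).mp e
  exact square_congr (Category.id_comp _).symm (Category.id_comp _).symm e''

end SeparateProduct

/-! ### Naturality and coherence of currying -/

section Currying

variable {V : Type u} [Category.{v} V] [MonoidalCategory V] [MonoidalClosed V]

theorem unc_whiskerLeft_eComp {d x y z : V} (h : d ⟶ iHom y z) :
    unc (iHom x y ◁ h ≫ eComp V x y z) = (α_ _ _ _).inv ≫ evl x y ▷ d ≫ unc h := by
  rw [← id_tensorHom, unc_eComp, unc_id]

theorem unc_whiskerRight_eComp {d x y z : V} (g : d ⟶ iHom z x) :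
    unc (g ▷ iHom x y ≫ eComp V z x y) = (α_ _ _ _).inv ≫ unc g ▷ _ ≫ evl x y := by
  rw [← tensorHom_id, unc_eComp, unc_id]

theorem unc_curryHom (x x' y : V) :
    unc (curryHom x x' y) = (α_ _ _ _).hom ≫ x ◁ evl x' (iHom x y) ≫ evl x y :=
  unc_cur _

/-- Postcomposition with a generalized element of `[y, t]`, as a generalized element of
`[[x, y], [x, t]]`. -/
def postHom (x : V) {d y t : V} (f : d ⟶ iHom y t) : d ⟶ iHom (iHom x y) (iHom x t) :=
  cur (iHom x y ◁ f ≫ eComp V x y t)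

theorem postHom_precomp (x : V) {c d y t : V} (s : c ⟶ d) (f : d ⟶ iHom y t) :
    postHom x (s ≫ f) = s ≫ postHom x f := by
  apply unc_injective
  rw [unc_comp, postHom, postHom, unc_cur, unc_cur, MonoidalCategory.whiskerLeft_comp_assoc]

/-- Naturality of the currying morphism `[x', [x, y]] ⟶ [x ⊗ x', y]` in `y`. -/
theorem curryHom_natural {d y t : V} (x x' : V) (f : d ⟶ iHom y t) :
    postc (postHom x' (postHom x f)) (nm (curryHom x x' t)) =
      prec (nm (curryHom x x' y)) (postHom (x ⊗ x') f) := by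
  apply self_square
  apply unc_injective
  rw [unc_comp_curryHom, postHom, unc_cur, unc_whiskerLeft_eComp, postHom, unc_cur, postHom,
    unc_cur, ← Category.assoc, unc_comp, unc_whiskerLeft_eComp, unc_comp, unc_whiskerLeft_eComp,
    associator_inv_naturality_middle_assoc, ← comp_whiskerRight_assoc, ← unc_eq, unc_curryHom]
  monoidal

/-- Naturality of the canonical morphism `y ⟶ [𝟙, y]`. -/
theorem unitHom_natural {d y t : V} (f : d ⟶ iHom y t) :
    postc f (nm (unitHom t)) = prec (nm (unitHom y)) (postHom (𝟙_ V) f) := by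
  apply self_square
  apply unc_injective
  rw [unc_comp_unitHom, postHom, unc_cur, unc_comp, unc_whiskerLeft_eComp,
    associator_inv_naturality_middle_assoc, ← comp_whiskerRight_assoc, ← unc_eq, unitHom, unc_cur]
  simp

theorem curryHom_pentagon (x x' x'' y : V) :
    curryHom x' x'' (iHom x y) ≫ curryHom x (x' ⊗ x'') y =
      homMap (𝟙 x'') (curryHom x x' y) ≫ curryHom (x ⊗ x') x'' y ≫
        homMap (α_ x x' x'').inv (𝟙 y) := by
  apply unc_injective
  rw [unc_comp_curryHom, ← Category.assoc (homMap _ _), unc_comp_homMap, unc_comp_curryHom,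
    ← Category.id_comp (homMap (𝟙 x'') (curryHom x x' y)), unc_comp_homMap,
    unc_id, id_whiskerRight, Category.id_comp, unc_comp_curryHom,
    ← Category.id_comp (curryHom x' x'' (iHom x y)), unc_comp_curryHom, unc_comp, unc_id]
  simp

theorem curryHom_left_unit (x y : V) :
    homMap (𝟙 x) (unitHom y) ≫ curryHom (𝟙_ V) x y ≫ homMap (λ_ x).inv (𝟙 y) = 𝟙 _ := by
  apply unc_injective
  rw [← Category.assoc, unc_comp_homMap, unc_comp_curryHom,
    ← Category.id_comp (homMap (𝟙 x) (unitHom y)), unc_comp_homMap,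
    unc_id, id_whiskerRight, Category.id_comp, unc_comp_unitHom]
  simp

theorem curryHom_right_unit (x y : V) :
    unitHom (iHom x y) ≫ curryHom x (𝟙_ V) y ≫ homMap (ρ_ x).inv (𝟙 y) = 𝟙 _ := by
  apply unc_injective
  rw [← Category.assoc, unc_comp_homMap, unc_comp_curryHom,
    ← Category.id_comp (unitHom (iHom x y)), unc_comp_unitHom, Category.comp_id, unc_eq, unc_id]
  simp

theorem curryHom_monoidal_unit :
    (eId V (𝟙_ V) ≫ homMap (𝟙 (𝟙_ V)) (eId V (𝟙_ V))) ≫ curryHom (𝟙_ V) (𝟙_ V) (𝟙_ V) =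
      eId V (𝟙_ V) ≫ homMap (λ_ (𝟙_ V)).hom (𝟙 (𝟙_ V)) := by
  apply unc_injective
  rw [unc_comp_curryHom, unc_comp_homMap, unc_comp_homMap, unc_eId, id_whiskerRight,
    Category.id_comp, unc_comp, unc_eId]
  monoidal

theorem unitHom_monoidal_unit : unitHom (𝟙_ V) = eId V (𝟙_ V) := by
  apply unc_injective
  rw [unitHom, unc_cur, unc_eId, unitors_equal]

end Currying

section SymmetricCurrying

variable {V : Type u} [Category.{v} V] [MonoidalCategory V] [SymmetricCategory V]
  [MonoidalClosed V]

/-- Precomposition with a generalized element of `[z, x]`, as a generalized element of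
`[[x, y], [z, y]]`. -/
def preHom (y : V) {d x z : V} (g : d ⟶ iHom z x) : d ⟶ iHom (iHom x y) (iHom z y) :=
  cur (iHom x y ◁ g ≫ (β_ _ _).hom ≫ eComp V z x y)

theorem preHom_precomp (y : V) {c d x z : V} (s : c ⟶ d) (g : d ⟶ iHom z x) :
    preHom y (s ≫ g) = s ≫ preHom y g := by
  apply unc_injective
  rw [unc_comp, preHom, preHom, unc_cur, unc_cur, MonoidalCategory.whiskerLeft_comp_assoc]

theorem unc_unc_preHom (y : V) {d x z : V} (g : d ⟶ iHom z x) :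
    unc (unc (preHom y g)) = z ◁ (β_ _ _).hom ≫ (α_ _ _ _).inv ≫ unc g ▷ _ ≫ evl x y := by
  rw [preHom, unc_cur, braiding_naturality_right_assoc, unc_comp, unc_whiskerRight_eComp]

/-- Evaluating `k` after precomposition with `h`: the map `k` can be moved past `h`, so that it is
applied last. -/
theorem whiskerRight_braiding_evl {d p w x y : V} (k : p ⟶ iHom x y) (h : w ⊗ d ⟶ x) :
    w ◁ k ▷ d ≫ w ◁ (β_ (iHom x y) d).hom ≫ (α_ _ _ _).inv ≫ h ▷ iHom x y ≫ evl x y =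
      w ◁ (β_ p d).hom ≫ (α_ _ _ _).inv ≫ h ▷ p ≫ unc k := by
  rw [← MonoidalCategory.whiskerLeft_comp_assoc, braiding_naturality_left,
    MonoidalCategory.whiskerLeft_comp_assoc, associator_inv_naturality_right_assoc,
    whisker_exchange_assoc, unc_eq]

/-- Naturality of the currying morphism `[x', [x, y]] ⟶ [x ⊗ x', y]` in `x`. -/
theorem curryHom_natural_left {d x z : V} (x' y : V) (g : d ⟶ iHom z x) :
    postc (postHom x' (preHom y g)) (nm (curryHom z x' y)) =
      prec (nm (curryHom x x' y))
        (preHom y ((ρ_ d).inv ≫ (g ⊗ₘ eId V x') ≫ homTensor z x' x x')) := by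
  apply self_square
  apply unc_injective
  have e : unc ((ρ_ d).inv ≫ (g ⊗ₘ eId V x') ≫ homTensor z x' x x') =
      (α_ _ _ _).hom ≫ z ◁ (β_ x' d).hom ≫ (α_ _ _ _).inv ≫ unc g ▷ x' := by
    rw [unc_comp, unc_homTensor, unc_eId, MonoidalCategory.tensorHom_def]
    simp [tensorμ]
  rw [unc_comp_curryHom, postHom, unc_cur, unc_whiskerLeft_eComp, ← Category.assoc, unc_comp,
    unc_unc_preHom, unc_comp, unc_unc_preHom, e]
  -- The braiding moves `d` past the argument `x'` of the evaluation.
  have e' : evl x' (iHom x y) ▷ d ≫ (β_ (iHom x y) d).hom =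
      (α_ _ _ _).hom ≫ x' ◁ (β_ _ _).hom ≫ (α_ _ _ _).inv ≫ (β_ x' d).hom ▷ _ ≫
        (α_ _ _ _).hom ≫ d ◁ evl x' (iHom x y) := by
    rw [braiding_naturality_left, braiding_tensor_left_hom]
    simp only [Category.assoc]
  rw [whiskerRight_braiding_evl, unc_curryHom, ← MonoidalCategory.whiskerLeft_comp_assoc,
    Category.assoc, e', Iso.inv_hom_id_assoc]
  simp only [MonoidalCategory.whiskerLeft_comp, Category.assoc,
    associator_inv_naturality_right_assoc, whisker_exchange_assoc]
  monoidal

/-- Naturality of the currying morphism `[x', [x, y]] ⟶ [x ⊗ x', y]` in `x'`. -/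
theorem curryHom_natural_right {d x' z' : V} (x y : V) (g : d ⟶ iHom z' x') :
    postc (preHom (iHom x y) g) (nm (curryHom x z' y)) =
      prec (nm (curryHom x x' y))
        (preHom y ((λ_ d).inv ≫ (eId V x ⊗ₘ g) ≫ homTensor x z' x x')) := by
  apply self_square
  apply unc_injective
  have e : unc ((λ_ d).inv ≫ (eId V x ⊗ₘ g) ≫ homTensor x z' x x') =
      (α_ _ _ _).hom ≫ x ◁ unc g := by
    rw [unc_comp, unc_homTensor, unc_eId, MonoidalCategory.tensorHom_def]
    simp [tensorμ]
    monoidal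
  rw [unc_comp_curryHom, unc_unc_preHom, unc_comp (curryHom x x' y ▷ d), unc_unc_preHom, e,
    whiskerRight_braiding_evl, unc_curryHom, unc_eq]
  simp only [MonoidalCategory.whiskerLeft_comp, Category.assoc]
  monoidal

/-- The currying morphisms are compatible with the tensor products of internal homs. -/
theorem curryHom_monoidal (x₁ x₂ x₁' x₂' y₁ y₂ : V) :
    (homTensor x₁' x₂' (iHom x₁ y₁) (iHom x₂ y₂) ≫
      homMap (𝟙 (x₁' ⊗ x₂')) (homTensor x₁ x₂ y₁ y₂)) ≫
        curryHom (x₁ ⊗ x₂) (x₁' ⊗ x₂') (y₁ ⊗ y₂) =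
    (curryHom x₁ x₁' y₁ ⊗ₘ curryHom x₂ x₂' y₂) ≫ homTensor (x₁ ⊗ x₁') (x₂ ⊗ x₂') y₁ y₂ ≫
      homMap (tensorμ x₁ x₂ x₁' x₂') (𝟙 (y₁ ⊗ y₂)) := by
  apply unc_injective
  rw [unc_comp_curryHom, unc_comp_homMap, unc_homTensor', ← Category.assoc (_ ⊗ₘ _),
    unc_comp_homMap, unc_homTensor, unc_curryHom, unc_curryHom, id_whiskerRight, Category.id_comp,
    unc_comp, unc_homTensor', Category.comp_id]
  rw [MonoidalCategory.whiskerLeft_comp_assoc, tensorμ_natural_right_assoc,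
    ← tensor_associativity_assoc, tensorHom_comp_tensorHom, tensorHom_comp_tensorHom]

theorem unitHom_monoidal (y₁ y₂ : V) :
    unitHom (y₁ ⊗ y₂) = (unitHom y₁ ⊗ₘ unitHom y₂) ≫ homTensor (𝟙_ V) (𝟙_ V) y₁ y₂ ≫
      homMap (λ_ (𝟙_ V)).inv (𝟙 (y₁ ⊗ y₂)) := by
  apply unc_injective
  rw [← Category.assoc, unc_comp_homMap, unc_homTensor]
  simp only [unitHom, unc_cur]
  rw [Category.comp_id, tensor_left_unitality]
end SymmetricCurrying

/-! ### The internal hom as a module -/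

section Opposite
open Opposite
variable {V : Type u} [Category.{v} V] [MonoidalCategory V] [SymmetricCategory V]
  {C : Type w} [EnrichedCategory V C]

theorem op_elComp₅ {x y z t p q : Cᵒᵖ} (a : 𝟙_ V ⟶ (x ⟶[V] y)) (b : 𝟙_ V ⟶ (y ⟶[V] z))
    (c : 𝟙_ V ⟶ (z ⟶[V] t)) (d : 𝟙_ V ⟶ (t ⟶[V] p)) (e : 𝟙_ V ⟶ (p ⟶[V] q)) :
    a ⊚ b ⊚ c ⊚ d ⊚ e = elComp (C := C) (x := q.unop) (y := y.unop) (z := x.unop)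
      (elComp (C := C) (x := q.unop) (y := z.unop) (z := y.unop)
        (elComp (C := C) (x := q.unop) (y := t.unop) (z := z.unop)
          (elComp (C := C) (x := q.unop) (y := p.unop) (z := t.unop) e d) c) b) a := by
  rw [op_elComp, op_elComp, op_elComp, op_elComp]

end Opposite

section Module
open Opposite
variable {V : Type u} [Category.{v} V] [MonoidalCategory V] [SymmetricCategory V]
  [MonoidalClosed V]

/-- With a constant contravariant variable, the internal hom functor is postcomposition. -/
theorem pairGen_internalHom_left (x : V) {c y t : V} (f : c ⟶ iHom y t) :
    (pairGen f (eId V (op x)) : c ⊗ 𝟙_ V ⟶ ((y, op x) ⟶[V] (t, op x))) ≫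
      (internalHom V).map (y, op x) (t, op x) = (ρ_ c).hom ≫ postHom x f := by
  apply unc_injective
  refine (unc_internalHom_left f).trans (Eq.symm ?_)
  exact (congrArg unc (postHom_precomp x (ρ_ c).hom f)).symm.trans (unc_cur _)

/-- With a constant covariant variable, the internal hom functor is precomposition. -/
theorem pairGen_internalHom_right (y : V) {d x z : V} (g : d ⟶ iHom z x) :
    (pairGen (eId V y) g : 𝟙_ V ⊗ d ⟶ ((y, op x) ⟶[V] (y, op z))) ≫
      (internalHom V).map (y, op x) (y, op z) = (λ_ d).hom ≫ preHom y g := by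
  apply unc_injective
  refine (unc_internalHom_right g).trans (Eq.symm ?_)
  exact (congrArg unc (preHom_precomp y (λ_ d).hom g)).symm.trans (unc_cur _)

variable (V) in
/-- The internal hom as a lax symmetric monoidal enriched functor. -/
def homAction : LaxSMFunctor V (V × Vᵒᵖ) V := ⟨internalHom V, laxInternalHom V⟩

variable (V) in
/-- The functor `(y, x, x') ↦ [x', [x, y]]`. -/
def homAction₁ : LaxSMFunctor V ((V × Vᵒᵖ) × Vᵒᵖ) V :=
  ((homAction V).prod (LaxSMFunctor.id V Vᵒᵖ)).comp (homAction V)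

variable (V) in
/-- The functor `(y, x, x') ↦ [x ⊗ x', y]`. -/
def homAction₂ : LaxSMFunctor V ((V × Vᵒᵖ) × Vᵒᵖ) V :=
  (LaxSMFunctor.assoc V V Vᵒᵖ Vᵒᵖ).comp (((LaxSMFunctor.id V V).prod
    (PseudoMonoid.canonical V Vᵒᵖ).mul).comp (homAction V))

variable (V) in
/-- The functor `y ↦ [𝟙, y]`. -/
def homUnit : LaxSMFunctor V (V × PUnit.{1}) V :=
  ((LaxSMFunctor.id V V).prod (PseudoMonoid.canonical V Vᵒᵖ).unit).comp (homAction V)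

/-- The components of the associativity constraint of the action. -/
def curryApp (p : (V × Vᵒᵖ) × Vᵒᵖ) :
    𝟙_ V ⟶ iHom ((homAction₁ V).toF.obj p) ((homAction₂ V).toF.obj p) :=
  nm (curryHom p.1.2.unop p.2.unop p.1.1)

theorem homAction₁_map {c d : V} {p q : V × Vᵒᵖ} {x z : Vᵒᵖ} (f : c ⟶ (p ⟶[V] q))
    (g : d ⟶ (x ⟶[V] z)) :
    pairGen f g ≫ (homAction₁ V).toF.map (p, x) (q, z) =
      (pairGen (f ≫ (internalHom V).map p q) g : _ ⟶ (((internalHom V).obj p, x) ⟶[V]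
        ((internalHom V).obj q, z))) ≫ (internalHom V).map _ _ := by
  have key {A A' B N : V} (f : c ⟶ A) (g : d ⟶ B) (k : A ⟶ A') (l : A' ⊗ B ⟶ N) :
      (f ⊗ₘ g) ≫ (k ⊗ₘ 𝟙 B) ≫ l = ((f ≫ k) ⊗ₘ g) ≫ l := by
    rw [tensorHom_comp_tensorHom_assoc, Category.comp_id]
  exact key _ _ _ _

theorem homAction₂_map {c d d' : V} {y t : V} {x z x' z' : Vᵒᵖ} (f : c ⟶ iHom y t)
    (g : d ⟶ (x ⟶[V] z)) (g' : d' ⟶ (x' ⟶[V] z')) :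
    pairGen (pairGen f g) g' ≫ (homAction₂ V).toF.map ((y, x), x') ((t, z), z') =
      (α_ c d d').hom ≫ (pairGen f (pairGen g g' ≫ (opTens V V).map (x, x') (z, z')) :
        _ ⟶ ((y, op (x.unop ⊗ x'.unop)) ⟶[V] (t, op (z.unop ⊗ z'.unop)))) ≫
          (internalHom V).map _ _ := by
  have key {A B B' N M : V} (f : c ⟶ A) (g : d ⟶ B) (g' : d' ⟶ B') (k : B ⊗ B' ⟶ N)
      (l : A ⊗ N ⟶ M) :
      ((f ⊗ₘ g) ⊗ₘ g') ≫ (α_ A B B').hom ≫ (𝟙 A ⊗ₘ k) ≫ l =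
        (α_ c d d').hom ≫ (f ⊗ₘ ((g ⊗ₘ g') ≫ k)) ≫ l := by
    rw [associator_naturality_assoc, tensorHom_comp_tensorHom_assoc, Category.comp_id]
  exact key _ _ _ _ _

theorem curryApp_natural_left (x x' y t : V) : NaturalAt (curryApp (V := V))
    (pairGen (pairGen (𝟙 (iHom y t)) (eId V (op x))) (eId V (op x'))) := by
  refine square_congr ((homAction₁_map _ _).trans ((congrArg (fun k => pairGen k _ ≫ _)
    (pairGen_internalHom_left x (𝟙 (iHom y t)))).trans (pairGen_internalHom_left x' _))) ?_
    (square_precomp _ (square_congr (postHom_precomp _ _ _) rfl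
      (square_precomp _ (curryHom_natural x x' (𝟙 (iHom y t))))))
  have h := (opTens V V).map_id (op x, op x')
  have h' : pairGen (eId V (op x)) (eId V (op x')) ≫ (opTens V V).map (op x, op x') (op x, op x') =
      (λ_ (𝟙_ V)).hom ≫ eId V (op (x ⊗ x')) := by
    rw [prod_eId, Category.assoc, Iso.inv_comp_eq] at h
    exact h
  have e (A : V) : (α_ A (𝟙_ V) (𝟙_ V)).hom ≫ A ◁ (λ_ (𝟙_ V)).hom ≫ (ρ_ A).hom =
      (ρ_ (A ⊗ 𝟙_ V)).hom ≫ (ρ_ A).hom := by monoidal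
  refine (homAction₂_map _ _ _).trans ((congrArg (fun k => _ ≫ pairGen _ k ≫ _) h').trans ?_)
  refine (congrArg (fun k => _ ≫ k ≫ _) (tensorHom_comp' _ _ _)).trans ?_
  refine (congrArg _ ((Category.assoc _ _ _).trans (congrArg _
    (pairGen_internalHom_left (x ⊗ x') (𝟙 (iHom y t)))))).trans ?_
  exact (reassoc_of% e (iHom y t)) _

theorem curryApp_natural_middle (x z x' y : V) : NaturalAt (curryApp (V := V))
    (pairGen (pairGen (eId V y) (𝟙 (op x ⟶[V] op z))) (eId V (op x'))) := by
  refine square_congr ((homAction₁_map _ _).trans ((congrArg (fun k => pairGen k _ ≫ _)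
    (pairGen_internalHom_right y (𝟙 (iHom z x)))).trans (pairGen_internalHom_left x' _))) ?_
    (square_precomp _ (square_congr (postHom_precomp _ _ _) rfl
      (square_precomp _ (curryHom_natural_left x' y (𝟙 (iHom z x))))))
  have e (A : V) : (α_ (𝟙_ V) A (𝟙_ V)).hom ≫ (λ_ (A ⊗ 𝟙_ V)).hom =
      (ρ_ (𝟙_ V ⊗ A)).hom ≫ (λ_ A).hom ≫ (ρ_ A).inv := by monoidal
  refine (homAction₂_map _ _ _).trans ((congrArg _ (pairGen_internalHom_right y _)).trans ?_)
  refine Eq.trans ?_ (congrArg (fun k => _ ≫ _ ≫ k) (preHom_precomp _ _ _).symm)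
  exact (reassoc_of% e (iHom z x)) _

theorem curryApp_natural_right (x x' z' y : V) : NaturalAt (curryApp (V := V))
    (pairGen (eId V (y, op x)) (𝟙 (op x' ⟶[V] op z'))) := by
  refine square_congr ((homAction₁_map _ _).trans ((congrArg (fun k => pairGen k _ ≫ _)
    ((internalHom V).map_id (y, op x))).trans
      (pairGen_internalHom_right (iHom x y) (𝟙 (iHom z' x'))))) ?_
    (square_precomp _ (curryHom_natural_right x y (𝟙 (iHom z' x'))))
  have e (A : V) : (λ_ (𝟙_ V)).inv ▷ A ≫ (α_ (𝟙_ V) (𝟙_ V) A).hom ≫ (λ_ (𝟙_ V ⊗ A)).hom =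
      (λ_ A).hom ≫ (λ_ A).inv := by monoidal
  have h : pairGen (eId V (y, op x)) (𝟙 (op x' ⟶[V] op z')) = (λ_ (𝟙_ V)).inv ▷ _ ≫
      pairGen (pairGen (eId V y) (eId V (op x))) (𝟙 (op x' ⟶[V] op z')) := comp_tensorHom' _ _ _
  refine ((congrArg (fun k => k ≫ _) h).trans (Category.assoc _ _ _)).trans ?_
  refine (congrArg _ ((homAction₂_map _ _ _).trans (congrArg _
    (pairGen_internalHom_right y _)))).trans ?_
  refine Eq.trans ?_ (congrArg (fun k => _ ≫ k) (preHom_precomp _ _ _).symm)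
  exact (reassoc_of% e (iHom z' x')) _

theorem curryApp_natural (p q : (V × Vᵒᵖ) × Vᵒᵖ) :
    postc ((homAction₁ V).toF.map p q) (curryApp q) =
      prec (curryApp p) ((homAction₂ V).toF.map p q) :=
  naturality_of_separate (fun y t x x' => curryApp_natural_left x.unop x'.unop y t)
    (fun y x z x' => curryApp_natural_middle x.unop z.unop x'.unop y)
    (fun y x x' z' => curryApp_natural_right x.unop x'.unop z'.unop y) p q

variable (V) in
/-- Currying as an invertible enriched natural transformation. -/
def curryNatIso : ENatIso (homAction₁ V).toF (homAction₂ V).toF where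
  hom :=
    { app := curryApp
      naturality := curryApp_natural }
  inv :=
    { app p := nm (curryHomInv p.1.2.unop p.2.unop p.1.1)
      naturality p q := square_inv (nm_inv_hom (curryIso _ _ _)) (nm_hom_inv (curryIso _ _ _))
        (curryApp_natural p q) }
  hom_inv _ := nm_hom_inv (curryIso _ _ _)
  inv_hom _ := nm_inv_hom (curryIso _ _ _)

theorem unitHom_square (p q : V × PUnit.{1}) :
    postc ((LaxSMFunctor.rightUnit V V).toF.map p q) (nm (unitHom q.1)) =
      prec (nm (unitHom p.1)) ((homUnit V).toF.map p q) := by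
  refine square_congr (Category.comp_id _).symm ?_
    (square_precomp (ρ_ _).hom (unitHom_natural (𝟙 (iHom p.1 q.1))))
  exact pairGen_internalHom_left (𝟙_ V) (𝟙 (iHom p.1 q.1))

variable (V) in
/-- The canonical morphisms `y ⟶ [𝟙, y]` as an invertible enriched natural transformation. -/
def unitNatIso : ENatIso (LaxSMFunctor.rightUnit V V).toF (homUnit V).toF where
  hom :=
    { app p := nm (unitHom p.1)
      naturality := unitHom_square }
  inv :=
    { app p := nm (unitHomInv p.1)
      naturality p q := square_inv (nm_inv_hom (unitIso _)) (nm_hom_inv (unitIso _))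
        (unitHom_square p q) }
  hom_inv _ := nm_hom_inv (unitIso _)
  inv_hom _ := nm_inv_hom (unitIso _)

/-- The interchange in `Vᵒᵖ` is an interchange in `V` in the opposite direction, with the two middle
objects exchanged. -/
theorem interEl_op (x y z t : V) : interEl V (op x) (op y) (op z) (op t) =
    nm (tensorμ x z y t) := by
  have h₁ : tEl (eId V (op x)) (aInv V (op y) (op z) (op t)) = nm (x ◁ (α_ y z t).hom) :=
    onEl_selfTens_right x _
  have h₂ : tEl (eId V (op x)) (tEl (bHom V (op y) (op z)) (eId V (op t))) =
      nm (x ◁ (β_ z y).hom ▷ t) :=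
    (congrArg (fun k => onEl (selfTens V) (pairEl (eId V x) k)) (onEl_selfTens_left _ t)).trans
      (onEl_selfTens_right x _)
  have h₃ : tEl (eId V (op x)) (aHom V (op z) (op y) (op t)) = nm (x ◁ (α_ z y t).inv) :=
    onEl_selfTens_right x _
  have h₄ : interEl V (op x) (op y) (op z) (op t) = _ :=
    congrArg (elComp _) (congrArg₂ elComp h₁ (congrArg₂ elComp h₂ (congrArg₂ elComp h₃ rfl)))
  refine h₄.trans ((op_elComp₅ _ _ _ _ _).trans ?_)
  refine Eq.trans (b := (((nm (α_ x z (y ⊗ t)).hom ⊚ nm (x ◁ (α_ z y t).inv)) ⊚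
    nm (x ◁ (β_ z y).hom ▷ t)) ⊚ nm (x ◁ (α_ y z t).hom)) ⊚ nm (α_ x y (z ⊗ t)).inv) rfl ?_
  rw [nm_comp, nm_comp, nm_comp, nm_comp]
  simp only [tensorμ, Category.assoc]

theorem nm_elComp_internalHom {w x y z t : V} (h : w ⟶ iHom x y) {f : y ⟶ t} {g : z ⟶ x}
    {a : 𝟙_ V ⟶ iHom y t} {b : 𝟙_ V ⟶ iHom z x} (ha : a = nm f) (hb : b = nm g) :
    nm h ⊚ onEl (internalHom V) (pairEl (x := y) (y := t) (x' := op x) (y' := op z) a b) =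
      nm (h ≫ homMap g f) := by
  subst ha hb
  exact (congrArg (elComp _) (onEl_internalHom f g)).trans (nm_comp _ _)

theorem homAction₁_ε : (homAction₁ V).str.ε =
    nm (eId V (𝟙_ V) ≫ homMap (𝟙 (𝟙_ V)) (eId V (𝟙_ V))) :=
  nm_elComp_internalHom _ rfl (nm_id _).symm

theorem homAction₂_ε : (homAction₂ V).str.ε =
    nm (eId V (𝟙_ V) ≫ homMap (λ_ (𝟙_ V)).hom (𝟙 (𝟙_ V))) :=
  ((congrArg (elComp _) (onEl_id _ _)).trans (elComp_id _)).trans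
    (nm_elComp_internalHom _ (nm_id _).symm rfl)

theorem homAction₁_μ (p q : (V × Vᵒᵖ) × Vᵒᵖ) : (homAction₁ V).str.μ.app (p, q) =
    nm (homTensor p.2.unop q.2.unop (iHom p.1.2.unop p.1.1) (iHom q.1.2.unop q.1.1) ≫
      homMap (𝟙 (p.2.unop ⊗ q.2.unop)) (homTensor p.1.2.unop q.1.2.unop p.1.1 q.1.1)) :=
  nm_elComp_internalHom _ rfl (nm_id _).symm

theorem homAction₂_μ (p q : (V × Vᵒᵖ) × Vᵒᵖ) : (homAction₂ V).str.μ.app (p, q) =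
    nm (homTensor (p.1.2.unop ⊗ p.2.unop) (q.1.2.unop ⊗ q.2.unop) p.1.1 q.1.1 ≫
      homMap (tensorμ p.1.2.unop q.1.2.unop p.2.unop q.2.unop) (𝟙 (p.1.1 ⊗ q.1.1))) :=
  ((congrArg (elComp _) (onEl_id (((LaxSMFunctor.id V V).prod
    (PseudoMonoid.canonical V Vᵒᵖ).mul).comp (homAction V)).toF
      (p.1.1 ⊗ q.1.1, (op (p.1.2.unop ⊗ q.1.2.unop), op (p.2.unop ⊗ q.2.unop))))).trans
        (elComp_id _)).trans
    (nm_elComp_internalHom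
      (homTensor (p.1.2.unop ⊗ p.2.unop) (q.1.2.unop ⊗ q.2.unop) p.1.1 q.1.1) (nm_id _).symm
      (interEl_op p.1.2.unop p.2.unop q.1.2.unop q.2.unop))

theorem homUnit_ε : (homUnit V).str.ε = nm (eId V (𝟙_ V)) :=
  (congrArg (elComp _) (onEl_id (internalHom V) (𝟙_ V, op (𝟙_ V)))).trans (elComp_id _)

theorem homUnit_μ (p q : V × PUnit.{1}) : (homUnit V).str.μ.app (p, q) =
    nm (homTensor (𝟙_ V) (𝟙_ V) p.1 q.1 ≫ homMap (λ_ (𝟙_ V)).inv (𝟙 (p.1 ⊗ q.1))) :=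
  nm_elComp_internalHom _ (nm_id _).symm rfl

variable (V) in
/-- Currying as an invertible monoidal enriched natural transformation. -/
def curryMonIso : MonENatIso (homAction₁ V) (homAction₂ V) :=
  MonENatIso.ofHom (curryNatIso V)
    ((congrArg (fun k => elComp k _) homAction₁_ε).trans ((nm_comp _ _).trans
      ((congrArg nm curryHom_monoidal_unit).trans homAction₂_ε.symm)))
    (fun p q => (congrArg (fun k => elComp k _) (homAction₁_μ p q)).trans ((nm_comp _ _).trans
      ((congrArg nm (curryHom_monoidal _ _ _ _ _ _)).trans ((nm_comp _ _).symm.trans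
        (congrArg₂ elComp (onEl_selfTens _ _) (homAction₂_μ p q)).symm))))

variable (V) in
/-- The canonical morphisms `y ⟶ [𝟙, y]` as an invertible monoidal enriched natural
transformation. -/
def unitMonIso : MonENatIso (LaxSMFunctor.rightUnit V V) (homUnit V) :=
  MonENatIso.ofHom (unitNatIso V)
    ((id_elComp _).trans ((congrArg nm unitHom_monoidal_unit).trans homUnit_ε.symm))
    (fun p q => (id_elComp _).trans ((congrArg nm (unitHom_monoidal p.1 q.1)).trans
      ((nm_comp _ _).symm.trans
        (congrArg₂ elComp (onEl_selfTens _ _) (homUnit_μ p q)).symm)))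

theorem onEl_internalHom_left {y t : V} (x : V) (f : y ⟶ t) :
    onEl (internalHom V) (pairEl (x := y) (y := t) (x' := op x) (y' := op x) (nm f)
      (eId V (op x))) = nm (homMap (𝟙 x) f) :=
  (congrArg (fun k => onEl (internalHom V) (pairEl (x := y) (y := t) (x' := op x) (y' := op x)
    (nm f) k)) (nm_id x).symm).trans (onEl_internalHom f (𝟙 x))

theorem onEl_internalHom_right {x z : V} (y : V) (g : z ⟶ x) :
    onEl (internalHom V) (pairEl (x := y) (y := y) (x' := op x) (y' := op z) (eId V y)
      (nm g)) = nm (homMap g (𝟙 y)) :=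
  (congrArg (fun k => onEl (internalHom V) (pairEl (x := y) (y := y) (x' := op x) (y' := op z)
    k (nm g))) (nm_id y).symm).trans (onEl_internalHom (𝟙 y) g)

variable (V) in
/-- The internal hom makes `V` a right module over the pseudo-monoid `Vᵒᵖ`. -/
def homModule : RightModuleStr (PseudoMonoid.canonical V Vᵒᵖ) (homAction V) where
  assoc := (curryMonIso V).hom
  unit := (unitMonIso V).hom
  pentagon m a b c := (nm_comp _ _).trans
    ((congrArg nm (curryHom_pentagon a.unop b.unop c.unop m)).trans ((nm_comp₃ _ _ _).symm.trans
      (congrArg₂ elComp (onEl_internalHom_left _ _)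
        (congrArg (elComp _) (onEl_internalHom_right _ _))).symm))
  left_unit m a :=
    (congrArg₂ elComp (onEl_internalHom_left a.unop (unitHom m))
      (congrArg (elComp _) (onEl_internalHom_right m (λ_ a.unop).inv))).trans
      ((nm_comp₃ _ (curryHom (𝟙_ V) a.unop m) _).trans
        ((congrArg nm (curryHom_left_unit a.unop m)).trans (nm_id _)))
  right_unit m a :=
    (congrArg (fun k => elComp (nm (unitHom (iHom a.unop m)))
      (elComp (nm (curryHom a.unop (𝟙_ V) m)) k)) (onEl_internalHom_right m (ρ_ a.unop).inv)).trans
      ((nm_comp₃ _ _ _).trans ((congrArg nm (curryHom_right_unit a.unop m)).trans (nm_id _)))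

end Module

end EnrichedSM

theorem mainTheorem4 (V : Type u) [Category.{v} V] [MonoidalCategory V] [SymmetricCategory V]
    [MonoidalClosed V] :
    ∃ L : EnrichedSM.LaxStr (EnrichedSM.internalHom V),
      L.ε = EnrichedSM.nm (eId V (𝟙_ V)) ∧
      (∀ x y x' y' : V, L.μ.app ((y, Opposite.op x), (y', Opposite.op x')) =
        EnrichedSM.nm (EnrichedSM.homTensor x x' y y')) ∧
      ∃ S : EnrichedSM.RightModuleStr (EnrichedSM.PseudoMonoid.canonical V Vᵒᵖ)
          (⟨EnrichedSM.internalHom V, L⟩ : EnrichedSM.LaxSMFunctor V (V × Vᵒᵖ) V),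
        S.IsStrong ∧
        (∀ x x' y : V, S.assoc.app ((y, Opposite.op x), Opposite.op x') =
          EnrichedSM.nm (EnrichedSM.curryHom x x' y)) ∧
        (∀ y : V, S.unit.app (y, PUnit.unit) = EnrichedSM.nm (EnrichedSM.unitHom y)) := by
  exact ⟨EnrichedSM.laxInternalHom V, rfl, fun _ _ _ _ => rfl, EnrichedSM.homModule V,
    ⟨⟨(EnrichedSM.curryMonIso V).inv, (EnrichedSM.curryMonIso V).hom_inv, (EnrichedSM.curryMonIso V).inv_hom⟩,
      ⟨(EnrichedSM.unitMonIso V).inv, (EnrichedSM.unitMonIso V).hom_inv, (EnrichedSM.unitMonIso V).inv_hom⟩⟩,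
    fun _ _ _ => rfl, fun _ => rfl⟩
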